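/- **Setting.** There are $N\ge 3$ buyers with unit demand. Their valuations $X_1,\dots,X_N$ are independent with distribution $F$ supported on $[\underline x,\bar x]$, $0\le\underline x<\bar x$, with a density $f$ continuous on $[\underline x,\bar x]$ and positive on $(\underline x,\bar x)$. The virtual valuation is $\psi(x)=x-\frac{1-F(x)}{f(x)}$. Write $X_{(k)}$ for the $k$-th highest valuation. Two sellers each sell one identical unit in sequence. The second uses a second-price auction without reserve price, in which every buyer who did not get the first unit takes part and bids his valuation. The first seller chooses a mechanism. A *direct mechanism* assigns to each vector of reported types nonnegative allocation probabilities with sum at most $1$ and a payment for each buyer (with well-defined expectations). It is *incentive compatible* if truthful reporting maximizes each type's interim expected payoff over both auctions when the others are truthful, and *individually rational* if each type's truthful payoff is at least $E\max\{x-Y_{(1)},0\}$ (what the second auction gives if the first unit is withheld), where $Y_{(1)}\geq Y_{(2)}\ge\dots$ are the ordered valuations of the $N-1$ rivals. The *optimal expected revenue* is the maximum over these mechanisms of the first seller's expected total payments under truthful reporting. Let $G_1=F^{N-1}$ and $G_2=F^{N-1}+(N-1)F^{N-2}(1-F)$ be the distributions of $Y_{(1)},Y_{(2)}$, with densities $g_1,g_2$.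 Let $a_0=\inf\{t\in(\underline x,\bar x]: t+\psi(t)\ge 0\}$ and $x_0=\psi^{-1}(0)=\inf\{t\in(\underline x,\bar x]:\psi(t)\ge0\}$. Let $H=G_1$ on $[\underline x,a_0)$, $H(q)=G_1(q)+(N-1)F(q+\psi(q))^{N-2}(1-F(q))$ on $[a_0,x_0)$, and $H=G_2$ on $[x_0,\bar x]$. Define $\beta(\underline x)=0$ and, for $x>\underline x$, $$\beta(x)=\begin{cases}\dfrac1{G_1(x)}\displaystyle\int_{\underline x}^x s\,g_1(s)\,ds, & x<a_0,\\[2ex] \dfrac1{H(x)}\Big[G_1(a_0)\beta(a_0)+\displaystyle\int_{a_0}^x s\,H'(s)\,ds\Big], & a_0\le x<x_0,\\[2ex] \dfrac1{G_2(x)}\Big[G_2(x_0)\beta(x_0)+\displaystyle\int_{x_0}^x s\,g_2(s)\,ds\Big], & x\ge x_0,\end{cases}$$ where $\beta(a_0)$ and $\beta(x_0)$ on the right-hand side are given by the formula of the preceding piece, and $$H'(s)=g_1(s)+(N-1)\Big[(N-2)F(s+\psi(s))^{N-3}(1-F(s))(1+\psi'(s))f(s+\psi(s))-F(s+\psi(s))^{N-2}f(s)\Big].$$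 *Modified pay-your-bid auction.* Each buyer submits a bid. From bid $b$ the seller infers the type $\sup\{x\in[\underline x,\bar x]:\beta(x)\le b\}$ (or $\underline x$ if there is no such $x$). With $q_{(2)},q_{(3)}$ the types inferred from the second- and third-highest bids, the second-highest bidder gets the first unit if $\psi(q_{(2)})+q_{(2)}-q_{(3)}\ge0$; otherwise nobody does. The highest bidder always pays his bid, and the second-highest bidder pays his bid if the unit is allocated. If the highest bidder wins the second auction, the first seller gives him a rebate equal to the sale price there. Ties are broken by an arbitrary fixed priority order. **Theorem.** Suppose that $\psi$ is nondecreasing on $(\underline x,\bar x)$ and differentiable on $(a_0,x_0)$. Then: 1. $\beta$ is strictly increasing on $[\underline x,\bar x]$. 2. All buyers bidding according to $\beta$ is a symmetric Bayesian equilibrium of the modified pay-your-bid auction: for each buyer and each type $x\in[\underline x,\bar x]$, when the others bid according to $\beta$, no bid $b\in\mathbb R$ gives a higher expected payoff than $\beta(x)$, and bidding $\beta(x)$ gives at least $E\max\{x-Y_{(1)},0\}$. 3. The first seller's expected revenue (net of rebates) in this equilibrium is the optimal expected revenue, and it equals $E\max\{\psi(X_{(2)})+X_{(2)}-X_{(3)},\,0\}$.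 -/

import Mathlib

open MeasureTheory

noncomputable section

/-- A distribution of buyer valuations with support `[lo, hi]`, `0 ≤ lo < hi`, having a density `f`
that is continuous on the support, positive in its interior and zero outside of it. -/
structure ValueDistribution where
  lo : ℝ
  hi : ℝ
  f : ℝ → ℝ
  lo_nonneg : 0 ≤ lo
  lo_lt_hi : lo < hi
  continuousOn_f : ContinuousOn f (Set.Icc lo hi)
  f_nonneg : ∀ x, 0 ≤ f x
  f_pos : ∀ x ∈ Set.Ioo lo hi, 0 < f x
  f_eq_zero : ∀ x, x ∉ Set.Icc lo hi → f x = 0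
  integral_f : ∫ x in lo..hi, f x = 1

/-- The `k`-th highest value (`k = 1` being the highest) among the numbers `v i`, `i ∈ s`:
the largest `t` such that at least `k` of them are `≥ t`. (For `1 ≤ k ≤ s.card`.) -/
def kthHighest {ι : Type*} (s : Finset ι) (v : ι → ℝ) (k : ℕ) : ℝ :=
  sSup {t : ℝ | k ≤ (s.filter (fun i => t ≤ v i)).card}

/-- Agent `i` has the `k`-th highest of the numbers `v j`, `j ∈ s`, where ties are broken by the
priority order `σ` (a smaller `σ` has priority). -/
def IsKthHighest {N : ℕ} (σ : Equiv.Perm (Fin N)) (s : Finset (Fin N)) (v : Fin N → ℝ) (k : ℕ)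
    (i : Fin N) : Prop :=
  i ∈ s ∧ (s.filter (fun j => v i < v j ∨ (v i = v j ∧ σ j < σ i))).card + 1 = k

/-- Surplus of buyer `i ∈ s` in a second-price auction without reserve price among the buyers in `s`
who all bid their values: `max {x_i - (highest value of the others), 0}`. -/
def secondAuctionSurplus {N : ℕ} (s : Finset (Fin N)) (x : Fin N → ℝ) (i : Fin N) : ℝ :=
  max (x i - kthHighest (s.erase i) x 1) 0

namespace ValueDistribution

variable (D : ValueDistribution)

/-- The law of one valuation. -/
def law : Measure ℝ := volume.withDensity (fun x => ENNReal.ofReal (D.f x))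

/-- The law of the vector of `N` independent valuations. -/
def jointLaw (N : ℕ) : Measure (Fin N → ℝ) := Measure.pi (fun _ => D.law)

/-- The distribution function. -/
def F (x : ℝ) : ℝ := D.law.real (Set.Iic x)

/-- The virtual valuation `ψ`. -/
def psi (x : ℝ) : ℝ := x - (1 - D.F x) / D.f x

/-- `a(x) = min {a ≥ x : a + ψ(a) ≥ x}` over types `a`. The lowest type is left out of the set, which
does not affect the infimum but allows for a density vanishing there (where `ψ` is `-∞`). -/
def a (x : ℝ) : ℝ := sInf {t : ℝ | t ∈ Set.Ioc D.lo D.hi ∧ x ≤ t ∧ x ≤ t + D.psi t}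

/-- `ψ⁻¹(0)`, the threshold type at which the virtual valuation becomes nonnegative. (It is the lowest
type if `ψ` is nonnegative throughout.) -/
def psiInvZero : ℝ := sInf {t : ℝ | t ∈ Set.Ioc D.lo D.hi ∧ 0 ≤ D.psi t}

/-- Distribution of the highest of `N - 1` competing valuations. -/
def G₁ (N : ℕ) (x : ℝ) : ℝ := D.F x ^ (N - 1)

/-- Density of the highest of `N - 1` competing valuations. -/
def g₁ (N : ℕ) (x : ℝ) : ℝ := ((N : ℝ) - 1) * D.F x ^ (N - 2) * D.f x

/-- Distribution of the second-highest of `N - 1` competing valuations. -/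
def G₂ (N : ℕ) (x : ℝ) : ℝ :=
  D.F x ^ (N - 1) + ((N : ℝ) - 1) * D.F x ^ (N - 2) * (1 - D.F x)

/-- Density of the second-highest of `N - 1` competing valuations. -/
def g₂ (N : ℕ) (x : ℝ) : ℝ :=
  ((N : ℝ) - 1) * ((N : ℝ) - 2) * D.F x ^ (N - 3) * (1 - D.F x) * D.f x

/-- The probability that a buyer bidding as type `q` pays his bid. -/
def H (N : ℕ) (q : ℝ) : ℝ :=
  if D.psiInvZero ≤ q then D.G₂ N q
  else if D.a 0 ≤ q then
    D.G₁ N q + ((N : ℝ) - 1) * D.F (q + D.psi q) ^ (N - 2) * (1 - D.F q)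
  else D.G₁ N q

/-- The derivative `H'` on the middle interval `[a(0), ψ⁻¹(0))`. -/
def H' (N : ℕ) (s : ℝ) : ℝ :=
  D.g₁ N s + ((N : ℝ) - 1) *
    (((N : ℝ) - 2) * D.F (s + D.psi s) ^ (N - 3) * (1 - D.F s) * (1 + deriv D.psi s)
        * D.f (s + D.psi s)
      - D.F (s + D.psi s) ^ (N - 2) * D.f s)

/-- The bid function on `[lo, a(0))`. -/
def bidLow (N : ℕ) (x : ℝ) : ℝ := 1 / D.G₁ N x * ∫ s in D.lo..x, s * D.g₁ N s

/-- The bid function on `[a(0), ψ⁻¹(0))`. -/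
def bidMid (N : ℕ) (x : ℝ) : ℝ :=
  1 / D.H N x * (D.G₁ N (D.a 0) * D.bidLow N (D.a 0) + ∫ s in (D.a 0)..x, s * D.H' N s)

/-- The bid function on `[ψ⁻¹(0), hi]`. -/
def bidHigh (N : ℕ) (x : ℝ) : ℝ :=
  1 / D.G₂ N x * (D.G₂ N D.psiInvZero * D.bidMid N D.psiInvZero
    + ∫ s in D.psiInvZero..x, s * D.g₂ N s)

/-- The bid function `β`. At the lowest type, where nothing is ever paid, all formulas read `0/0`,
which is `0` here, the boundary condition `β(lo) = 0`. -/
def bid (N : ℕ) (x : ℝ) : ℝ :=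
  if D.psiInvZero ≤ x then D.bidHigh N x else if D.a 0 ≤ x then D.bidMid N x else D.bidLow N x

/-- The type that the seller infers from the bid `b` if buyers bid according to `β`: the highest type
bidding at most `b`, and the lowest type for bids below all `β(x)`. For a strictly increasing `β` this
is the inverse function of `β` on its range, extended to all bids. -/
def inferredType (β : ℝ → ℝ) (b : ℝ) : ℝ :=
  max D.lo (sSup {x : ℝ | x ∈ Set.Icc D.lo D.hi ∧ β x ≤ b})

/-! ### The modified pay-your-bid auction

The rule refers to the bid function `β` that the seller uses to infer types. `b` is the vector of
bids, `x` the vector of true valuations, `σ` the tie-breaking order. -/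

/-- The good is allocated (to the second-highest bidder): `ψ(q₍₂₎) + q₍₂₎ - q₍₃₎ ≥ 0` for the types
`q₍₂₎`, `q₍₃₎` inferred from the second- and third-highest bids. -/
def Allocated {N : ℕ} (β : ℝ → ℝ) (b : Fin N → ℝ) : Prop :=
  0 ≤ D.psi (D.inferredType β (kthHighest Finset.univ b 2))
    + D.inferredType β (kthHighest Finset.univ b 2) - D.inferredType β (kthHighest Finset.univ b 3)

/-- Buyer `i` gets the first good. -/
def GetsFirst {N : ℕ} (σ : Equiv.Perm (Fin N)) (β : ℝ → ℝ) (b : Fin N → ℝ) (i : Fin N) : Prop :=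
  D.Allocated β b ∧ IsKthHighest σ Finset.univ b 2 i

open scoped Classical in
/-- The buyers who take part in the second auction: all who did not get the first good. -/
def remaining {N : ℕ} (σ : Equiv.Perm (Fin N)) (β : ℝ → ℝ) (b : Fin N → ℝ) : Finset (Fin N) :=
  Finset.univ.filter (fun i => ¬ D.GetsFirst σ β b i)

/-- The sale price in the second auction: the second-highest value of its participants. -/
def secondPrice {N : ℕ} (σ : Equiv.Perm (Fin N)) (β : ℝ → ℝ) (b x : Fin N → ℝ) : ℝ :=
  kthHighest (D.remaining σ β b) x 2

open scoped Classical in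
/-- Net payment of buyer `i` to the first seller. The highest bidder pays his bid, and so does the
second-highest bidder if the good is allocated. The highest bidder gets a rebate equal to the sale
price in the second auction if he wins the second auction. -/
def netPayment {N : ℕ} (σ : Equiv.Perm (Fin N)) (β : ℝ → ℝ) (b x : Fin N → ℝ) (i : Fin N) : ℝ :=
  (if IsKthHighest σ Finset.univ b 1 i ∨ D.GetsFirst σ β b i then b i else 0)
    - (if IsKthHighest σ Finset.univ b 1 i ∧ IsKthHighest σ (D.remaining σ β b) x 1 i
        then D.secondPrice σ β b x else 0)

open scoped Classical in
/-- Payoff of buyer `i` over both periods. -/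
def auctionPayoff {N : ℕ} (σ : Equiv.Perm (Fin N)) (β : ℝ → ℝ) (b x : Fin N → ℝ) (i : Fin N) : ℝ :=
  (if D.GetsFirst σ β b i then x i else secondAuctionSurplus (D.remaining σ β b) x i)
    - D.netPayment σ β b x i

/-- Payoff of buyer `i` with valuation `x` who bids `b`, when the other buyers have the valuations
`y j`, `j ≠ i`, and bid according to `β`. -/
def deviationPayoff {N : ℕ} (σ : Equiv.Perm (Fin N)) (β : ℝ → ℝ) (i : Fin N) (x b : ℝ)
    (y : Fin N → ℝ) : ℝ :=
  D.auctionPayoff σ β (Function.update (fun j => β (y j)) i b) (Function.update y i x) i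

/-- Expected payoff of buyer `i` with valuation `x` who skips the first auction, when the first good
is withheld. -/
def outsideOption {N : ℕ} (i : Fin N) (x : ℝ) : ℝ :=
  ∫ y, secondAuctionSurplus Finset.univ (Function.update y i x) i ∂(D.jointLaw N)

/-- All buyers bidding according to `β` is a symmetric Bayesian equilibrium: for every buyer of every
type expected payoffs are well defined, no other bid does better, and participating is at least as
good as the outside option. -/
def IsSymmetricEquilibrium {N : ℕ} (σ : Equiv.Perm (Fin N)) (β : ℝ → ℝ) : Prop :=
  ∀ (i : Fin N), ∀ x ∈ Set.Icc D.lo D.hi,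
    (∀ b : ℝ, Integrable (D.deviationPayoff σ β i x b) (D.jointLaw N)) ∧
    (∀ b : ℝ, ∫ y, D.deviationPayoff σ β i x b y ∂(D.jointLaw N)
      ≤ ∫ y, D.deviationPayoff σ β i x (β x) y ∂(D.jointLaw N)) ∧
    D.outsideOption i x ≤ ∫ y, D.deviationPayoff σ β i x (β x) y ∂(D.jointLaw N)

/-- The first seller's revenue when valuations are `x` and everybody bids according to `β`. -/
def auctionRevenue {N : ℕ} (σ : Equiv.Perm (Fin N)) (β : ℝ → ℝ) (x : Fin N → ℝ) : ℝ :=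
  ∑ i, D.netPayment σ β (fun j => β (x j)) x i

/-- A direct mechanism for the first seller: for each vector of reported types, the probabilities
`P x i` that buyer `i` gets the good, and the payments `t x i`, which have well defined expectations
both ex ante and conditional on a report. -/
structure DirectMechanism (N : ℕ) where
  P : (Fin N → ℝ) → Fin N → ℝ
  t : (Fin N → ℝ) → Fin N → ℝ
  measurable_P : ∀ i, Measurable (fun x => P x i)
  P_nonneg : ∀ x, (∀ j, x j ∈ Set.Icc D.lo D.hi) → ∀ i, 0 ≤ P x i
  sum_P_le_one : ∀ x, (∀ j, x j ∈ Set.Icc D.lo D.hi) → ∑ i, P x i ≤ 1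
  measurable_t : ∀ i, Measurable (fun x => t x i)
  integrable_t : ∀ i, Integrable (fun x => t x i) (D.jointLaw N)
  integrable_t_update : ∀ i, ∀ q ∈ Set.Icc D.lo D.hi,
    Integrable (fun y => t (Function.update y i q) i) (D.jointLaw N)

namespace DirectMechanism

variable {D} {N : ℕ} (M : D.DirectMechanism N)

/-- Payoff of buyer `i` over both periods when types `q` are reported and `x` are the true types:
if another buyer `k` gets the first good, the second auction is among the buyers other than `k`. -/
def payoff (q x : Fin N → ℝ) (i : Fin N) : ℝ :=
  M.P q i * x i
    + ∑ k ∈ Finset.univ.erase i, M.P q k * secondAuctionSurplus (Finset.univ.erase k) x i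
    + (1 - ∑ k, M.P q k) * secondAuctionSurplus Finset.univ x i
    - M.t q i

/-- Expected payoff of buyer `i` of type `x` who reports `q`, the others being truthful. -/
def interimPayoff (i : Fin N) (q x : ℝ) : ℝ :=
  ∫ y, M.payoff (Function.update y i q) (Function.update y i x) i ∂(D.jointLaw N)

/-- (Bayesian) incentive compatibility. -/
def IncentiveCompatible : Prop :=
  ∀ i, ∀ x ∈ Set.Icc D.lo D.hi, ∀ q ∈ Set.Icc D.lo D.hi,
    M.interimPayoff i q x ≤ M.interimPayoff i x x

/-- (Interim) individual rationality; the good is withheld if a buyer does not participate. -/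
def IndividuallyRational : Prop :=
  ∀ i, ∀ x ∈ Set.Icc D.lo D.hi, D.outsideOption i x ≤ M.interimPayoff i x x

/-- The seller's expected revenue under truthful reporting. -/
def revenue : ℝ := ∫ x, ∑ i, M.t x i ∂(D.jointLaw N)

end DirectMechanism

end ValueDistribution

end

/-! The upper bound is an envelope argument in which the second auction is part of each buyer's
payoff. For a fixed report, the payoff as a function of the true type has the probability of getting
a unit in either auction as a subgradient (`gross_subgradient`). Truthful rents are therefore
determined by that probability up to the rent of the lowest type, and exchanging the order of
integration turns them into virtual valuations (`integral_law_primitive`, `integral_t_eq`). Summed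
over buyers, each unit contributes the virtual valuation of its recipient, less the price in the
second auction. Relative to withholding the first unit, which earns 0, giving it to either of the
two highest types gains ψ(x₍₂₎) + x₍₂₎ - x₍₃₎; giving it to anybody else gains only the virtual
valuation of that buyer, which is no more (`gain_cases`). This yields `revenue_le`.

The bound is attained by `optimalMechanism`, the direct version of the auction. The three pieces of
`H` are a single function `payProb`, and the three pieces of β are integrations by parts which all
say that `payProb` times (x - β(x)) is the integral of `payProb` up to x (`payProb_mul_sub_bid`).
The left side is the truthful payoff: a truthful highest type wins the second auction, and the
rebate cancels the price. Incentive compatibility is single crossing: after the report q, a true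
type z gets a unit with probability at most `payProb` at z if z ≥ q, and at least that if z ≤ q.
Reporting the lowest type reproduces the outside option, so individual rationality comes for free.

Finally, a bid b in the auction is no better than reporting the inferred type q: almost surely,
whenever the bid is paid, b is at least β(q), and the rebate depends on actually winning the second
auction. Without deviations the payments coincide almost surely, so equilibrium and revenue carry
over from the mechanism. -/

open MeasureTheory

/-! ### Order statistics of finite families. -/

section KthHighest

variable {ι : Type*} {s : Finset ι} {v w : ι → ℝ} {k : ℕ}

/-- Among the values that at least `k` members reach, take the largest one attained by a member. It
bounds every admissible `t`, so the set under the supremum is a closed half-line. -/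
theorem exists_kthHighest (hk : 1 ≤ k) (hks : k ≤ s.card) :
    ∃ j ∈ s, kthHighest s v k = v j ∧
      {t : ℝ | k ≤ (s.filter (fun i => t ≤ v i)).card} = Set.Iic (v j) := by
  classical
  have hne : (s.filter fun j => k ≤ (s.filter (fun i => v j ≤ v i)).card).Nonempty := by
    obtain ⟨j, hj, hmin⟩ := s.exists_min_image v (Finset.card_pos.mp (by omega))
    refine ⟨j, Finset.mem_filter.mpr ⟨hj, ?_⟩⟩
    rwa [Finset.filter_true_of_mem hmin]
  obtain ⟨j, hj, hmax⟩ := Finset.exists_max_image _ v hne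
  rw [Finset.mem_filter] at hj
  have hT : {t : ℝ | k ≤ (s.filter (fun i => t ≤ v i)).card} = Set.Iic (v j) := by
    ext t
    simp only [Set.mem_ofPred_eq, Set.mem_Iic]
    constructor
    · intro ht
      -- The least value that is still at least `t` is itself reached by at least `k` members, so
      -- the maximal candidate dominates it.
      obtain ⟨l, hl, hlmin⟩ := Finset.exists_min_image (s.filter fun i => t ≤ v i) v
        (Finset.card_pos.mp (by omega))
      rw [Finset.mem_filter] at hl
      refine hl.2.trans (hmax l (Finset.mem_filter.mpr ⟨hl.1, ht.trans ?_⟩))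
      refine Finset.card_le_card fun i hi => ?_
      exact Finset.mem_filter.mpr ⟨(Finset.mem_filter.mp hi).1, hlmin i hi⟩
    · intro ht
      refine hj.2.trans (Finset.card_le_card fun i hi => ?_)
      rw [Finset.mem_filter] at hi ⊢
      exact ⟨hi.1, ht.trans hi.2⟩
  refine ⟨j, hj.1, ?_, hT⟩
  rw [kthHighest, hT, csSup_Iic]

theorem le_kthHighest_iff (hk : 1 ≤ k) (hks : k ≤ s.card) {t : ℝ} :
    t ≤ kthHighest s v k ↔ k ≤ (s.filter (fun i => t ≤ v i)).card := by
  obtain ⟨j, -, h, hT⟩ := exists_kthHighest (v := v) hk hks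
  rw [h, ← Set.mem_Iic, ← hT, Set.mem_ofPred_eq]

/-- A number above `v b` can be reached only by members of `U` other than `b`, which are too few.
With this, order statistics are found by naming the top indices instead of counting. -/
theorem kthHighest_eq_of_subset {U : Finset ι} (hU : U ⊆ s) {b : ι} (hb : b ∈ U)
    (h₁ : ∀ j ∈ U, v b ≤ v j) (h₂ : ∀ j ∈ s, j ∉ U → v j ≤ v b) :
    kthHighest s v U.card = v b := by
  classical
  have hT : {t : ℝ | U.card ≤ (s.filter (fun i => t ≤ v i)).card} = Set.Iic (v b) := by
    ext t
    simp only [Set.mem_ofPred_eq, Set.mem_Iic]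
    constructor
    · intro ht
      by_contra! hlt
      have hsub : s.filter (fun i => t ≤ v i) ⊆ U.erase b := by
        intro i hi
        rw [Finset.mem_filter] at hi
        refine Finset.mem_erase.mpr ⟨fun hib => ?_, ?_⟩
        · rw [hib] at hi; linarith [hi.2]
        · by_contra hiU; linarith [h₂ i hi.1 hiU, hi.2]
      have := Finset.card_le_card hsub
      rw [Finset.card_erase_of_mem hb] at this
      have := Finset.card_pos.mpr ⟨b, hb⟩
      omega
    · intro ht
      refine Finset.card_le_card fun i hi => Finset.mem_filter.mpr ⟨hU hi, ht.trans (h₁ i hi)⟩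
  rw [kthHighest, hT, csSup_Iic]

theorem kthHighest_one_eq {a : ι} (ha : a ∈ s) (h : ∀ j ∈ s, v j ≤ v a) :
    kthHighest s v 1 = v a := by
  have := kthHighest_eq_of_subset (s := s) (v := v) (U := {a}) (b := a) (by simpa) (by simp)
    (by simp) (fun j hj _ => h j hj)
  simpa using this

theorem kthHighest_two_eq {a b : ι} (ha : a ∈ s) (hb : b ∈ s) (hab : a ≠ b) (hv : v b ≤ v a)
    (h : ∀ j ∈ s, j ≠ a → v j ≤ v b) : kthHighest s v 2 = v b := by
  classical
  have := kthHighest_eq_of_subset (s := s) (v := v) (U := {a, b}) (b := b)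
    (by intro i; simp; rintro (rfl | rfl) <;> assumption) (by simp)
    (by intro i; simp; rintro (rfl | rfl) <;> simp [hv])
    (fun j hj hU => h j hj (by rintro rfl; simp at hU))
  rwa [Finset.card_pair hab] at this

theorem kthHighest_three_eq {a b c : ι} (ha : a ∈ s) (hb : b ∈ s) (hc : c ∈ s) (hab : a ≠ b)
    (hac : a ≠ c) (hbc : b ≠ c) (hv : v b ≤ v a) (hv' : v c ≤ v b)
    (h : ∀ j ∈ s, j ≠ a → j ≠ b → v j ≤ v c) : kthHighest s v 3 = v c := by
  classical
  have := kthHighest_eq_of_subset (s := s) (v := v) (U := {a, b, c}) (b := c)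
    (by intro i; simp; rintro (rfl | rfl | rfl) <;> assumption) (by simp)
    (by intro i; simp; rintro (rfl | rfl | rfl) <;> linarith)
    (fun j hj hU => h j hj (by rintro rfl; simp at hU) (by rintro rfl; simp at hU))
  rwa [Finset.card_eq_three.mpr ⟨a, b, c, hab, hac, hbc, rfl⟩] at this

theorem kthHighest_congr (h : ∀ i ∈ s, v i = w i) : kthHighest s v k = kthHighest s w k := by
  unfold kthHighest
  congr 1
  ext t
  simp only [Set.mem_ofPred_eq]
  rw [Finset.filter_congr fun i hi => by rw [h i hi]]

theorem kthHighest_erase_update [DecidableEq ι] (i : ι) (z : ℝ) :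
    kthHighest (s.erase i) (Function.update v i z) k = kthHighest (s.erase i) v k :=
  kthHighest_congr fun j hj => by
    rw [Function.update_of_ne (Finset.ne_of_mem_erase hj)]

theorem kthHighest_mem (hk : 1 ≤ k) (hks : k ≤ s.card) {A : Set ℝ} (h : ∀ j ∈ s, v j ∈ A) :
    kthHighest s v k ∈ A := by
  obtain ⟨j, hj, hv, -⟩ := exists_kthHighest (v := v) hk hks
  exact hv ▸ h j hj

theorem measurable_kthHighest (hk : 1 ≤ k) (hks : k ≤ s.card) :
    Measurable fun v : ι → ℝ => kthHighest s v k := by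
  refine measurable_of_Ici fun t => ?_
  have : (fun v : ι → ℝ => kthHighest s v k) ⁻¹' Set.Ici t =
      {v | k ≤ ∑ i ∈ s, if t ≤ v i then 1 else 0} := by
    ext v
    simp only [Set.mem_preimage, Set.mem_Ici, Set.mem_ofPred_eq]
    rw [le_kthHighest_iff hk hks, Finset.card_filter]
  rw [this]
  refine measurableSet_le measurable_const (Finset.measurable_sum _ fun i _ => ?_)
  exact Measurable.ite (measurableSet_le measurable_const (measurable_pi_apply i))
    measurable_const measurable_const

/-- The two highest among finitely many distinct numbers. -/
theorem exists_top_two [DecidableEq ι] (hs : 2 ≤ s.card) (hv : Set.InjOn v s) :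
    ∃ a ∈ s, ∃ b ∈ s, a ≠ b ∧ v b < v a ∧ (∀ j ∈ s, j ≠ a → j ≠ b → v j < v b) := by
  obtain ⟨a, ha, hmax⟩ := s.exists_max_image v (Finset.card_pos.mp (by omega))
  obtain ⟨b, hb, hmaxb⟩ := (s.erase a).exists_max_image v
    (Finset.card_pos.mp (by rw [Finset.card_erase_of_mem ha]; omega))
  have hba := Finset.ne_of_mem_erase hb
  have hbs := Finset.mem_of_mem_erase hb
  refine ⟨a, ha, b, hbs, hba.symm, lt_of_le_of_ne (hmax b hbs) fun h => hba (hv hbs ha h),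
    fun j hj hja hjb => lt_of_le_of_ne (hmaxb j (Finset.mem_erase.mpr ⟨hja, hj⟩))
      fun h => hjb (hv hj hbs h)⟩

end KthHighest

/-! ### Subgradients and the fundamental theorem for them. -/

section Subgradient

/-- A function with a subgradient `w` on an interval is the integral of `w`, which is monotone. -/
theorem monotoneOn_of_subgradient {a b : ℝ} {V w : ℝ → ℝ}
    (h : ∀ x ∈ Set.Icc a b, ∀ z ∈ Set.Icc a b, V x + (z - x) * w x ≤ V z) :
    MonotoneOn w (Set.Icc a b) := by
  intro x hx z hz hxz
  rcases hxz.eq_or_lt with rfl | hlt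
  · rfl
  · have h1 := h x hx z hz
    have h2 := h z hz x hx
    nlinarith

/-- Over [x, z], the integral of `w` and the increment of `V` both lie between (z - x) w(x) and (z -
x) w(z). On a grid of n + 1 equal steps the errors telescope to (b - a)(w(b) - w(a))/(n + 1), which
tends to 0. No differentiability of `V` is involved. -/
theorem integral_eq_sub_of_subgradient {a b : ℝ} (hab : a ≤ b) {V w : ℝ → ℝ}
    (h : ∀ x ∈ Set.Icc a b, ∀ z ∈ Set.Icc a b, V x + (z - x) * w x ≤ V z) :
    ∫ z in a..b, w z = V b - V a := by
  have hmono := monotoneOn_of_subgradient h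
  have hint : ∀ {x z}, a ≤ x → x ≤ z → z ≤ b → IntervalIntegrable w volume x z := by
    intro x z hx hxz hz
    exact (hmono.mono (by rw [Set.uIcc_of_le hxz]; exact Set.Icc_subset_Icc hx hz)).intervalIntegrable
  have hstep : ∀ x z, a ≤ x → x ≤ z → z ≤ b →
      |(∫ t in x..z, w t) - (V z - V x)| ≤ (z - x) * (w z - w x) := by
    intro x z hx hxz hz
    have hxm : x ∈ Set.Icc a b := ⟨hx, hxz.trans hz⟩
    have hzm : z ∈ Set.Icc a b := ⟨hx.trans hxz, hz⟩
    have h1 := h x hxm z hzm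
    have h2 := h z hzm x hxm
    have h3 : ∫ t in x..z, w t ≤ ∫ t in x..z, w z :=
      intervalIntegral.integral_mono_on hxz (hint hx hxz hz) (by simp)
        fun t ht => hmono ⟨hx.trans ht.1, ht.2.trans hz⟩ hzm ht.2
    have h4 : ∫ t in x..z, w x ≤ ∫ t in x..z, w t :=
      intervalIntegral.integral_mono_on hxz (by simp) (hint hx hxz hz)
        fun t ht => hmono hxm ⟨hx.trans ht.1, ht.2.trans hz⟩ ht.1
    simp only [intervalIntegral.integral_const, smul_eq_mul] at h3 h4
    rw [abs_le]
    constructor <;> nlinarith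
  have hn : ∀ n : ℕ, |(∫ t in a..b, w t) - (V b - V a)| ≤
      (b - a) * (w b - w a) / ((n : ℝ) + 1) := by
    intro n
    set p : ℕ → ℝ := fun k => a + k * ((b - a) / (n + 1)) with hp
    have hn0 : (0 : ℝ) < n + 1 := by positivity
    have hd0 : 0 ≤ (b - a) / ((n : ℝ) + 1) := div_nonneg (by linarith) hn0.le
    have hp0 : p 0 = a := by simp [hp]
    have hpn : p (n + 1) = b := by simp only [hp]; push_cast; field_simp; ring
    have hps : ∀ k, p (k + 1) - p k = (b - a) / (n + 1) := by
      intro k; simp only [hp]; push_cast; ring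
    have hpm : Monotone p := monotone_nat_of_le_succ fun k => by linarith [hps k]
    have key : ∀ k ≤ n + 1, |(∫ t in a..p k, w t) - (V (p k) - V a)| ≤
        (b - a) / (n + 1) * (w (p k) - w a) := by
      intro k
      induction k with
      | zero => intro _; simp [hp0]
      | succ k ih =>
        intro hk
        have ih := ih (by omega)
        have ha : a ≤ p k := hp0 ▸ hpm (Nat.zero_le k)
        have hb : p (k + 1) ≤ b := hpn ▸ hpm hk
        have hkk : p k ≤ p (k + 1) := hpm (Nat.le_succ k)
        have hs := hstep (p k) (p (k + 1)) ha hkk hb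
        rw [hps] at hs
        rw [← intervalIntegral.integral_add_adjacent_intervals (hint le_rfl ha (hkk.trans hb))
          (hint ha hkk hb)]
        rw [abs_le] at *
        constructor <;> linarith [ih.1, ih.2, hs.1, hs.2]
    have := key (n + 1) le_rfl
    rw [hpn] at this
    rw [div_mul_eq_mul_div] at this
    exact this
  have hlim : Filter.Tendsto (fun n : ℕ => (b - a) * (w b - w a) / ((n : ℝ) + 1)) Filter.atTop
      (nhds 0) := by
    have := (tendsto_one_div_add_atTop_nhds_zero_nat (𝕜 := ℝ)).const_mul ((b - a) * (w b - w a))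
    simpa [div_eq_mul_inv] using this
  have := ge_of_tendsto' hlim hn
  have := abs_nonpos_iff.mp this
  linarith

end Subgradient

/-! ### The law of one valuation. -/

namespace ValueDistribution

variable (D : ValueDistribution)

theorem measurable_f : Measurable D.f := by
  classical
  have : D.f = (Set.Icc D.lo D.hi).piecewise D.f (fun _ => 0) := by
    ext x
    by_cases hx : x ∈ Set.Icc D.lo D.hi
    · simp [hx]
    · simp [hx, D.f_eq_zero x hx]
  rw [this]
  exact D.continuousOn_f.measurable_piecewise continuousOn_const measurableSet_Icc

theorem integrable_f : Integrable D.f := by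
  have h := D.continuousOn_f.integrableOn_Icc (μ := volume)
  refine (integrableOn_iff_integrable_of_support_subset fun x hx => ?_).mp h
  by_contra hx'
  exact hx (D.f_eq_zero x hx')

theorem intervalIntegrable_f (a b : ℝ) : IntervalIntegrable D.f volume a b :=
  D.integrable_f.intervalIntegrable

theorem setIntegral_Iic_lo : ∫ t in Set.Iic D.lo, D.f t = 0 := by
  rw [integral_Iic_eq_integral_Iio]
  refine setIntegral_eq_zero_of_forall_eq_zero fun t ht => D.f_eq_zero t fun h => ?_
  exact absurd h.1 (not_le.mpr ht)

theorem law_real {s : Set ℝ} (hs : MeasurableSet s) : D.law.real s = ∫ t in s, D.f t := by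
  rw [Measure.real, law, withDensity_apply _ hs,
    integral_eq_lintegral_of_nonneg_ae (ae_of_all _ D.f_nonneg)
      D.measurable_f.aestronglyMeasurable]

theorem F_eq_integral (x : ℝ) : D.F x = ∫ t in D.lo..x, D.f t := by
  rw [F, D.law_real measurableSet_Iic, ← intervalIntegral.integral_Iic_sub_Iic
    D.integrable_f.integrableOn D.integrable_f.integrableOn, D.setIntegral_Iic_lo, sub_zero]

theorem F_lo : D.F D.lo = 0 := by simp [F_eq_integral]

theorem F_hi : D.F D.hi = 1 := by rw [F_eq_integral, D.integral_f]

theorem integral_f_univ : ∫ t, D.f t = 1 := by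
  rw [← D.integral_f, intervalIntegral.integral_of_le D.lo_lt_hi.le,
    ← integral_Icc_eq_integral_Ioc]
  refine (setIntegral_eq_integral_of_forall_compl_eq_zero fun x hx => D.f_eq_zero x hx).symm

instance : IsProbabilityMeasure D.law := ⟨by
  have h : D.law.real Set.univ = 1 := by
    rw [D.law_real MeasurableSet.univ, Measure.restrict_univ, D.integral_f_univ]
  rw [Measure.real] at h
  rw [← ENNReal.ofReal_toReal (a := D.law Set.univ) (by intro h'; simp [h'] at h), h]
  simp⟩

instance : NullSingletonClass D.law := by unfold law; infer_instance

instance (N : ℕ) : IsProbabilityMeasure (D.jointLaw N) := by unfold jointLaw; infer_instance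

theorem F_mono : Monotone D.F := fun _ _ h => measureReal_mono (Set.Iic_subset_Iic.mpr h)

theorem F_nonneg (x : ℝ) : 0 ≤ D.F x := measureReal_nonneg

theorem F_le_one (x : ℝ) : D.F x ≤ 1 := measureReal_le_one

theorem F_of_le_lo {x : ℝ} (hx : x ≤ D.lo) : D.F x = 0 :=
  le_antisymm (D.F_lo ▸ D.F_mono hx) (D.F_nonneg x)

theorem F_strictMonoOn : StrictMonoOn D.F (Set.Icc D.lo D.hi) := by
  intro x hx y hy hxy
  have : D.F y - D.F x = ∫ t in x..y, D.f t := by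
    rw [F_eq_integral, F_eq_integral, intervalIntegral.integral_interval_sub_left
      (D.intervalIntegrable_f _ _) (D.intervalIntegrable_f _ _)]
  have hpos : 0 < ∫ t in x..y, D.f t :=
    intervalIntegral.intervalIntegral_pos_of_pos_on (D.intervalIntegrable_f _ _)
      (fun t ht => D.f_pos t ⟨hx.1.trans_lt ht.1, ht.2.trans_le hy.2⟩) hxy
  linarith

theorem F_pos {x : ℝ} (hx : D.lo < x) : 0 < D.F x := by
  rcases le_total x D.hi with h | h
  · exact D.F_lo ▸ D.F_strictMonoOn ⟨le_rfl, D.lo_lt_hi.le⟩ ⟨hx.le, h⟩ hx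
  · exact (D.F_hi ▸ zero_lt_one : 0 < D.F D.hi).trans_le (D.F_mono h)

theorem continuous_F : Continuous D.F := by
  have : D.F = fun x => ∫ t in D.lo..x, D.f t := funext D.F_eq_integral
  rw [this]
  exact intervalIntegral.continuous_primitive D.intervalIntegrable_f D.lo

/-- The density may jump at the two ends of the support, hence their exclusion; outside the support
it is locally zero. -/
theorem continuousAt_f {x : ℝ} (hl : x ≠ D.lo) (hh : x ≠ D.hi) : ContinuousAt D.f x := by
  have hzero : ∀ U : Set ℝ, IsOpen U → x ∈ U → (∀ t ∈ U, t ∉ Set.Icc D.lo D.hi) →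
      ContinuousAt D.f x := by
    intro U hU hx h
    refine (continuousAt_const (y := (0 : ℝ))).congr ?_
    filter_upwards [hU.mem_nhds hx] with t ht using (D.f_eq_zero t (h t ht)).symm
  rcases lt_or_gt_of_ne hl with h | h
  · exact hzero (Set.Iio D.lo) isOpen_Iio h fun t ht h' => absurd h'.1 (not_le.mpr ht)
  rcases lt_or_gt_of_ne hh with h' | h'
  · exact D.continuousOn_f.continuousAt (Icc_mem_nhds h h')
  · exact hzero (Set.Ioi D.hi) isOpen_Ioi h' fun t ht h' => absurd h'.2 (not_le.mpr ht)

theorem hasDerivAt_F {x : ℝ} (hl : x ≠ D.lo) (hh : x ≠ D.hi) : HasDerivAt D.F (D.f x) x := by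
  have : D.F = fun x => ∫ t in D.lo..x, D.f t := funext D.F_eq_integral
  rw [this]
  exact intervalIntegral.integral_hasDerivAt_right (D.intervalIntegrable_f _ _)
    D.measurable_f.stronglyMeasurable.stronglyMeasurableAtFilter (D.continuousAt_f hl hh)

theorem measurable_F : Measurable D.F := D.continuous_F.measurable

theorem measurable_psi : Measurable D.psi :=
  measurable_id.sub ((measurable_const.sub D.measurable_F).div D.measurable_f)

theorem continuousOn_psi : ContinuousOn D.psi (Set.Ioo D.lo D.hi) :=
  continuousOn_id.sub ((continuousOn_const.sub D.continuous_F.continuousOn).div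
    (D.continuousOn_f.mono Set.Ioo_subset_Icc_self) fun x hx => (D.f_pos x hx).ne')

theorem psi_le (x : ℝ) : D.psi x ≤ x := by
  have := div_nonneg (sub_nonneg.mpr (D.F_le_one x)) (D.f_nonneg x)
  unfold psi; linarith

theorem psi_hi : D.psi D.hi = D.hi := by simp [psi, F_hi]

theorem law_Ioo_compl : D.law (Set.Ioo D.lo D.hi)ᶜ = 0 := by
  have h : D.law.real (Set.Ioo D.lo D.hi) = 1 := by
    rw [D.law_real measurableSet_Ioo, ← integral_Ioc_eq_integral_Ioo,
      ← intervalIntegral.integral_of_le D.lo_lt_hi.le, D.integral_f]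
  rw [prob_compl_eq_zero_iff measurableSet_Ioo]
  rw [Measure.real] at h
  rw [← ENNReal.ofReal_toReal (a := D.law (Set.Ioo D.lo D.hi)) (measure_ne_top _ _), h]
  simp

theorem ae_mem_Ioo : ∀ᵐ x ∂D.law, x ∈ Set.Ioo D.lo D.hi := D.law_Ioo_compl

theorem law_Ioi (x : ℝ) : D.law.real (Set.Ioi x) = 1 - D.F x := by
  rw [F, ← Set.compl_Iic, probReal_compl_eq_one_sub measurableSet_Iic]

theorem law_Iio (x : ℝ) : D.law.real (Set.Iio x) = D.F x :=
  measureReal_congr Iio_ae_eq_Iic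

theorem integral_law (g : ℝ → ℝ) : ∫ x, g x ∂D.law = ∫ x in D.lo..D.hi, g x * D.f x := by
  have h1 : ∫ x, g x ∂D.law = ∫ x, D.f x * g x := by
    rw [law, integral_withDensity_eq_integral_toReal_smul D.measurable_f.ennreal_ofReal
      (by simp)]
    simp [ENNReal.toReal_ofReal (D.f_nonneg _)]
  rw [h1, intervalIntegral.integral_of_le D.lo_lt_hi.le, ← integral_Icc_eq_integral_Ioc]
  simp_rw [mul_comm (D.f _)]
  refine (setIntegral_eq_integral_of_forall_compl_eq_zero fun x hx => ?_).symm
  simp [D.f_eq_zero x hx]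

theorem integrable_law_iff {g : ℝ → ℝ} :
    Integrable g D.law ↔ Integrable (fun x => g x * D.f x) := by
  rw [law, integrable_withDensity_iff D.measurable_f.ennreal_ofReal (by simp)]
  simp [ENNReal.toReal_ofReal (D.f_nonneg _)]

/-! ### The joint law: redrawing one coordinate, and absence of ties. -/

section Joint

variable {N : ℕ}

/-- On boxes, the redrawn coordinate supplies the factor of `s i`, while the overwritten one is
unconstrained and contributes 1. This serves as Fubini's theorem for interim expectations, which are
integrals over all coordinates with one of them overwritten. -/
theorem measurePreserving_update (i : Fin N) :
    MeasurePreserving (fun p : ℝ × (Fin N → ℝ) => Function.update p.2 i p.1)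
      (D.law.prod (D.jointLaw N)) (D.jointLaw N) := by
  have hm : Measurable fun p : ℝ × (Fin N → ℝ) => Function.update p.2 i p.1 := by
    refine measurable_pi_lambda _ fun j => ?_
    rcases eq_or_ne j i with rfl | h
    · simpa using measurable_fst
    · simp only [Function.update_of_ne h]
      exact (measurable_pi_apply j).comp measurable_snd
  refine ⟨hm, (Measure.pi_eq fun s hs => ?_).symm⟩
  rw [Measure.map_apply hm (MeasurableSet.univ_pi hs)]
  have : (fun p : ℝ × (Fin N → ℝ) => Function.update p.2 i p.1) ⁻¹' Set.univ.pi s =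
      s i ×ˢ Set.univ.pi (Function.update s i Set.univ) := by
    ext p
    simp only [Set.mem_preimage, Set.mem_pi, Set.mem_univ, true_imp_iff, Set.mem_prod]
    constructor
    · intro h
      refine ⟨by simpa using h i, fun j => ?_⟩
      rcases eq_or_ne j i with rfl | hj
      · simp
      · simpa [hj] using h j
    · rintro ⟨h1, h2⟩ j
      rcases eq_or_ne j i with rfl | hj
      · simpa using h1
      · simpa [hj] using h2 j
  rw [this, Measure.prod_prod, jointLaw, Measure.pi_pi,
    ← Finset.mul_prod_erase Finset.univ (fun j => D.law (s j)) (Finset.mem_univ i),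
    ← Finset.mul_prod_erase Finset.univ _ (Finset.mem_univ i)]
  simp only [Function.update_self, measure_univ, one_mul]
  congr 1
  refine Finset.prod_congr rfl fun j hj => ?_
  rw [Function.update_of_ne (Finset.ne_of_mem_erase hj)]

theorem integral_jointLaw_update (i : Fin N) {g : (Fin N → ℝ) → ℝ}
    (hg : Integrable g (D.jointLaw N)) :
    ∫ x, g x ∂D.jointLaw N = ∫ z, ∫ y, g (Function.update y i z) ∂D.jointLaw N ∂D.law := by
  have hp := D.measurePreserving_update i
  have h1 : Integrable (fun p : ℝ × (Fin N → ℝ) => g (Function.update p.2 i p.1))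
      (D.law.prod (D.jointLaw N)) := hp.integrable_comp_of_integrable hg
  rw [← integral_prod _ h1]
  rw [← integral_map (f := g) hp.measurable.aemeasurable
    (by rw [hp.map_eq]; exact hg.aestronglyMeasurable), hp.map_eq]

theorem measurePreserving_eval (i : Fin N) :
    MeasurePreserving (fun x : Fin N → ℝ => x i) (D.jointLaw N) D.law :=
  MeasureTheory.measurePreserving_eval (fun _ => D.law) i

theorem ae_mem_Ioo_joint : ∀ᵐ x ∂D.jointLaw N, ∀ j, x j ∈ Set.Ioo D.lo D.hi :=
  ae_all_iff.mpr fun j => (D.measurePreserving_eval j).quasiMeasurePreserving.ae D.ae_mem_Ioo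

theorem ae_mem_Icc_joint : ∀ᵐ x ∂D.jointLaw N, ∀ j, x j ∈ Set.Icc D.lo D.hi := by
  filter_upwards [D.ae_mem_Ioo_joint] with x hx j using Set.Ioo_subset_Icc_self (hx j)

theorem ae_ne_joint (q : ℝ) : ∀ᵐ x ∂D.jointLaw N, ∀ j, x j ≠ q :=
  ae_all_iff.mpr fun j => (D.measurePreserving_eval j).quasiMeasurePreserving.ae
    ((Set.countable_singleton q).ae_notMem D.law)

/-- After coordinate `i` is redrawn independently, a tie with `j` means that an atomless variable
hits a given number. The two almost-everywhere quantifiers are exchanged so that this number is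
fixed first. -/
theorem ae_injective_joint : ∀ᵐ x ∂D.jointLaw N, Function.Injective x := by
  have h : ∀ i j : Fin N, i ≠ j → ∀ᵐ x ∂D.jointLaw N, x i ≠ x j := by
    intro i j hij
    have hm : MeasurableSet {x : Fin N → ℝ | x i ≠ x j} :=
      (measurableSet_eq_fun (measurable_pi_apply i) (measurable_pi_apply j)).compl
    have hp := D.measurePreserving_update i (N := N)
    rw [← hp.map_eq]
    refine (ae_map_iff hp.measurable.aemeasurable hm).mpr ?_
    refine (Measure.ae_prod_iff_ae_ae (hp.measurable hm)).mpr ?_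
    refine (Measure.ae_ae_comm (p := fun z y => Function.update y i z ∈ {x : Fin N → ℝ | x i ≠ x j})
      (hp.measurable hm)).mpr (ae_of_all _ fun y => ?_)
    simp only [Set.mem_ofPred_eq, Function.update_self, Function.update_of_ne hij.symm]
    exact (Set.countable_singleton (y j)).ae_notMem D.law
  have := ae_all_iff.mpr fun i => ae_all_iff.mpr fun j => Filter.eventually_imp_distrib_left.mpr (h i j)
  filter_upwards [this] with x hx i j hij
  by_contra hne
  exact hx i j hne hij

end Joint

end ValueDistribution

/-! ### The probability of paying as a function of the type. -/

namespace ValueDistribution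

variable (D : ValueDistribution) {N : ℕ}

/-- The highest second-highest rival type against which type `q` pays without being the highest. -/
noncomputable def payThreshold (q : ℝ) : ℝ := min q (q + D.psi q)

/-- The probability that type `q` pays his bid, as one formula for the three cases of `H`. -/
noncomputable def payProb (N : ℕ) (q : ℝ) : ℝ :=
  D.F q ^ (N - 1) + ((N : ℝ) - 1) * D.F (D.payThreshold q) ^ (N - 2) * (1 - D.F q)

theorem F_payThreshold_le (q : ℝ) : D.F (D.payThreshold q) ≤ D.F q := D.F_mono (min_le_left _ _)

section

variable (hN : 3 ≤ N)
include hN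

theorem natCast_sub_one_pos : (0 : ℝ) < (N : ℝ) - 1 := by
  have : (3 : ℝ) ≤ N := by exact_mod_cast hN
  linarith

theorem G₁_lo : D.G₁ N D.lo = 0 := by rw [G₁, F_lo, zero_pow (by omega)]

theorem G₂_lo : D.G₂ N D.lo = 0 := by
  rw [G₂, F_lo, zero_pow (by omega), zero_pow (by omega)]; ring

theorem payProb_le_G₂ (q : ℝ) : D.payProb N q ≤ D.G₂ N q := by
  have h1 := pow_le_pow_left₀ (D.F_nonneg _) (D.F_payThreshold_le q) (N - 2)
  have h2 := natCast_sub_one_pos hN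
  have h3 := sub_nonneg.mpr (D.F_le_one q)
  unfold payProb G₂
  gcongr

theorem G₁_le_payProb (q : ℝ) : D.G₁ N q ≤ D.payProb N q := by
  have h1 := pow_nonneg (D.F_nonneg (D.payThreshold q)) (N - 2)
  have h2 := natCast_sub_one_pos hN
  have h3 := sub_nonneg.mpr (D.F_le_one q)
  unfold payProb G₁
  have := mul_nonneg (mul_nonneg h2.le h1) h3
  linarith

theorem payProb_lo : D.payProb N D.lo = 0 :=
  le_antisymm (D.G₂_lo hN ▸ D.payProb_le_G₂ hN D.lo) (D.G₁_lo hN ▸ D.G₁_le_payProb hN D.lo)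

theorem payProb_nonneg (q : ℝ) : 0 ≤ D.payProb N q :=
  (pow_nonneg (D.F_nonneg q) _).trans (D.G₁_le_payProb hN q)

theorem payProb_pos {q : ℝ} (hq : D.lo < q) : 0 < D.payProb N q :=
  (pow_pos (D.F_pos hq) _).trans_le (D.G₁_le_payProb hN q)

omit hN in
theorem payProb_eq_G₁ (hN : 3 ≤ N) {q : ℝ} (h : q + D.psi q ≤ D.lo) : D.payProb N q = D.G₁ N q := by
  rw [payProb, G₁, payThreshold, D.F_of_le_lo ((min_le_right _ _).trans h), zero_pow (by omega)]
  ring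

omit hN in
theorem payProb_eq_G₂ {q : ℝ} (h : 0 ≤ D.psi q) : D.payProb N q = D.G₂ N q := by
  rw [payProb, G₂, payThreshold, min_eq_left (by linarith)]

omit hN in
theorem payProb_eq_mid {q : ℝ} (h : D.psi q ≤ 0) : D.payProb N q =
    D.G₁ N q + ((N : ℝ) - 1) * D.F (q + D.psi q) ^ (N - 2) * (1 - D.F q) := by
  rw [payProb, G₁, payThreshold, min_eq_right (by linarith)]

omit hN in
theorem payThreshold_monotoneOn (hψ : MonotoneOn D.psi (Set.Ioo D.lo D.hi)) :
    MonotoneOn D.payThreshold (Set.Ioc D.lo D.hi) := by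
  intro x hx y hy hxy
  have : D.psi x ≤ D.psi y := by
    rcases hy.2.eq_or_lt with rfl | h
    · rw [psi_hi]; exact (D.psi_le x).trans hxy
    · exact hψ ⟨hx.1, hxy.trans_lt h⟩ ⟨hy.1, h⟩ hxy
  exact min_le_min hxy (add_le_add hxy this)

/-- From x to y the second term can only lose through the factor 1 - F, and by at most (N - 1)
F(x)^(N-2) (F(y) - F(x)), because the threshold is at most x. The first term gains strictly more
than that: the power lies above its tangent, by the strict Bernoulli inequality for F(y)/F(x) with
exponent N - 1 > 1. -/
theorem payProb_strictMonoOn (hψ : MonotoneOn D.psi (Set.Ioo D.lo D.hi)) :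
    StrictMonoOn (D.payProb N) (Set.Icc D.lo D.hi) := by
  intro x hx y hy hxy
  rcases hx.1.eq_or_lt with rfl | hlo
  · rw [D.payProb_lo hN]; exact D.payProb_pos hN hxy
  have hF := D.F_strictMonoOn hx hy hxy
  have hFx := D.F_pos hlo
  have hm := D.F_mono (D.payThreshold_monotoneOn hψ ⟨hlo, hx.2⟩ ⟨hlo.trans hxy, hy.2⟩ hxy.le)
  have hu := D.F_payThreshold_le x
  have hu0 := D.F_nonneg (D.payThreshold x)
  have hc := natCast_sub_one_pos hN
  have h1 : ((N : ℝ) - 1) * D.F (D.payThreshold x) ^ (N - 2) * (1 - D.F y) ≤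
      ((N : ℝ) - 1) * D.F (D.payThreshold y) ^ (N - 2) * (1 - D.F y) := by
    have := sub_nonneg.mpr (D.F_le_one y)
    gcongr
  have h2 : D.F x ^ (N - 1) + ((N : ℝ) - 1) * D.F x ^ (N - 2) * (D.F y - D.F x) <
      D.F y ^ (N - 1) := by
    have hb := one_add_mul_self_lt_rpow_one_add (s := D.F y / D.F x - 1)
      (by have := div_nonneg (hFx.le.trans hF.le) hFx.le; linarith)
      (by rw [sub_ne_zero]; intro h; rw [div_eq_one_iff_eq hFx.ne'] at h; exact hF.ne' h)
      (p := ((N - 1 : ℕ) : ℝ)) (by exact_mod_cast (by omega : 1 < N - 1))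
    rw [Real.rpow_natCast, add_sub_cancel, div_pow, lt_div_iff₀ (pow_pos hFx _)] at hb
    push_cast [Nat.cast_sub (by omega : 1 ≤ N)] at hb
    refine lt_of_eq_of_lt ?_ hb
    obtain ⟨n, rfl⟩ : ∃ n, N = n + 2 := ⟨N - 2, by omega⟩
    simp only [Nat.add_sub_cancel, show n + 2 - 1 = n + 1 by omega]
    push_cast
    field_simp
    ring
  have h3 : D.F (D.payThreshold x) ^ (N - 2) * (D.F y - D.F x) ≤
      D.F x ^ (N - 2) * (D.F y - D.F x) := by
    have := sub_nonneg.mpr hF.le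
    gcongr
  unfold payProb
  nlinarith

/-- The virtual valuation need not be continuous at the ends of the support. There `G₁` and `G₂`
agree, and `payProb` is squeezed between them. -/
theorem continuousOn_payProb : ContinuousOn (D.payProb N) (Set.Icc D.lo D.hi) := by
  have hG₁ : Continuous (D.G₁ N) := D.continuous_F.pow _
  have hG₂ : Continuous (D.G₂ N) := by
    unfold G₂
    have := D.continuous_F
    fun_prop
  have hends : ∀ x, D.G₁ N x = D.G₂ N x → ContinuousAt (D.payProb N) x := by
    intro x hx
    have h0 : D.payProb N x = D.G₁ N x :=
      le_antisymm (hx ▸ D.payProb_le_G₂ hN x) (D.G₁_le_payProb hN x)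
    unfold ContinuousAt
    rw [h0]
    refine tendsto_of_tendsto_of_tendsto_of_le_of_le hG₁.continuousAt
      (hx ▸ hG₂.continuousAt : Filter.Tendsto (D.G₂ N) (nhds x) (nhds (D.G₁ N x)))
      (D.G₁_le_payProb hN) (D.payProb_le_G₂ hN)
  intro x hx
  refine ContinuousAt.continuousWithinAt ?_
  rcases hx.1.eq_or_lt with rfl | hl
  · exact hends _ (by rw [D.G₁_lo hN, D.G₂_lo hN])
  rcases hx.2.eq_or_lt with rfl | hh
  · exact hends _ (by simp [G₁, G₂, F_hi])
  have hpsi := D.continuousOn_psi.continuousAt (Ioo_mem_nhds hl hh)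
  have hm : ContinuousAt D.payThreshold x := continuousAt_id.min (continuousAt_id.add hpsi)
  have hF := D.continuous_F
  unfold payProb
  have h1 : ContinuousAt (fun q => D.F (D.payThreshold q)) x := hF.continuousAt.comp hm
  exact (hF.continuousAt.pow _).add ((continuousAt_const.mul (h1.pow _)).mul
    (continuousAt_const.sub hF.continuousAt))

end

/-! ### The threshold types `a 0` and `psiInvZero`. -/

section Thresholds

theorem psiInvZero_set_nonempty : D.hi ∈ {t : ℝ | t ∈ Set.Ioc D.lo D.hi ∧ 0 ≤ D.psi t} :=
  ⟨⟨D.lo_lt_hi, le_rfl⟩, by rw [psi_hi]; exact D.lo_nonneg.trans D.lo_lt_hi.le⟩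

theorem psiInvZero_le {t : ℝ} (ht : t ∈ Set.Ioc D.lo D.hi) (h : 0 ≤ D.psi t) : D.psiInvZero ≤ t :=
  csInf_le ⟨D.lo, fun _ h => h.1.1.le⟩ ⟨ht, h⟩

theorem psiInvZero_le_hi : D.psiInvZero ≤ D.hi :=
  D.psiInvZero_le D.psiInvZero_set_nonempty.1 D.psiInvZero_set_nonempty.2

theorem lo_le_a_zero : D.lo ≤ D.a 0 := by
  obtain ⟨h1, h2⟩ := D.psiInvZero_set_nonempty
  exact le_csInf ⟨D.hi, h1, D.lo_nonneg.trans h1.1.le, by linarith [D.lo_nonneg, h1.1]⟩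
    fun _ h => h.1.1.le

theorem a_zero_le {t : ℝ} (ht : t ∈ Set.Ioc D.lo D.hi) (h : 0 ≤ t + D.psi t) : D.a 0 ≤ t :=
  csInf_le ⟨D.lo, fun _ h => h.1.1.le⟩ ⟨ht, D.lo_nonneg.trans ht.1.le, h⟩

theorem a_zero_le_psiInvZero : D.a 0 ≤ D.psiInvZero :=
  le_csInf ⟨_, D.psiInvZero_set_nonempty⟩ fun t ht =>
    D.a_zero_le ht.1 (by linarith [D.lo_nonneg, ht.1.1, ht.2])

theorem psi_neg_of_lt {x : ℝ} (hl : D.lo < x) (hx : x < D.psiInvZero) : D.psi x < 0 := by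
  by_contra! h
  exact absurd (D.psiInvZero_le ⟨hl, hx.le.trans D.psiInvZero_le_hi⟩ h) (not_le.mpr hx)

theorem add_psi_neg_of_lt {x : ℝ} (hl : D.lo < x) (hx : x < D.a 0) : x + D.psi x < 0 := by
  by_contra! h
  exact absurd (D.a_zero_le ⟨hl, (hx.le.trans D.a_zero_le_psiInvZero).trans D.psiInvZero_le_hi⟩ h)
    (not_le.mpr hx)

/-- Strictly above the infimum this is monotonicity. At the infimum, which need not obviously belong
to the set, it is a limit from the right. -/
theorem psi_nonneg_of_le (hψ : MonotoneOn D.psi (Set.Ioo D.lo D.hi)) {x : ℝ}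
    (hx : x ∈ Set.Ioc D.lo D.hi) (h : D.psiInvZero ≤ x) : 0 ≤ D.psi x := by
  rcases hx.2.eq_or_lt with rfl | hh
  · exact D.psiInvZero_set_nonempty.2
  have hgt : ∀ y ∈ Set.Ioo x D.hi, 0 ≤ D.psi y := by
    intro y hy
    obtain ⟨t, ht, hty⟩ := exists_lt_of_csInf_lt ⟨_, D.psiInvZero_set_nonempty⟩ (h.trans_lt hy.1)
    exact ht.2.trans (hψ ⟨ht.1.1, hty.trans hy.2⟩ ⟨hx.1.trans hy.1, hy.2⟩ hty.le)
  have hc := D.continuousOn_psi.continuousAt (Ioo_mem_nhds hx.1 hh)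
  refine ge_of_tendsto (hc.tendsto.mono_left (nhdsWithin_le_nhds (s := Set.Ioi x))) ?_
  filter_upwards [Ioo_mem_nhdsGT hh] with y hy using hgt y hy

/-- A limit from the left, where the sum is negative; the threshold has to be interior for the
virtual valuation to be continuous there. -/
theorem a_zero_add_psi_nonpos (hl : D.lo < D.a 0) (hh : D.a 0 < D.hi) :
    D.a 0 + D.psi (D.a 0) ≤ 0 := by
  have hc := continuousAt_id.add (D.continuousOn_psi.continuousAt (Ioo_mem_nhds hl hh))
  refine le_of_tendsto (hc.tendsto.mono_left (nhdsWithin_le_nhds (s := Set.Iio (D.a 0)))) ?_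
  filter_upwards [Ioo_mem_nhdsLT hl] with y hy using (D.add_psi_neg_of_lt hy.1 hy.2).le

end Thresholds

/-! ### The bid function through integration by parts. -/

section BidFormula

variable (hN : 3 ≤ N) (hψ : MonotoneOn D.psi (Set.Ioo D.lo D.hi))
include hN

theorem payProb_eq_G₁_of_le {x : ℝ} (hl : D.lo ≤ x) (hx : x ≤ D.a 0) :
    D.payProb N x = D.G₁ N x := by
  rcases hl.eq_or_lt with rfl | hl
  · rw [D.payProb_lo hN, D.G₁_lo hN]
  rcases hx.eq_or_lt with rfl | hx
  · rcases (D.a_zero_le_psiInvZero.trans D.psiInvZero_le_hi).eq_or_lt with h | h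
    · rw [h]; simp [payProb, G₁, F_hi]
    · exact D.payProb_eq_G₁ hN ((D.a_zero_add_psi_nonpos hl h).trans D.lo_nonneg)
  · exact D.payProb_eq_G₁ hN ((D.add_psi_neg_of_lt hl hx).le.trans D.lo_nonneg)

include hψ

theorem H_eq_payProb {x : ℝ} (hx : x ∈ Set.Ioc D.lo D.hi) : D.H N x = D.payProb N x := by
  unfold H
  split_ifs with h1 h2
  · exact (D.payProb_eq_G₂ (D.psi_nonneg_of_le hψ hx h1)).symm
  · exact (D.payProb_eq_mid (D.psi_neg_of_lt hx.1 (not_le.mp h1)).le).symm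
  · exact (D.payProb_eq_G₁_of_le hN hx.1.le (not_le.mp h2).le).symm

/-- Integration by parts against a derivative not known to be continuous: it is integrable because
`payProb` is continuous and monotone, so that its derivative is nonnegative. The exceptional point
`c` absorbs a possible kink of `payProb` inside the middle interval. -/
theorem integral_mul_deriv_payProb {a b c : ℝ} {p : ℝ → ℝ} (ha : D.lo ≤ a) (hab : a ≤ b)
    (hb : b ≤ D.hi) (hd : ∀ s ∈ Set.Ioo a b, s ≠ c → HasDerivAt (D.payProb N) (p s) s) :
    ∫ s in a..b, s * p s = b * D.payProb N b - a * D.payProb N a - ∫ s in a..b, D.payProb N s := by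
  set P := D.payProb N with hPdef
  have hsub : Set.Icc a b ⊆ Set.Icc D.lo D.hi := Set.Icc_subset_Icc ha hb
  have hP : ContinuousOn P (Set.Icc a b) := (D.continuousOn_payProb hN).mono hsub
  have hmono : MonotoneOn P (Set.Icc a b) := (D.payProb_strictMonoOn hN hψ).monotoneOn.mono hsub
  have hp0 : ∀ s ∈ Set.Ioo a b, s ≠ c → 0 ≤ p s := by
    intro s hs hsc
    have hd' := (hd s hs hsc).hasDerivWithinAt (s := Set.Ioo a b)
    exact hd'.nonneg_of_monotoneOn
      (uniqueDiffOn_Ioo a b s hs).accPt (hmono.mono Set.Ioo_subset_Icc_self)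
  have hint₀ : ∀ u v, a ≤ u → u ≤ v → v ≤ b → c ∉ Set.Ioo u v → IntervalIntegrable p volume u v := by
    intro u v hu huv hv hcu
    rw [intervalIntegrable_iff_integrableOn_Ioc_of_le huv]
    have hs : ∀ s ∈ Set.Ioo u v, s ∈ Set.Ioo a b ∧ s ≠ c := fun s hs =>
      ⟨⟨hu.trans_lt hs.1, hs.2.trans_le hv⟩, fun h => hcu (h ▸ hs)⟩
    exact intervalIntegral.integrableOn_deriv_of_nonneg (hP.mono (Set.Icc_subset_Icc hu hv))
      (fun s h => hd s (hs s h).1 (hs s h).2) (fun s h => hp0 s (hs s h).1 (hs s h).2)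
  have hint : IntervalIntegrable p volume a b := by
    by_cases hc : c ∈ Set.Ioo a b
    · exact (hint₀ a c le_rfl hc.1.le hc.2.le (by simp)).trans
        (hint₀ c b hc.1.le hc.2.le le_rfl (by simp))
    · exact hint₀ a b le_rfl hab le_rfl hc
  have hK : ContinuousOn (fun s => s * P s - ∫ t in a..s, P t) (Set.Icc a b) := by
    refine (continuousOn_id.mul hP).sub ?_
    have := intervalIntegral.continuousOn_primitive_interval (a := a) (b := b) (f := P)
      (μ := volume) (by rw [Set.uIcc_of_le hab]; exact hP.integrableOn_Icc)
    rwa [Set.uIcc_of_le hab] at this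
  have := integral_eq_of_hasDerivAt_off_countable_of_le (fun s => s * P s - ∫ t in a..s, P t)
    (fun s => s * p s) hab (Set.countable_singleton c) hK (fun s hs => ?_)
    (hint.continuousOn_mul continuousOn_id)
  · rw [this]; simp; ring
  · have hPs : ContinuousAt P s := hP.continuousAt (Icc_mem_nhds hs.1.1 hs.1.2)
    have h1 : HasDerivAt (fun u => ∫ t in a..u, P t) (P s) s :=
      intervalIntegral.integral_hasDerivAt_right
        ((hP.mono (by rw [Set.uIcc_of_le hs.1.1.le]
                      exact Set.Icc_subset_Icc le_rfl hs.1.2.le)).intervalIntegrable)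
        ((hP.mono Set.Ioo_subset_Icc_self).stronglyMeasurableAtFilter isOpen_Ioo s hs.1) hPs
    exact (((hasDerivAt_id' s).fun_mul (hd s hs.1 hs.2)).fun_sub h1).congr_deriv (by ring)

/-- On each piece the integral of s H'(s) is integrated by parts, and the constants at `a 0` and
`psiInvZero` are what makes the resulting primitives match across pieces. Together with the value 0
at the lowest type, this identity is all that is used about the bid function later. -/
theorem payProb_mul_sub_bid (hdiff : DifferentiableOn ℝ D.psi (Set.Ioo (D.a 0) D.psiInvZero))
    {x : ℝ} (hx : x ∈ Set.Icc D.lo D.hi) :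
    D.payProb N x * (x - D.bid N x) = ∫ s in D.lo..x, D.payProb N s := by
  have hint : ∀ u v, D.lo ≤ u → u ≤ v → v ≤ D.hi → IntervalIntegrable (D.payProb N) volume u v :=
    fun u v hu huv hv => ((D.continuousOn_payProb hN).mono (by
      rw [Set.uIcc_of_le huv]; exact Set.Icc_subset_Icc hu hv)).intervalIntegrable
  rcases hx.1.eq_or_lt with rfl | hl
  · simp [D.payProb_lo hN]
  have ha := D.lo_le_a_zero
  have ha' := D.a_zero_le_psiInvZero
  have hz := D.psiInvZero_le_hi
  -- the lowest interval
  have low : ∀ t, D.lo ≤ t → t ≤ D.a 0 → D.G₁ N t * D.bidLow N t =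
      t * D.payProb N t - ∫ s in D.lo..t, D.payProb N s := by
    intro t htl hta
    rcases htl.eq_or_lt with rfl | htl'
    · simp [D.G₁_lo hN, D.payProb_lo hN]
    have hG : D.G₁ N t ≠ 0 := (pow_pos (D.F_pos htl') _).ne'
    rw [bidLow, ← mul_assoc, mul_one_div_cancel hG, one_mul,
      D.integral_mul_deriv_payProb hN hψ (c := D.lo) le_rfl htl (hta.trans (ha'.trans hz)),
      D.payProb_lo hN]
    · ring
    intro s hs _
    have hs' : s ∈ Set.Ioo D.lo (D.a 0) := ⟨hs.1, hs.2.trans_le hta⟩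
    have h1 := (D.hasDerivAt_F hs.1.ne' (hs'.2.trans_le (ha'.trans hz)).ne).fun_pow (N - 1)
    have h2 : D.payProb N =ᶠ[nhds s] D.G₁ N := by
      filter_upwards [Ioo_mem_nhds hs'.1 hs'.2] with u hu
      exact D.payProb_eq_G₁_of_le hN hu.1.le hu.2.le
    refine HasDerivAt.congr_of_eventuallyEq ?_ h2
    unfold g₁
    refine h1.congr_deriv ?_
    push_cast [Nat.cast_sub (by omega : 1 ≤ N)]
    rfl
  -- the middle interval
  have mid : ∀ t, D.a 0 ≤ t → t ≤ D.psiInvZero → D.lo < t → D.payProb N t * D.bidMid N t =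
      t * D.payProb N t - ∫ s in D.lo..t, D.payProb N s := by
    intro t hta htz htl
    -- `F` may fail to be differentiable at the ends of the support. Since s + ψ(s) is strictly
    -- increasing it meets the lower end at most once, at `c` (arbitrary if never); the upper end is
    -- out of reach because ψ(s) is negative here.
    obtain ⟨c, hc⟩ : ∃ c, ∀ s ∈ Set.Ioo D.lo D.hi, s ≠ c → s + D.psi s ≠ D.lo := by
      by_cases h : ∃ c ∈ Set.Ioo D.lo D.hi, c + D.psi c = D.lo
      · obtain ⟨c, hc, hce⟩ := h
        refine ⟨c, fun s hs hsc he => ?_⟩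
        rcases lt_or_gt_of_ne hsc with h | h
        · linarith [hψ hs hc h.le]
        · linarith [hψ hc hs h.le]
      · exact ⟨0, fun s hs _ he => h ⟨s, hs, he⟩⟩
    rw [bidMid, D.H_eq_payProb hN hψ ⟨htl, htz.trans hz⟩, ← mul_assoc,
      mul_one_div_cancel (D.payProb_pos hN htl).ne', one_mul, low _ ha le_rfl,
      D.integral_mul_deriv_payProb hN hψ (c := c) ha hta (htz.trans hz),
      ← intervalIntegral.integral_add_adjacent_intervals
        (hint _ _ le_rfl ha (ha'.trans hz)) (hint _ _ ha hta (htz.trans hz))]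
    · ring
    intro s hs hsc
    have hs0 : s ∈ Set.Ioo (D.a 0) D.psiInvZero := ⟨hs.1, hs.2.trans_le htz⟩
    have hs1 : s ∈ Set.Ioo D.lo D.hi := ⟨ha.trans_lt hs.1, hs0.2.trans_le hz⟩
    have hneg := D.psi_neg_of_lt hs1.1 hs0.2
    have hF := D.hasDerivAt_F hs1.1.ne' hs1.2.ne
    have hps := (hdiff.differentiableAt (Ioo_mem_nhds hs0.1 hs0.2)).hasDerivAt
    have hF2 : HasDerivAt D.F (D.f (s + D.psi s)) (s + D.psi s) :=
      D.hasDerivAt_F (hc s hs1 hsc) (by linarith [hs1.2])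
    have hcomp : HasDerivAt (fun u => D.F (u + D.psi u))
        (D.f (s + D.psi s) * (1 + deriv D.psi s)) s :=
      HasDerivAt.comp (h₂ := D.F) s hF2 ((hasDerivAt_id' s).fun_add hps)
    have h2 : D.payProb N =ᶠ[nhds s] fun u =>
        D.F u ^ (N - 1) + ((N : ℝ) - 1) * D.F (u + D.psi u) ^ (N - 2) * (1 - D.F u) := by
      filter_upwards [Ioo_mem_nhds hs0.1 hs0.2] with u hu
      exact D.payProb_eq_mid (D.psi_neg_of_lt (ha.trans_lt hu.1) hu.2).le
    refine HasDerivAt.congr_of_eventuallyEq ?_ h2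
    have h3 := (hF.fun_pow (N - 1)).fun_add
      (((hcomp.fun_pow (N - 2)).const_mul ((N : ℝ) - 1)).fun_mul (hF.const_sub 1))
    unfold H' g₁
    refine h3.congr_deriv ?_
    push_cast [Nat.cast_sub (by omega : 1 ≤ N), Nat.cast_sub (by omega : 2 ≤ N)]
    rw [show N - 2 - 1 = N - 3 by omega, show N - 1 - 1 = N - 2 by omega]
    ring
  -- the highest interval
  have high : ∀ t, D.psiInvZero ≤ t → t ≤ D.hi → D.lo < t → D.payProb N t * D.bidHigh N t =
      t * D.payProb N t - ∫ s in D.lo..t, D.payProb N s := by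
    intro t htz hth htl
    have hGt : D.payProb N t = D.G₂ N t :=
      D.payProb_eq_G₂ (D.psi_nonneg_of_le hψ ⟨htl, hth⟩ htz)
    have hz0 : D.G₂ N D.psiInvZero * D.bidMid N D.psiInvZero =
        D.psiInvZero * D.payProb N D.psiInvZero - ∫ s in D.lo..D.psiInvZero, D.payProb N s := by
      -- If the threshold is the lowest type, both sides vanish; `mid` does not apply there, since
      -- it divides by the probability of paying.
      rcases (ha.trans ha').eq_or_lt with h | h
      · rw [← h, D.G₂_lo hN, D.payProb_lo hN]; simp
      · rw [← D.payProb_eq_G₂ (D.psi_nonneg_of_le hψ ⟨h, hz⟩ le_rfl), mid _ ha' le_rfl h]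
    rw [bidHigh, hz0, ← hGt, ← mul_assoc, mul_one_div_cancel (D.payProb_pos hN htl).ne', one_mul,
      D.integral_mul_deriv_payProb hN hψ (c := D.lo) (ha.trans ha') htz hth,
      ← intervalIntegral.integral_add_adjacent_intervals
        (hint _ _ le_rfl (ha.trans ha') hz) (hint _ _ (ha.trans ha') htz hth)]
    · ring
    intro s hs _
    have hsl : D.lo < s := (ha.trans ha').trans_lt hs.1
    have hF := D.hasDerivAt_F hsl.ne' (hs.2.trans_le hth).ne
    have h2 : D.payProb N =ᶠ[nhds s] fun u =>
        D.F u ^ (N - 1) + ((N : ℝ) - 1) * D.F u ^ (N - 2) * (1 - D.F u) := by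
      filter_upwards [Ioo_mem_nhds hs.1 hs.2] with u hu
      exact D.payProb_eq_G₂ (D.psi_nonneg_of_le hψ
        ⟨(ha.trans ha').trans_lt hu.1, hu.2.le.trans hth⟩ hu.1.le)
    refine HasDerivAt.congr_of_eventuallyEq ?_ h2
    have h3 := (hF.fun_pow (N - 1)).fun_add
      (((hF.fun_pow (N - 2)).const_mul ((N : ℝ) - 1)).fun_mul (hF.const_sub 1))
    unfold g₂
    refine h3.congr_deriv ?_
    push_cast [Nat.cast_sub (by omega : 1 ≤ N), Nat.cast_sub (by omega : 2 ≤ N)]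
    rw [show N - 2 - 1 = N - 3 by omega, show N - 1 - 1 = N - 2 by omega]
    ring
  have key : D.payProb N x * D.bid N x = x * D.payProb N x - ∫ s in D.lo..x, D.payProb N s := by
    unfold bid
    split_ifs with h1 h2
    · exact high x h1 hx.2 hl
    · exact mid x h2 (not_le.mp h1).le hl
    · rw [← low x hx.1 (not_le.mp h2).le, D.payProb_eq_G₁_of_le hN hx.1 (not_le.mp h2).le]
  rw [mul_sub, key]
  ring

omit hψ in
theorem bid_lo : D.bid N D.lo = 0 := by
  unfold bid
  split_ifs with h1 h2
  · simp [bidHigh, D.G₂_lo hN]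
  · have h : D.a 0 = D.lo := le_antisymm h2 D.lo_le_a_zero
    simp [bidMid, h, D.G₁_lo hN]
  · simp [bidLow]

variable (hdiff : DifferentiableOn ℝ D.psi (Set.Ioo (D.a 0) D.psiInvZero))
include hdiff

theorem bid_le_self {x : ℝ} (hx : x ∈ Set.Icc D.lo D.hi) : D.bid N x ≤ x := by
  rcases hx.1.eq_or_lt with rfl | hl
  · rw [D.bid_lo hN]; exact D.lo_nonneg
  have h1 := D.payProb_mul_sub_bid hN hψ hdiff hx
  have h2 : 0 ≤ ∫ s in D.lo..x, D.payProb N s :=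
    intervalIntegral.integral_nonneg hx.1 fun s _ => D.payProb_nonneg hN s
  rw [← h1] at h2
  exact sub_nonneg.mp (nonneg_of_mul_nonneg_right h2 (D.payProb_pos hN hl))

/-- Write P for `payProb`. Since P is strictly increasing, P(y)(y - β(y)) = P(x)(x - β(x)) + ∫ P
over [x, y] < P(y)(x - β(x)) + P(y)(y - x), as x - β(x) ≥ 0. Dividing by P(y) gives β(x) < β(y). -/
theorem bid_strictMonoOn : StrictMonoOn (D.bid N) (Set.Icc D.lo D.hi) := by
  intro x hx y hy hxy
  have hP := D.payProb_strictMonoOn hN hψ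
  have hc := D.continuousOn_payProb hN
  have hcxy : ContinuousOn (D.payProb N) (Set.Icc x y) := hc.mono (Set.Icc_subset_Icc hx.1 hy.2)
  have h1 := D.payProb_mul_sub_bid hN hψ hdiff hx
  have h2 := D.payProb_mul_sub_bid hN hψ hdiff hy
  rw [← intervalIntegral.integral_add_adjacent_intervals (b := x)
    ((hc.mono (Set.Icc_subset_Icc le_rfl hx.2)).intervalIntegrable_of_Icc hx.1)
    (hcxy.intervalIntegrable_of_Icc hxy.le), ← h1] at h2
  have h3 : ∫ s in x..y, D.payProb N s < ∫ s in x..y, D.payProb N y :=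
    intervalIntegral.integral_lt_integral_of_continuousOn_of_le_of_exists_lt hxy hcxy
      continuousOn_const
      (fun s hs => hP.monotoneOn ⟨hx.1.trans hs.1.le, hs.2.trans hy.2⟩ hy hs.2)
      ⟨x, ⟨le_rfl, hxy.le⟩, hP hx hy hxy⟩
  rw [intervalIntegral.integral_const, smul_eq_mul] at h3
  by_contra! hle
  have h4 := D.bid_le_self hN hψ hdiff hx
  have h5 := hP hx hy hxy
  have h6 := D.payProb_nonneg hN x
  nlinarith [mul_nonneg (sub_nonneg.mpr h5.le) (sub_nonneg.mpr h4),
    mul_nonneg (h6.trans h5.le) (sub_nonneg.mpr hle)]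

theorem bid_nonneg {x : ℝ} (hx : x ∈ Set.Icc D.lo D.hi) : 0 ≤ D.bid N x := by
  rw [← D.bid_lo hN]
  exact (D.bid_strictMonoOn hN hψ hdiff).monotoneOn ⟨le_rfl, D.lo_lt_hi.le⟩ hx hx.1

/-- This is left continuity of β away from the lowest type, obtained from `payProb_mul_sub_bid`:
multiplied by `payProb` the inequality is one between continuous functions and survives the limit.
It shows that a bid from which the type q above `D.lo` is inferred is at least β(q). -/
theorem bid_le_of_forall_lt {q b : ℝ} (hq : q ∈ Set.Ioc D.lo D.hi)
    (h : ∀ z ∈ Set.Ioo D.lo q, D.bid N z ≤ b) : D.bid N q ≤ b := by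
  have hc := D.continuousOn_payProb hN
  have hsub : Set.Ioo D.lo q ⊆ Set.Icc D.lo D.hi :=
    fun z hz => ⟨hz.1.le, hz.2.le.trans hq.2⟩
  have hI : ContinuousOn (fun z => ∫ s in D.lo..z, D.payProb N s) (Set.Icc D.lo D.hi) := by
    have := intervalIntegral.continuousOn_primitive_interval (a := D.lo) (b := D.hi)
      (f := D.payProb N) (μ := volume)
      (by rw [Set.uIcc_of_le D.lo_lt_hi.le]; exact hc.integrableOn_Icc)
    rwa [Set.uIcc_of_le D.lo_lt_hi.le] at this
  have hqm : q ∈ Set.Icc D.lo D.hi := ⟨hq.1.le, hq.2⟩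
  have key := ContinuousWithinAt.closure_le (s := Set.Ioo D.lo q) (x := q)
    (f := fun z => z * D.payProb N z - ∫ s in D.lo..z, D.payProb N s)
    (g := fun z => b * D.payProb N z)
    (by rw [closure_Ioo hq.1.ne]; exact ⟨hq.1.le, le_rfl⟩)
    (((continuousOn_id.mul hc).sub hI q hqm).mono hsub)
    (((continuousOn_const.mul hc) q hqm).mono hsub)
    (fun z hz => by
      have h1 := D.payProb_mul_sub_bid hN hψ hdiff (hsub hz)
      have := mul_le_mul_of_nonneg_right (h z hz) (D.payProb_nonneg hN z)
      linarith)
  have h1 := D.payProb_mul_sub_bid hN hψ hdiff hqm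
  have h2 := D.payProb_pos hN hq.1
  refine le_of_mul_le_mul_left ?_ h2
  linarith

end BidFormula

end ValueDistribution

/-! ### Surplus and winner in the second auction. -/

theorem secondAuctionSurplus_nonneg {N : ℕ} (s : Finset (Fin N)) (x : Fin N → ℝ) (i : Fin N) :
    0 ≤ secondAuctionSurplus s x i := le_max_right _ _

theorem secondAuctionSurplus_update {N : ℕ} (s : Finset (Fin N)) (y : Fin N → ℝ) (i : Fin N)
    (z : ℝ) : secondAuctionSurplus s (Function.update y i z) i =
      max (z - kthHighest (s.erase i) y 1) 0 := by
  rw [secondAuctionSurplus, kthHighest_erase_update, Function.update_self]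

theorem secondAuctionSurplus_eq_ite {N : ℕ} (s : Finset (Fin N)) (x : Fin N → ℝ) (i : Fin N) :
    secondAuctionSurplus s x i =
      if kthHighest (s.erase i) x 1 < x i then x i - kthHighest (s.erase i) x 1 else 0 := by
  unfold secondAuctionSurplus
  split_ifs with h
  · exact max_eq_left (by linarith)
  · exact max_eq_right (by linarith)

/-- The winner of a second-price auction among at least two bidders with distinct values. -/
theorem sum_winner {N : ℕ} {s : Finset (Fin N)} {x : Fin N → ℝ} (hs : 2 ≤ s.card)
    (hx : Set.InjOn x s) (g : ℝ → ℝ) :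
    ∑ i ∈ s, (if kthHighest (s.erase i) x 1 < x i then g (x i) - kthHighest (s.erase i) x 1 else 0)
      = g (kthHighest s x 1) - kthHighest s x 2 := by
  obtain ⟨a, ha, b, hb, hab, hlt, h⟩ := exists_top_two hs hx
  have hle : ∀ j ∈ s, j ≠ a → x j ≤ x b := fun j hj hja => by
    rcases eq_or_ne j b with rfl | hjb
    · rfl
    · exact (h j hj hja hjb).le
  have h1 : kthHighest s x 1 = x a := kthHighest_one_eq ha fun j hj => by
    rcases eq_or_ne j a with rfl | hja
    · rfl
    · exact (hle j hj hja).trans hlt.le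
  have h2 : kthHighest s x 2 = x b := kthHighest_two_eq ha hb hab hlt.le hle
  have h3 : kthHighest (s.erase a) x 1 = x b :=
    kthHighest_one_eq (Finset.mem_erase.mpr ⟨hab.symm, hb⟩) fun j hj =>
      hle j (Finset.mem_of_mem_erase hj) (Finset.ne_of_mem_erase hj)
  rw [Finset.sum_eq_single_of_mem a ha, h1, h2, h3, if_pos hlt]
  intro i hi hia
  have h4 : kthHighest (s.erase i) x 1 = x a :=
    kthHighest_one_eq (Finset.mem_erase.mpr ⟨hia.symm, ha⟩) fun j hj => by
      rcases eq_or_ne j a with rfl | hja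
      · rfl
      · exact (hle j (Finset.mem_of_mem_erase hj) hja).trans hlt.le
  rw [h4, if_neg (not_lt.mpr ((hle i hi hia).trans hlt.le))]

/-! ### Virtual valuations as weights on rents. -/

namespace ValueDistribution

variable (D : ValueDistribution) {N : ℕ}

theorem mul_density_ae {z : ℝ} (hz : z ∈ Set.Ioo D.lo D.hi) :
    (z - D.psi z) * D.f z = 1 - D.F z := by
  have := (D.f_pos z hz).ne'
  unfold psi
  field_simp
  ring

/-- Multiplied by the density this is 1 - F, which is bounded, so a blow-up of ψ where the density
vanishes does no harm. -/
theorem integrable_sub_psi : Integrable (fun z => z - D.psi z) D.law := by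
  rw [integrable_law_iff]
  have h : Integrable ((Set.Ioo D.lo D.hi).indicator fun z => 1 - D.F z) := by
    rw [integrable_indicator_iff measurableSet_Ioo]
    exact ((continuous_const.sub D.continuous_F).continuousOn.integrableOn_Icc).mono_set
      Set.Ioo_subset_Icc_self
  refine h.congr ?_
  filter_upwards [(Set.countable_singleton D.lo).ae_notMem volume,
    (Set.countable_singleton D.hi).ae_notMem volume] with z h1 h2
  by_cases hz : z ∈ Set.Ioo D.lo D.hi
  · rw [Set.indicator_of_mem hz, D.mul_density_ae hz]
  · rw [Set.indicator_of_notMem hz, D.f_eq_zero z, mul_zero]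
    exact fun h => hz ⟨lt_of_le_of_ne h.1 (Ne.symm h1), lt_of_le_of_ne h.2 h2⟩

/-- Exchange the integrals over the triangle s ≤ z: the slope at s is earned by all types above s,
which gives it the weight 1 - F(s) = (s - ψ(s)) f(s). Here virtual valuations enter. -/
theorem integral_law_primitive {w : ℝ → ℝ} (hw : IntervalIntegrable w volume D.lo D.hi) :
    ∫ z, (∫ s in D.lo..z, w s) ∂D.law = ∫ z, w z * (z - D.psi z) ∂D.law := by
  have hwI : Integrable w (volume.restrict (Set.Ioc D.lo D.hi)) :=
    (intervalIntegrable_iff_integrableOn_Ioc_of_le D.lo_lt_hi.le).mp hw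
  have hprod : Integrable (Function.uncurry fun z s => {p : ℝ × ℝ | p.2 ≤ p.1}.indicator
      (fun p => w p.2) (z, s)) (D.law.prod (volume.restrict (Set.Ioc D.lo D.hi))) := by
    have := (integrable_const (μ := D.law) (1 : ℝ)).mul_prod hwI
    exact (this.indicator (measurableSet_le measurable_snd measurable_fst)).congr
      (ae_of_all _ fun p => by simp [Set.indicator, Function.uncurry])
  have hswap := integral_integral_swap hprod
  have hl : ∫ z, (∫ s in D.lo..z, w s) ∂D.law = ∫ z, (∫ s in Set.Ioc D.lo D.hi,
      {p : ℝ × ℝ | p.2 ≤ p.1}.indicator (fun p => w p.2) (z, s)) ∂D.law := by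
    refine integral_congr_ae ?_
    filter_upwards [D.ae_mem_Ioo] with z hz
    have : (fun s => {p : ℝ × ℝ | p.2 ≤ p.1}.indicator (fun p => w p.2) (z, s)) =
        (Set.Iic z).indicator w := by
      ext s; simp [Set.indicator]
    rw [this, setIntegral_indicator measurableSet_Iic, intervalIntegral.integral_of_le hz.1.le]
    congr 2
    ext s
    simp only [Set.mem_Ioc, Set.mem_inter_iff, Set.mem_Iic]
    exact ⟨fun h => ⟨⟨h.1, h.2.trans hz.2.le⟩, h.2⟩, fun h => ⟨h.1.1, h.2⟩⟩
  rw [hl, hswap, D.integral_law, intervalIntegral.integral_of_le D.lo_lt_hi.le,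
    integral_Ioc_eq_integral_Ioo, integral_Ioc_eq_integral_Ioo]
  refine setIntegral_congr_fun measurableSet_Ioo fun s hs => ?_
  have : (fun z => {p : ℝ × ℝ | p.2 ≤ p.1}.indicator (fun p => w p.2) (z, s)) =
      (Set.Ici s).indicator fun _ => w s := by
    ext z; simp [Set.indicator]
  simp only [this]
  rw [integral_indicator_const _ measurableSet_Ici, mul_assoc, D.mul_density_ae hs, smul_eq_mul,
    mul_comm, measureReal_congr Ioi_ae_eq_Ici.symm, D.law_Ioi]

/-- The virtual surplus from allocating the first good optimally. -/
noncomputable def virtualSurplus (x : Fin N → ℝ) : ℝ :=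
  D.psi (kthHighest Finset.univ x 2) + kthHighest Finset.univ x 2 - kthHighest Finset.univ x 3

/-! ### The envelope theorem and the revenue bound for direct mechanisms. -/

namespace DirectMechanism

variable {D} (M : D.DirectMechanism N)

/-- Payoff over both periods before the payment to the first seller. -/
noncomputable def gross (q x : Fin N → ℝ) (i : Fin N) : ℝ :=
  M.P q i * x i
    + ∑ k ∈ Finset.univ.erase i, M.P q k * secondAuctionSurplus (Finset.univ.erase k) x i
    + (1 - ∑ k, M.P q k) * secondAuctionSurplus Finset.univ x i

/-- Probability of getting a unit in either period. -/
noncomputable def winProb (q x : Fin N → ℝ) (i : Fin N) : ℝ :=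
  M.P q i
    + ∑ k ∈ Finset.univ.erase i, M.P q k *
        (if kthHighest ((Finset.univ.erase k).erase i) x 1 < x i then 1 else 0)
    + (1 - ∑ k, M.P q k) * (if kthHighest (Finset.univ.erase i) x 1 < x i then 1 else 0)

/-- Expectation of `gross` for a buyer of type `x` who reports `q`. -/
noncomputable def interimGross (i : Fin N) (q x : ℝ) : ℝ :=
  ∫ y, M.gross (Function.update y i q) (Function.update y i x) i ∂D.jointLaw N

/-- Expectation of `winProb` for a buyer of type `x` who reports `q`. -/
noncomputable def interimWin (i : Fin N) (q x : ℝ) : ℝ :=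
  ∫ y, M.winProb (Function.update y i q) (Function.update y i x) i ∂D.jointLaw N

theorem payoff_eq (q x : Fin N → ℝ) (i : Fin N) : M.payoff q x i = M.gross q x i - M.t q i := rfl

theorem sum_weights (q : Fin N → ℝ) (i : Fin N) :
    M.P q i + ∑ k ∈ Finset.univ.erase i, M.P q k + (1 - ∑ k, M.P q k) = 1 := by
  rw [Finset.add_sum_erase _ _ (Finset.mem_univ i)]; ring

/-- The allocation probabilities and the probability of withholding are convex weights. Gross
payoffs and winning probabilities are mixtures with these weights, so they can be compared recipient
by recipient. -/
theorem weighted_le {q : Fin N → ℝ} (hq : ∀ j, q j ∈ Set.Icc D.lo D.hi) (i : Fin N) {A C C' : ℝ}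
    {B B' : Fin N → ℝ} {A' : ℝ} (hA : A ≤ A') (hB : ∀ k, B k ≤ B' k) (hC : C ≤ C') :
    M.P q i * A + ∑ k ∈ Finset.univ.erase i, M.P q k * B k + (1 - ∑ k, M.P q k) * C ≤
      M.P q i * A' + ∑ k ∈ Finset.univ.erase i, M.P q k * B' k + (1 - ∑ k, M.P q k) * C' := by
  have h1 := M.P_nonneg q hq
  have h2 := sub_nonneg.mpr (M.sum_P_le_one q hq)
  refine add_le_add (add_le_add (mul_le_mul_of_nonneg_left hA (h1 i))
    (Finset.sum_le_sum fun k _ => mul_le_mul_of_nonneg_left (hB k) (h1 k)))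
    (mul_le_mul_of_nonneg_left hC h2)

theorem weighted_const (q : Fin N → ℝ) (i : Fin N) (c : ℝ) :
    M.P q i * c + ∑ k ∈ Finset.univ.erase i, M.P q k * c + (1 - ∑ k, M.P q k) * c = c := by
  rw [← Finset.sum_mul, ← add_mul, ← add_mul, M.sum_weights, one_mul]

theorem winProb_mem {q : Fin N → ℝ} (hq : ∀ j, q j ∈ Set.Icc D.lo D.hi) (x : Fin N → ℝ)
    (i : Fin N) : M.winProb q x i ∈ Set.Icc 0 1 := by
  have h01 : ∀ p : Prop, [Decidable p] → (0 : ℝ) ≤ (if p then 1 else 0) ∧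
      (if p then 1 else 0) ≤ (1 : ℝ) := fun p _ => by split_ifs <;> norm_num
  have e : M.winProb q x i = M.P q i * 1 + ∑ k ∈ Finset.univ.erase i, M.P q k *
        (if kthHighest ((Finset.univ.erase k).erase i) x 1 < x i then 1 else 0)
    + (1 - ∑ k, M.P q k) * (if kthHighest (Finset.univ.erase i) x 1 < x i then 1 else 0) := by
    rw [mul_one]; rfl
  rw [e]
  constructor
  · refine (M.weighted_const q i 0).symm.le.trans ?_
    exact M.weighted_le hq i zero_le_one (fun k => (h01 _).1) (h01 _).1
  · exact (M.weighted_le hq i le_rfl (fun k => (h01 _).2) (h01 _).2).trans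
      (M.weighted_const q i 1).le

/-- The winning probability is a subgradient of the payoff with respect to the true type. -/
theorem gross_subgradient {q : Fin N → ℝ} (hq : ∀ j, q j ∈ Set.Icc D.lo D.hi) (y : Fin N → ℝ)
    (i : Fin N) (x z : ℝ) :
    M.gross q (Function.update y i x) i + (z - x) * M.winProb q (Function.update y i x) i ≤
      M.gross q (Function.update y i z) i := by
  -- In a second-price auction against the price `r`, the indicator of winning is a subgradient of
  -- the surplus.
  have hmax : ∀ r : ℝ, max (x - r) 0 + (z - x) * (if r < x then 1 else 0) ≤ max (z - r) 0 := by
    intro r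
    split_ifs with h
    · rw [max_eq_left (by linarith)]
      exact le_max_of_le_left (by linarith)
    · rw [max_eq_right (by linarith)]
      simp
  have key := M.weighted_le hq i (A := x + (z - x) * 1) (A' := z)
    (B := fun k => max (x - kthHighest ((Finset.univ.erase k).erase i) y 1) 0 +
      (z - x) * (if kthHighest ((Finset.univ.erase k).erase i) y 1 < x then 1 else 0))
    (B' := fun k => max (z - kthHighest ((Finset.univ.erase k).erase i) y 1) 0)
    (by linarith) (fun k => hmax _) (hmax (kthHighest (Finset.univ.erase i) y 1))
  refine le_trans (le_of_eq ?_) (key.trans (le_of_eq ?_))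
  · simp only [gross, winProb, secondAuctionSurplus_update, kthHighest_erase_update,
      Function.update_self]
    simp only [mul_add, Finset.sum_add_distrib, Finset.mul_sum]
    have : ∀ k, M.P q k *
        ((z - x) * (if kthHighest ((Finset.univ.erase k).erase i) y 1 < x then (1 : ℝ) else 0)) =
        (z - x) * (M.P q k *
          (if kthHighest ((Finset.univ.erase k).erase i) y 1 < x then (1 : ℝ) else 0)) :=
      fun k => by ring
    simp only [this]
    ring
  · simp only [gross, secondAuctionSurplus_update, Function.update_self]

section

variable (hN : 3 ≤ N)
include hN

omit hN in
theorem one_le_card_erase_erase (hN : 3 ≤ N) (k i : Fin N) :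
    1 ≤ ((Finset.univ.erase k).erase i).card := by
  have h1 : ((Finset.univ.erase k).erase i).card + 1 ≥ (Finset.univ.erase k).card := by
    have := Finset.pred_card_le_card_erase (s := Finset.univ.erase k) (a := i)
    omega
  rw [Finset.card_erase_of_mem (Finset.mem_univ k), Finset.card_univ, Fintype.card_fin] at h1
  omega

omit hN in
theorem card_univ_erase (i : Fin N) : (Finset.univ.erase i).card = N - 1 := by
  rw [Finset.card_erase_of_mem (Finset.mem_univ i), Finset.card_univ, Fintype.card_fin]

theorem measurable_gross (i : Fin N) :
    Measurable fun p : (Fin N → ℝ) × (Fin N → ℝ) => M.gross p.1 p.2 i := by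
  have hP : ∀ k, Measurable fun p : (Fin N → ℝ) × (Fin N → ℝ) => M.P p.1 k :=
    fun k => (M.measurable_P k).comp measurable_fst
  have hx : Measurable fun p : (Fin N → ℝ) × (Fin N → ℝ) => p.2 i :=
    (measurable_pi_apply i).comp measurable_snd
  have hk : ∀ s : Finset (Fin N), 1 ≤ (s.erase i).card →
      Measurable fun p : (Fin N → ℝ) × (Fin N → ℝ) => secondAuctionSurplus s p.2 i :=
    fun s hs => (hx.sub ((measurable_kthHighest le_rfl hs).comp measurable_snd)).max
      measurable_const
  unfold gross
  refine (((hP i).mul hx).add (Finset.measurable_sum _ fun k _ => (hP k).mul (hk _ ?_))).add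
    ((measurable_const.sub (Finset.measurable_sum _ fun k _ => hP k)).mul (hk _ ?_))
  · exact one_le_card_erase_erase hN k i
  · rw [card_univ_erase]; omega

theorem measurable_winProb (i : Fin N) :
    Measurable fun p : (Fin N → ℝ) × (Fin N → ℝ) => M.winProb p.1 p.2 i := by
  have hP : ∀ k, Measurable fun p : (Fin N → ℝ) × (Fin N → ℝ) => M.P p.1 k :=
    fun k => (M.measurable_P k).comp measurable_fst
  have hx : Measurable fun p : (Fin N → ℝ) × (Fin N → ℝ) => p.2 i :=
    (measurable_pi_apply i).comp measurable_snd
  have hk : ∀ s : Finset (Fin N), 1 ≤ s.card →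
      Measurable fun p : (Fin N → ℝ) × (Fin N → ℝ) =>
        if kthHighest s p.2 1 < p.2 i then (1 : ℝ) else 0 :=
    fun s hs => Measurable.ite (measurableSet_lt
      ((measurable_kthHighest le_rfl hs).comp measurable_snd) hx) measurable_const measurable_const
  unfold winProb
  refine ((hP i).add (Finset.measurable_sum _ fun k _ => (hP k).mul (hk _ ?_))).add
    ((measurable_const.sub (Finset.measurable_sum _ fun k _ => hP k)).mul (hk _ ?_))
  · exact one_le_card_erase_erase hN k i
  · rw [card_univ_erase]; omega

theorem gross_mem {q x : Fin N → ℝ} (hq : ∀ j, q j ∈ Set.Icc D.lo D.hi)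
    (hx : ∀ j, x j ∈ Set.Icc D.lo D.hi) (i : Fin N) : M.gross q x i ∈ Set.Icc 0 D.hi := by
  have hk : ∀ s : Finset (Fin N), 1 ≤ (s.erase i).card → secondAuctionSurplus s x i ≤ D.hi := by
    intro s hs
    have := kthHighest_mem (v := x) le_rfl hs (A := Set.Icc D.lo D.hi) fun j _ => hx j
    refine max_le ?_ (D.lo_nonneg.trans D.lo_lt_hi.le)
    linarith [(hx i).2, this.1, D.lo_nonneg]
  constructor
  · refine (M.weighted_const q i 0).symm.le.trans ?_
    exact M.weighted_le hq i (D.lo_nonneg.trans (hx i).1)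
      (fun k => secondAuctionSurplus_nonneg _ _ _) (secondAuctionSurplus_nonneg _ _ _)
  · exact (M.weighted_le hq i (hx i).2 (fun k => hk _ (one_le_card_erase_erase hN k i))
      (hk _ (by rw [card_univ_erase]; omega))).trans (M.weighted_const q i D.hi).le

omit hN in
theorem ae_update_mem (i : Fin N) {q : ℝ} (hq : q ∈ Set.Icc D.lo D.hi) :
    ∀ᵐ y ∂D.jointLaw N, ∀ j, Function.update y i q j ∈ Set.Icc D.lo D.hi := by
  filter_upwards [D.ae_mem_Icc_joint] with y hy j
  rcases eq_or_ne j i with rfl | h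
  · simpa using hq
  · simpa [h] using hy j

omit hN in
theorem measurable_update_pair (i : Fin N) (q x : ℝ) :
    Measurable fun y : Fin N → ℝ => (Function.update y i q, Function.update y i x) :=
  (measurable_update' (a := i)).comp (measurable_id.prodMk measurable_const) |>.prodMk
    ((measurable_update' (a := i)).comp (measurable_id.prodMk measurable_const))

theorem integrable_gross_update (i : Fin N) {q x : ℝ} (hq : q ∈ Set.Icc D.lo D.hi)
    (hx : x ∈ Set.Icc D.lo D.hi) :
    Integrable (fun y => M.gross (Function.update y i q) (Function.update y i x) i)
      (D.jointLaw N) := by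
  refine Integrable.of_mem_Icc 0 D.hi
    ((M.measurable_gross hN i).comp (measurable_update_pair i q x)).aemeasurable ?_
  filter_upwards [ae_update_mem i hq, ae_update_mem i hx] with y h1 h2 using M.gross_mem hN h1 h2 i

theorem integrable_winProb_update (i : Fin N) {q : ℝ} (hq : q ∈ Set.Icc D.lo D.hi) (x : ℝ) :
    Integrable (fun y => M.winProb (Function.update y i q) (Function.update y i x) i)
      (D.jointLaw N) := by
  refine Integrable.of_mem_Icc 0 1
    ((M.measurable_winProb hN i).comp (measurable_update_pair i q x)).aemeasurable ?_
  filter_upwards [ae_update_mem i hq] with y h1 using M.winProb_mem h1 _ i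

theorem integrable_gross (i : Fin N) : Integrable (fun x => M.gross x x i) (D.jointLaw N) := by
  refine Integrable.of_mem_Icc 0 D.hi
    ((M.measurable_gross hN i).comp (measurable_id.prodMk measurable_id)).aemeasurable ?_
  filter_upwards [D.ae_mem_Icc_joint] with y h1 using M.gross_mem hN h1 h1 i

theorem integrable_winProb_mul (i : Fin N) :
    Integrable (fun x => M.winProb x x i * (x i - D.psi (x i))) (D.jointLaw N) := by
  have h := ((D.measurePreserving_eval i).integrable_comp_of_integrable D.integrable_sub_psi)
  refine h.bdd_mul (c := 1)
    ((M.measurable_winProb hN i).comp (measurable_id.prodMk measurable_id)).aestronglyMeasurable ?_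
  filter_upwards [D.ae_mem_Icc_joint] with y h1
  have := M.winProb_mem h1 y i
  simpa [abs_of_nonneg this.1] using this.2

theorem interimPayoff_eq (i : Fin N) {q x : ℝ} (hq : q ∈ Set.Icc D.lo D.hi)
    (hx : x ∈ Set.Icc D.lo D.hi) :
    M.interimPayoff i q x = M.interimGross i q x -
      ∫ y, M.t (Function.update y i q) i ∂D.jointLaw N := by
  unfold interimPayoff interimGross
  simp only [payoff_eq]
  exact integral_sub (M.integrable_gross_update hN i hq hx) (M.integrable_t_update i q hq)

theorem interimGross_subgradient (i : Fin N) {q x z : ℝ} (hq : q ∈ Set.Icc D.lo D.hi)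
    (hx : x ∈ Set.Icc D.lo D.hi) (hz : z ∈ Set.Icc D.lo D.hi) :
    M.interimGross i q x + (z - x) * M.interimWin i q x ≤ M.interimGross i q z := by
  unfold interimGross interimWin
  rw [← integral_const_mul, ← integral_add (M.integrable_gross_update hN i hq hx)
    ((M.integrable_winProb_update hN i hq x).const_mul _)]
  refine integral_mono_ae ((M.integrable_gross_update hN i hq hx).add
    ((M.integrable_winProb_update hN i hq x).const_mul _))
    (M.integrable_gross_update hN i hq hz) ?_
  filter_upwards [ae_update_mem i hq] with y h1 using M.gross_subgradient h1 y i x z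

/-- Let type `z` report `x`. Incentive compatibility bounds the result by the truthful payoff of
`z`; the payment depends on the report alone, so the comparison with type `x` is the subgradient
inequality for the gross payoff. -/
theorem interimPayoff_subgradient (hM : M.IncentiveCompatible) (i : Fin N) :
    ∀ x ∈ Set.Icc D.lo D.hi, ∀ z ∈ Set.Icc D.lo D.hi,
      M.interimPayoff i x x + (z - x) * M.interimWin i x x ≤ M.interimPayoff i z z := by
  intro x hx z hz
  have h1 := hM i z hz x hx
  rw [M.interimPayoff_eq hN i hx hz] at h1
  rw [M.interimPayoff_eq hN i hx hx]
  linarith [M.interimGross_subgradient hN i hx hx hz]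

/-- The envelope theorem. -/
theorem interimPayoff_eq_integral (hM : M.IncentiveCompatible) (i : Fin N) {x : ℝ}
    (hx : x ∈ Set.Icc D.lo D.hi) :
    M.interimPayoff i x x = M.interimPayoff i D.lo D.lo + ∫ z in D.lo..x, M.interimWin i z z := by
  rw [integral_eq_sub_of_subgradient hx.1 (V := fun x => M.interimPayoff i x x)
    fun u hu v hv => M.interimPayoff_subgradient hN hM i u ⟨hu.1, hu.2.trans hx.2⟩ v
      ⟨hv.1, hv.2.trans hx.2⟩]
  ring

/-- The payment is gross surplus minus rent. By the envelope theorem the rent is that of the lowest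
type plus a primitive of the winning probability, and averaging the primitive over types weights
that probability by x - ψ(x). -/
theorem integral_t_eq (hM : M.IncentiveCompatible) (i : Fin N) :
    ∫ x, M.t x i ∂D.jointLaw N =
      ∫ x, (M.gross x x i - M.winProb x x i * (x i - D.psi (x i))) ∂D.jointLaw N
        - M.interimPayoff i D.lo D.lo := by
  have hmono := monotoneOn_of_subgradient (M.interimPayoff_subgradient hN hM i)
  have hw : IntervalIntegrable (fun z => M.interimWin i z z) volume D.lo D.hi :=
    (by rwa [← Set.uIcc_of_le D.lo_lt_hi.le] at hmono :
      MonotoneOn (fun z => M.interimWin i z z) (Set.uIcc D.lo D.hi)).intervalIntegrable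
  have h1 : ∫ x, (M.gross x x i - M.t x i) ∂D.jointLaw N =
      ∫ z, M.interimPayoff i z z ∂D.law := by
    exact D.integral_jointLaw_update i ((M.integrable_gross hN i).sub (M.integrable_t i))
  have hprim : ContinuousOn (fun z => ∫ s in D.lo..z, M.interimWin i s s) (Set.Icc D.lo D.hi) := by
    have := intervalIntegral.continuousOn_primitive_interval' hw Set.left_mem_uIcc
    rwa [Set.uIcc_of_le D.lo_lt_hi.le] at this
  have h2 : ∫ z, M.interimPayoff i z z ∂D.law = M.interimPayoff i D.lo D.lo +
      ∫ z, M.interimWin i z z * (z - D.psi z) ∂D.law := by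
    rw [← D.integral_law_primitive hw]
    have hres : D.law.restrict (Set.Icc D.lo D.hi) = D.law := by
      refine Measure.restrict_eq_self_of_ae_mem ?_
      filter_upwards [D.ae_mem_Ioo] with z hz using Set.Ioo_subset_Icc_self hz
    have hI : Integrable (fun z => ∫ s in D.lo..z, M.interimWin i s s) D.law := by
      have := hprim.integrableOn_Icc (μ := D.law)
      rwa [IntegrableOn, hres] at this
    have h := integral_add (integrable_const (M.interimPayoff i D.lo D.lo)) hI
    rw [integral_const, probReal_univ, one_smul] at h
    rw [← h]
    refine integral_congr_ae ?_
    filter_upwards [D.ae_mem_Ioo] with z hz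
    exact M.interimPayoff_eq_integral hN hM i (Set.Ioo_subset_Icc_self hz)
  have h3 : ∫ z, M.interimWin i z z * (z - D.psi z) ∂D.law =
      ∫ x, M.winProb x x i * (x i - D.psi (x i)) ∂D.jointLaw N := by
    rw [D.integral_jointLaw_update i (M.integrable_winProb_mul hN i)]
    refine integral_congr_ae (ae_of_all _ fun z => ?_)
    simp only [Function.update_self]
    rw [integral_mul_const]
    rfl
  rw [integral_sub (M.integrable_gross hN i) (M.integrable_t i)] at h1
  rw [integral_sub (M.integrable_gross hN i) (M.integrable_winProb_mul hN i)]
  linarith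

omit hN in
-- For a given recipient `k` of the first unit, subtracting the rents leaves ψ(x_k) from him, the
-- winner's virtual valuation minus the price from the second auction, and nothing from losers. The
-- sum over buyers and recipients is regrouped by recipient.
theorem sum_virtual (hN : 3 ≤ N) {x : Fin N → ℝ} (hx : Function.Injective x) (q : Fin N → ℝ) :
    ∑ i, (M.gross q x i - M.winProb q x i * (x i - D.psi (x i))) =
      D.psi (kthHighest Finset.univ x 1) - kthHighest Finset.univ x 2 +
      ∑ k, M.P q k * (D.psi (x k) + (D.psi (kthHighest (Finset.univ.erase k) x 1)
          - kthHighest (Finset.univ.erase k) x 2)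
        - (D.psi (kthHighest Finset.univ x 1) - kthHighest Finset.univ x 2)) := by
  set T : Finset (Fin N) → Fin N → ℝ := fun s i =>
    if kthHighest (s.erase i) x 1 < x i then D.psi (x i) - kthHighest (s.erase i) x 1 else 0 with hT
  have hterm : ∀ i, M.gross q x i - M.winProb q x i * (x i - D.psi (x i)) =
      M.P q i * D.psi (x i) + ∑ k ∈ Finset.univ.erase i, M.P q k * T (Finset.univ.erase k) i
        + (1 - ∑ k, M.P q k) * T Finset.univ i := by
    intro i
    have hs : ∀ s : Finset (Fin N), T s i = secondAuctionSurplus s x i -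
        (if kthHighest (s.erase i) x 1 < x i then 1 else 0) * (x i - D.psi (x i)) := by
      intro s
      rw [secondAuctionSurplus_eq_ite]
      simp only [hT]
      split_ifs <;> ring
    simp only [hs, gross, winProb, mul_sub, Finset.sum_sub_distrib, add_mul, Finset.sum_mul]
    simp only [← mul_assoc]
    ring
  have hcard : 2 ≤ (Finset.univ : Finset (Fin N)).card := by
    rw [Finset.card_univ, Fintype.card_fin]; omega
  have hsum : ∀ k, ∑ i ∈ Finset.univ.erase k, T (Finset.univ.erase k) i =
      D.psi (kthHighest (Finset.univ.erase k) x 1) - kthHighest (Finset.univ.erase k) x 2 :=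
    fun k => sum_winner (by rw [card_univ_erase]; omega) hx.injOn D.psi
  have hsum' : ∑ i, T Finset.univ i =
      D.psi (kthHighest Finset.univ x 1) - kthHighest Finset.univ x 2 :=
    sum_winner hcard hx.injOn D.psi
  have hcomm : ∑ i, ∑ k ∈ Finset.univ.erase i, M.P q k * T (Finset.univ.erase k) i =
      ∑ k, M.P q k * ∑ i ∈ Finset.univ.erase k, T (Finset.univ.erase k) i := by
    simp only [Finset.mul_sum]
    exact Finset.sum_comm' fun i k => by simp [eq_comm]
  simp only [hterm, Finset.sum_add_distrib]
  rw [hcomm, ← Finset.mul_sum, hsum']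
  simp only [hsum, mul_sub, mul_add, Finset.sum_sub_distrib, Finset.sum_add_distrib,
    ← Finset.sum_mul, sub_mul, one_mul]
  ring

omit hN in
/-- The gain in virtual surplus from allocating to one of the two highest types is
`virtualSurplus`; allocating to anybody else yields no more than that. -/
theorem gain_cases (hN : 3 ≤ N) (hψ : MonotoneOn D.psi (Set.Ioo D.lo D.hi)) {x : Fin N → ℝ}
    (hx : Function.Injective x) (hmem : ∀ j, x j ∈ Set.Ioo D.lo D.hi) (k : Fin N) :
    (kthHighest Finset.univ x 2 ≤ x k → D.psi (x k) + (D.psi (kthHighest (Finset.univ.erase k) x 1)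
          - kthHighest (Finset.univ.erase k) x 2)
        - (D.psi (kthHighest Finset.univ x 1) - kthHighest Finset.univ x 2) =
          D.virtualSurplus x) ∧
    D.psi (x k) + (D.psi (kthHighest (Finset.univ.erase k) x 1)
          - kthHighest (Finset.univ.erase k) x 2)
        - (D.psi (kthHighest Finset.univ x 1) - kthHighest Finset.univ x 2) ≤
          D.virtualSurplus x := by
  have hcard : 2 ≤ (Finset.univ : Finset (Fin N)).card := by
    rw [Finset.card_univ, Fintype.card_fin]; omega
  obtain ⟨a, -, b, -, hab, hlt, h⟩ := exists_top_two hcard hx.injOn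
  have hcard' : 1 ≤ ((Finset.univ.erase a).erase b : Finset (Fin N)).card :=
    one_le_card_erase_erase hN a b
  obtain ⟨c, hc, hcmax⟩ := Finset.exists_max_image _ x (Finset.card_pos.mp hcard')
  have hcb := Finset.ne_of_mem_erase hc
  have hca := Finset.ne_of_mem_erase (Finset.mem_of_mem_erase hc)
  have hltc : x c < x b := h c (Finset.mem_univ _) hca hcb
  have hmaxc : ∀ j, j ≠ a → j ≠ b → x j ≤ x c := fun j h1 h2 => hcmax j (by simp [h1, h2])
  have hmaxb : ∀ j, j ≠ a → x j ≤ x b := fun j h1 => by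
    rcases eq_or_ne j b with rfl | h2
    · rfl
    · exact (hmaxc j h1 h2).trans hltc.le
  have hmaxa : ∀ j, x j ≤ x a := fun j => by
    rcases eq_or_ne j a with rfl | h2
    · rfl
    · exact (hmaxb j h2).trans hlt.le
  have k1 : kthHighest Finset.univ x 1 = x a :=
    kthHighest_one_eq (Finset.mem_univ a) fun j _ => hmaxa j
  have k2 : kthHighest Finset.univ x 2 = x b :=
    kthHighest_two_eq (Finset.mem_univ a) (Finset.mem_univ b) hab hlt.le fun j _ => hmaxb j
  have k3 : kthHighest Finset.univ x 3 = x c :=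
    kthHighest_three_eq (Finset.mem_univ a) (Finset.mem_univ b) (Finset.mem_univ c) hab hca.symm
      hcb.symm hlt.le hltc.le fun j _ => hmaxc j
  unfold virtualSurplus
  rw [k1, k2, k3]
  have mem : ∀ {i : Fin N}, i ≠ k → i ∈ Finset.univ.erase k := fun h => by simp [h]
  rcases eq_or_ne k a with rfl | hka
  · have e1 : kthHighest (Finset.univ.erase k) x 1 = x b :=
      kthHighest_one_eq (mem hab.symm) fun j hj => hmaxb j (Finset.ne_of_mem_erase hj)
    have e2 : kthHighest (Finset.univ.erase k) x 2 = x c :=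
      kthHighest_two_eq (mem hab.symm) (mem hca) hcb.symm hltc.le fun j hj =>
        hmaxc j (Finset.ne_of_mem_erase hj)
    rw [e1, e2]
    constructor
    · intro _; ring
    · linarith
  have e1 : kthHighest (Finset.univ.erase k) x 1 = x a :=
    kthHighest_one_eq (mem hka.symm) fun j _ => hmaxa j
  rcases eq_or_ne k b with rfl | hkb
  · have e2 : kthHighest (Finset.univ.erase k) x 2 = x c :=
      kthHighest_two_eq (mem hab) (mem hcb) hca.symm (hltc.trans hlt).le fun j hj hja =>
        hmaxc j hja (Finset.ne_of_mem_erase hj)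
    rw [e1, e2]
    constructor
    · intro _; ring
    · linarith
  · have e2 : kthHighest (Finset.univ.erase k) x 2 = x b :=
      kthHighest_two_eq (mem hka.symm) (mem hkb.symm) hab hlt.le fun j hj hja => hmaxb j hja
    have hkc := hmaxc k hka hkb
    rw [e1, e2]
    constructor
    · intro hk; linarith
    -- The gain is ψ(x_k), and x₍₂₎ - x₍₃₎ is positive. The upper bound on revenue needs
    -- monotonicity of ψ only here.
    · have := hψ (hmem k) (hmem b) (hkc.trans hltc.le)
      linarith

/-- The mechanism that withholds the first good. -/
noncomputable def zero (D : ValueDistribution) (N : ℕ) : D.DirectMechanism N where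
  P _ _ := 0
  t _ _ := 0
  measurable_P _ := measurable_const
  P_nonneg _ _ _ := le_rfl
  sum_P_le_one _ _ := by simp
  measurable_t _ := measurable_const
  integrable_t _ := integrable_zero _ _ _
  integrable_t_update _ _ _ := integrable_zero _ _ _

omit hN in
theorem zero_payoff (q x : Fin N → ℝ) (i : Fin N) :
    (zero D N).payoff q x i = secondAuctionSurplus Finset.univ x i := by
  simp [payoff, zero]

omit hN in
theorem zero_interimPayoff (i : Fin N) (q x : ℝ) :
    (zero D N).interimPayoff i q x = D.outsideOption i x := by
  simp [interimPayoff, zero_payoff, outsideOption]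

omit hN in
theorem zero_incentiveCompatible : (zero D N).IncentiveCompatible := fun i x _ q _ => by
  rw [zero_interimPayoff, zero_interimPayoff]

omit hN in
theorem outsideOption_nonneg (i : Fin N) (x : ℝ) : 0 ≤ D.outsideOption i x :=
  integral_nonneg fun _ => secondAuctionSurplus_nonneg _ _ _

theorem outsideOption_lo (i : Fin N) : D.outsideOption i D.lo = 0 := by
  refine integral_eq_zero_of_ae ?_
  filter_upwards [D.ae_mem_Icc_joint] with y hy
  rw [secondAuctionSurplus_update]
  have := kthHighest_mem (v := y) (s := Finset.univ.erase i) (k := 1) le_rfl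
    (by rw [card_univ_erase]; omega) (A := Set.Icc D.lo D.hi) fun j _ => hy j
  exact max_eq_right (by linarith [this.1])

/-- The expected gain in virtual surplus over withholding the good. -/
theorem revenue_eq (hM : M.IncentiveCompatible) :
    M.revenue = ∫ x, ∑ k, M.P x k *
        (D.psi (x k) + (D.psi (kthHighest (Finset.univ.erase k) x 1)
          - kthHighest (Finset.univ.erase k) x 2)
        - (D.psi (kthHighest Finset.univ x 1) - kthHighest Finset.univ x 2)) ∂D.jointLaw N
      - ∑ i, M.interimPayoff i D.lo D.lo := by
  have hI₀ : ∀ (M : D.DirectMechanism N) (i : Fin N), Integrable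
      (fun x => M.gross x x i - M.winProb x x i * (x i - D.psi (x i))) (D.jointLaw N) :=
    fun M i => (M.integrable_gross hN i).sub (M.integrable_winProb_mul hN i)
  have hgen : ∀ M : D.DirectMechanism N, M.IncentiveCompatible → M.revenue =
      ∫ x, ∑ i, (M.gross x x i - M.winProb x x i * (x i - D.psi (x i))) ∂D.jointLaw N
        - ∑ i, M.interimPayoff i D.lo D.lo := by
    intro M hM
    unfold revenue
    rw [integral_finsetSum _ fun i _ => M.integrable_t i, integral_finsetSum _ fun i _ => hI₀ M i,
      ← Finset.sum_sub_distrib]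
    exact Finset.sum_congr rfl fun i _ => M.integral_t_eq hN hM i
  have hI : ∀ M : D.DirectMechanism N, Integrable
      (fun x => ∑ i, (M.gross x x i - M.winProb x x i * (x i - D.psi (x i)))) (D.jointLaw N) :=
    fun M => integrable_finsetSum _ fun i _ => hI₀ M i
  -- The same identity for the mechanism that always withholds, with no revenue and no rent at the
  -- bottom, shows that the terms of an unaffected second auction integrate to 0. Subtracting it
  -- leaves only the gains from allocation.
  have h0 := hgen (zero D N) zero_incentiveCompatible
  have h0' : (zero D N).revenue = 0 := by simp [revenue, zero]
  simp only [zero_interimPayoff, outsideOption_lo hN, Finset.sum_const_zero, sub_zero, h0'] at h0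
  rw [hgen M hM, ← sub_zero (∫ x, ∑ i, (M.gross x x i - _) ∂D.jointLaw N), h0,
    ← integral_sub (hI M) (hI (zero D N))]
  congr 1
  refine integral_congr_ae ?_
  filter_upwards [D.ae_injective_joint] with x hx
  rw [M.sum_virtual hN hx, (zero D N).sum_virtual hN hx]
  simp [zero]

omit hN in
theorem integrable_max_virtualSurplus (hN : 3 ≤ N) :
    Integrable (fun x : Fin N → ℝ => max (D.virtualSurplus x) 0) (D.jointLaw N) := by
  have hc : (Finset.univ : Finset (Fin N)).card = N := by simp
  have h2 : Measurable fun x : Fin N → ℝ => kthHighest Finset.univ x 2 :=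
    measurable_kthHighest (by norm_num) (by omega)
  have h3 : Measurable fun x : Fin N → ℝ => kthHighest Finset.univ x 3 :=
    measurable_kthHighest (by norm_num) (by omega)
  refine Integrable.of_mem_Icc 0 (2 * D.hi) ((((D.measurable_psi.comp h2).add h2).sub h3).max
    measurable_const).aemeasurable ?_
  filter_upwards [D.ae_mem_Icc_joint] with x hx
  have m2 := kthHighest_mem (v := x) (s := Finset.univ) (k := 2) (by norm_num) (by omega)
    (A := Set.Icc D.lo D.hi) fun j _ => hx j
  have m3 := kthHighest_mem (v := x) (s := Finset.univ) (k := 3) (by norm_num) (by omega)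
    (A := Set.Icc D.lo D.hi) fun j _ => hx j
  have := D.lo_nonneg
  have := D.psi_le (kthHighest Finset.univ x 2)
  exact ⟨le_max_right _ _, max_le (by unfold virtualSurplus; linarith [m2.2, m3.1])
    (by linarith [m2.1, m2.2])⟩

theorem revenue_le (hψ : MonotoneOn D.psi (Set.Ioo D.lo D.hi)) (hM : M.IncentiveCompatible)
    (hM' : M.IndividuallyRational) :
    M.revenue ≤ ∫ x, max (D.virtualSurplus x) 0 ∂D.jointLaw N := by
  rw [M.revenue_eq hN hM]
  have h1 : 0 ≤ ∑ i, M.interimPayoff i D.lo D.lo := Finset.sum_nonneg fun i _ =>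
    (outsideOption_nonneg i _).trans (hM' i _ ⟨le_rfl, D.lo_lt_hi.le⟩)
  refine (sub_le_self _ h1).trans ?_
  have h2 := integrable_max_virtualSurplus (D := D) hN
  -- If the gain were not integrable, its integral would be 0 by convention and the bound would hold
  -- trivially, so integrability need not be proved.
  by_cases hint : Integrable (fun x => ∑ k, M.P x k *
        (D.psi (x k) + (D.psi (kthHighest (Finset.univ.erase k) x 1)
          - kthHighest (Finset.univ.erase k) x 2)
        - (D.psi (kthHighest Finset.univ x 1) - kthHighest Finset.univ x 2))) (D.jointLaw N)
  swap
  · rw [integral_undef hint]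
    exact integral_nonneg fun _ => le_max_right _ _
  refine integral_mono_ae hint h2 ?_
  filter_upwards [D.ae_injective_joint, D.ae_mem_Ioo_joint] with x hx hmem
  have hmem' : ∀ j, x j ∈ Set.Icc D.lo D.hi := fun j => Set.Ioo_subset_Icc_self (hmem j)
  calc _ ≤ ∑ k, M.P x k * max (D.virtualSurplus x) 0 :=
        Finset.sum_le_sum fun k _ => mul_le_mul_of_nonneg_left
          ((gain_cases hN hψ hx hmem k).2.trans (le_max_left _ _)) (M.P_nonneg x hmem' k)
    _ = (∑ k, M.P x k) * max (D.virtualSurplus x) 0 := (Finset.sum_mul _ _ _).symm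
    _ ≤ _ := mul_le_of_le_one_left (le_max_right _ _) (M.sum_P_le_one x hmem')

theorem revenue_eq_of_optimal (hψ : MonotoneOn D.psi (Set.Ioo D.lo D.hi))
    (hM : M.IncentiveCompatible) (hlo : ∀ i, M.interimPayoff i D.lo D.lo = 0)
    (hP : ∀ᵐ x ∂D.jointLaw N, ∀ k, M.P x k =
      if x k = kthHighest Finset.univ x 2 ∧ 0 ≤ D.virtualSurplus x then 1 else 0) :
    M.revenue = ∫ x, max (D.virtualSurplus x) 0 ∂D.jointLaw N := by
  rw [M.revenue_eq hN hM]
  simp only [hlo, Finset.sum_const_zero, sub_zero]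
  refine integral_congr_ae ?_
  filter_upwards [hP, D.ae_injective_joint, D.ae_mem_Ioo_joint] with x hP hx hmem
  obtain ⟨j, -, hj, -⟩ := exists_kthHighest (v := x) (s := Finset.univ) (k := 2) (by norm_num)
    (by rw [Finset.card_univ, Fintype.card_fin]; omega)
  rw [Finset.sum_eq_single_of_mem j (Finset.mem_univ j)]
  · rw [(gain_cases hN hψ hx hmem j).1 hj.le, hP]
    by_cases h : 0 ≤ D.virtualSurplus x
    · rw [if_pos ⟨hj.symm, h⟩, one_mul, max_eq_left h]
    · rw [if_neg fun h' => h h'.2, zero_mul, max_eq_right (not_le.mp h).le]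
  · intro k _ hkj
    rw [hP, if_neg, zero_mul]
    rintro ⟨h, -⟩
    exact hkj (hx (h.trans hj))

end

end DirectMechanism

end ValueDistribution

/-! ### Order statistics of the rivals of one buyer. -/

/-- The highest value among the rivals of `i`. -/
noncomputable def topRival {N : ℕ} (i : Fin N) (y : Fin N → ℝ) : ℝ :=
  kthHighest (Finset.univ.erase i) y 1

/-- The second-highest value among the rivals of `i`. -/
noncomputable def secondRival {N : ℕ} (i : Fin N) (y : Fin N → ℝ) : ℝ :=
  kthHighest (Finset.univ.erase i) y 2

/-- `a` and `b` have the two highest values among the rivals of `i`, without ties. -/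
structure TopRivals {N : ℕ} (i : Fin N) (y : Fin N → ℝ) (a b : Fin N) : Prop where
  ne_a : a ≠ i
  ne_b : b ≠ i
  ne : a ≠ b
  lt : y b < y a
  others_lt : ∀ j, j ≠ i → j ≠ a → j ≠ b → y j < y b

section Rivals

variable {N : ℕ} {i a b : Fin N} {y : Fin N → ℝ}

theorem exists_topRivals (hN : 3 ≤ N) (hy : Function.Injective y) (i : Fin N) :
    ∃ a b, TopRivals i y a b := by
  obtain ⟨a, ha, b, hb, hab, hlt, h⟩ := exists_top_two (s := Finset.univ.erase i) (v := y)
    (by rw [Finset.card_erase_of_mem (Finset.mem_univ i), Finset.card_univ, Fintype.card_fin]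
        omega) hy.injOn
  exact ⟨a, b, Finset.ne_of_mem_erase ha, Finset.ne_of_mem_erase hb, hab, hlt,
    fun j hji => h j (by simp [hji])⟩

namespace TopRivals

variable (h : TopRivals i y a b)
include h

theorem le_b {j : Fin N} (hi : j ≠ i) (ha : j ≠ a) : y j ≤ y b := by
  rcases eq_or_ne j b with rfl | hb
  · rfl
  · exact (h.others_lt j hi ha hb).le

theorem le_a {j : Fin N} (hi : j ≠ i) : y j ≤ y a := by
  rcases eq_or_ne j a with rfl | ha
  · rfl
  · exact (h.le_b hi ha).trans h.lt.le

theorem topRival_eq : topRival i y = y a :=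
  kthHighest_one_eq (by simp [h.ne_a]) fun _ hj => h.le_a (Finset.ne_of_mem_erase hj)

theorem secondRival_eq : secondRival i y = y b :=
  kthHighest_two_eq (by simp [h.ne_a]) (by simp [h.ne_b]) h.ne h.lt.le
    fun _ hj hja => h.le_b (Finset.ne_of_mem_erase hj) hja

theorem kthHighest_erase_a : kthHighest ((Finset.univ.erase a).erase i) y 1 = y b :=
  kthHighest_one_eq (by simp [h.ne_b, h.ne.symm]) fun j hj => by
    simp only [Finset.mem_erase] at hj
    exact h.le_b hj.1 hj.2.1

theorem kthHighest_erase_of_ne {k : Fin N} (hk : k ≠ a) :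
    kthHighest ((Finset.univ.erase k).erase i) y 1 = y a :=
  kthHighest_one_eq (by simp [h.ne_a, hk.symm]) fun j hj => by
    simp only [Finset.mem_erase] at hj
    exact h.le_a hj.1

end TopRivals

theorem topRival_update (i : Fin N) (y : Fin N → ℝ) (z : ℝ) :
    topRival i (Function.update y i z) = topRival i y := kthHighest_erase_update i z

theorem secondRival_update (i : Fin N) (y : Fin N → ℝ) (z : ℝ) :
    secondRival i (Function.update y i z) = secondRival i y := kthHighest_erase_update i z

theorem topRival_mem (hN : 3 ≤ N) {A : Set ℝ} (h : ∀ j ≠ i, y j ∈ A) : topRival i y ∈ A :=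
  kthHighest_mem le_rfl (by
    rw [Finset.card_erase_of_mem (Finset.mem_univ i), Finset.card_univ, Fintype.card_fin]; omega)
    fun j hj => h j (Finset.ne_of_mem_erase hj)

theorem secondRival_mem (hN : 3 ≤ N) {A : Set ℝ} (h : ∀ j ≠ i, y j ∈ A) : secondRival i y ∈ A :=
  kthHighest_mem (by norm_num) (by
    rw [Finset.card_erase_of_mem (Finset.mem_univ i), Finset.card_univ, Fintype.card_fin]; omega)
    fun j hj => h j (Finset.ne_of_mem_erase hj)

theorem measurable_topRival (hN : 3 ≤ N) (i : Fin N) : Measurable (topRival i) :=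
  measurable_kthHighest le_rfl (by
    rw [Finset.card_erase_of_mem (Finset.mem_univ i), Finset.card_univ, Fintype.card_fin]; omega)

theorem measurable_secondRival (hN : 3 ≤ N) (i : Fin N) : Measurable (secondRival i) :=
  measurable_kthHighest (by norm_num) (by
    rw [Finset.card_erase_of_mem (Finset.mem_univ i), Finset.card_univ, Fintype.card_fin]; omega)

theorem le_secondRival (hN : 3 ≤ N) {j l : Fin N} {t : ℝ} (hj : j ≠ i) (hl : l ≠ i) (hjl : j ≠ l)
    (htj : t ≤ y j) (htl : t ≤ y l) : t ≤ secondRival i y := by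
  classical
  refine (le_kthHighest_iff (by norm_num) (by
    rw [Finset.card_erase_of_mem (Finset.mem_univ i), Finset.card_univ, Fintype.card_fin]
    omega)).mpr ?_
  rw [← Finset.card_pair hjl]
  refine Finset.card_le_card fun m hm => ?_
  simp only [Finset.mem_insert, Finset.mem_singleton] at hm
  rcases hm with rfl | rfl <;> simp [*]

theorem topRival_le (hN : 3 ≤ N) {t : ℝ} (h : ∀ j ≠ i, y j ≤ t) : topRival i y ≤ t :=
  topRival_mem (A := Set.Iic t) hN h

end Rivals

/-! ### Winning and paying from the viewpoint of one buyer. -/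

namespace ValueDistribution

variable (D : ValueDistribution) {N : ℕ}

/-- Type `q` of buyer `i` is the second-highest and gets the first good. -/
def WinsAsSecond (i : Fin N) (q : ℝ) (y : Fin N → ℝ) : Prop :=
  q < topRival i y ∧ secondRival i y < q ∧ secondRival i y ≤ q + D.psi q

/-- Type `q` of buyer `i` is the highest or gets the first good. -/
def PaysBid (i : Fin N) (q : ℝ) (y : Fin N → ℝ) : Prop :=
  topRival i y < q ∨ D.WinsAsSecond i q y

open scoped Classical in
/-- The highest rival in the second auction if buyer `i` is the highest type. -/
noncomputable def rivalPrice (i : Fin N) (y : Fin N → ℝ) : ℝ :=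
  if secondRival i y ≤ topRival i y + D.psi (topRival i y) then secondRival i y else topRival i y

variable {D}

theorem winsAsSecond_update {i : Fin N} {q z : ℝ} {y : Fin N → ℝ} :
    D.WinsAsSecond i q (Function.update y i z) ↔ D.WinsAsSecond i q y := by
  unfold WinsAsSecond
  rw [topRival_update, secondRival_update]

theorem rivalPrice_update {i : Fin N} {z : ℝ} {y : Fin N → ℝ} :
    D.rivalPrice i (Function.update y i z) = D.rivalPrice i y := by
  unfold rivalPrice
  rw [topRival_update, secondRival_update]

theorem measurableSet_winsAsSecond (hN : 3 ≤ N) (i : Fin N) {q : (Fin N → ℝ) → ℝ}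
    (hq : Measurable q) : MeasurableSet {y | D.WinsAsSecond i (q y) y} :=
  (measurableSet_lt hq (measurable_topRival hN i)).inter
    ((measurableSet_lt (measurable_secondRival hN i) hq).inter
      (measurableSet_le (measurable_secondRival hN i) (hq.add (D.measurable_psi.comp hq))))

theorem measurableSet_paysBid (hN : 3 ≤ N) (i : Fin N) {q : (Fin N → ℝ) → ℝ}
    (hq : Measurable q) : MeasurableSet {y | D.PaysBid i (q y) y} :=
  (measurableSet_lt (measurable_topRival hN i) hq).union (measurableSet_winsAsSecond hN i hq)

theorem measurable_rivalPrice (hN : 3 ≤ N) (i : Fin N) : Measurable (D.rivalPrice i) :=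
  Measurable.ite (measurableSet_le (measurable_secondRival hN i)
    ((measurable_topRival hN i).add (D.measurable_psi.comp (measurable_topRival hN i))))
    (measurable_secondRival hN i) (measurable_topRival hN i)

theorem rivalPrice_mem (hN : 3 ≤ N) {i : Fin N} {y : Fin N → ℝ} {A : Set ℝ}
    (h : ∀ j ≠ i, y j ∈ A) : D.rivalPrice i y ∈ A := by
  unfold rivalPrice
  split_ifs
  · exact secondRival_mem hN h
  · exact topRival_mem hN h

theorem rivalPrice_le {i a b : Fin N} {y : Fin N → ℝ} (h : TopRivals i y a b) :
    D.rivalPrice i y ≤ topRival i y := by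
  unfold rivalPrice
  split_ifs
  · rw [h.secondRival_eq, h.topRival_eq]; exact h.lt.le
  · rfl

theorem not_winsAsSecond_of_two (hN : 3 ≤ N) {x : Fin N → ℝ} {k j l : Fin N} (hj : j ≠ k)
    (hl : l ≠ k) (hjl : j ≠ l) (hxj : x k ≤ x j) (hxl : x k ≤ x l) :
    ¬ D.WinsAsSecond k (x k) x :=
  fun h => absurd h.2.1 (not_lt.mpr (le_secondRival hN hj hl hjl hxj hxl))

theorem not_winsAsSecond_of_top (hN : 3 ≤ N) {x : Fin N → ℝ} {k : Fin N}
    (h : ∀ j ≠ k, x j ≤ x k) : ¬ D.WinsAsSecond k (x k) x :=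
  fun h' => absurd h'.1 (not_lt.mpr (topRival_le hN h))

/-- Somebody ranks strictly above the winner with the higher report. Together with that winner this
makes two rivals at or above the other one, who then does not win as second. Ties are covered, since
feasibility of the mechanism is required at every vector of reports. -/
theorem winsAsSecond_unique (hN : 3 ≤ N) {x : Fin N → ℝ} {j l : Fin N}
    (hj : D.WinsAsSecond j (x j) x) (hl : D.WinsAsSecond l (x l) x) : j = l := by
  wlog hle : x j ≤ x l generalizing j l
  · exact (this hl hj (not_le.mp hle).le).symm
  by_contra hne
  obtain ⟨m, hm, hmx⟩ : ∃ m ≠ l, topRival l x = x m :=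
    topRival_mem (A := {t | ∃ m ≠ l, t = x m}) hN fun m hm => ⟨m, hm, rfl⟩
  have hlt : x l < x m := hmx ▸ hl.1
  have hmj : m ≠ j := by rintro rfl; linarith
  exact not_winsAsSecond_of_two hN (Ne.symm hne) hmj hm.symm hle (hle.trans hlt.le) hj

theorem lo_le_hi_mem : D.lo ∈ Set.Icc D.lo D.hi := ⟨le_rfl, D.lo_lt_hi.le⟩

/-! ### The probability of paying -/

section PayProb

theorem real_pi_univ (s : Fin N → Set ℝ) :
    (D.jointLaw N).real (Set.univ.pi s) = ∏ j, D.law.real (s j) := by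
  rw [Measure.real, jointLaw, Measure.pi_pi, ENNReal.toReal_prod]
  rfl

theorem ae_generic (N : ℕ) (q : ℝ) : ∀ᵐ y ∂D.jointLaw N, Function.Injective y ∧
    (∀ j, y j ∈ Set.Ioo D.lo D.hi) ∧ ∀ j, y j ≠ q := by
  filter_upwards [D.ae_injective_joint, D.ae_mem_Ioo_joint, D.ae_ne_joint q] with y h1 h2 h3
    using ⟨h1, h2, h3⟩

-- Up to null sets the event is a disjoint union of boxes: all rivals below `q`, or, for one of the
-- N - 1 rivals, that rival above `q` and the other N - 2 at most `payThreshold`. Coordinate `i` is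
-- free and contributes 1.
open scoped Classical in
theorem integral_paysBid (hN : 3 ≤ N) (i : Fin N) (q : ℝ) :
    ∫ y, (if D.PaysBid i q y then (1 : ℝ) else 0) ∂D.jointLaw N = D.payProb N q := by
  set s₀ : Fin N → Set ℝ := fun l => if l = i then Set.univ else Set.Iio q with hs₀
  set s : Fin N → Fin N → Set ℝ := fun j l => if l = i then Set.univ else if l = j then Set.Ioi q
    else Set.Iic (D.payThreshold q) with hs
  have hms₀ : MeasurableSet (Set.univ.pi s₀) := MeasurableSet.univ_pi fun l => by
    simp only [hs₀]; split_ifs <;> measurability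
  have hms : ∀ j, MeasurableSet (Set.univ.pi (s j)) := fun j => MeasurableSet.univ_pi fun l => by
    simp only [hs]; split_ifs <;> measurability
  have hae : (fun y => if D.PaysBid i q y then (1 : ℝ) else 0) =ᵐ[D.jointLaw N] fun y =>
      (Set.univ.pi s₀).indicator (fun _ => (1 : ℝ)) y +
        ∑ j ∈ Finset.univ.erase i, (Set.univ.pi (s j)).indicator (fun _ => (1 : ℝ)) y := by
    filter_upwards [ae_generic N q] with y hy
    obtain ⟨hinj, -, hne⟩ := hy
    obtain ⟨a, b, h⟩ := exists_topRivals hN hinj i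
    have hzero : ∀ j ∈ Finset.univ.erase i, j ≠ a → q < y a →
        (Set.univ.pi (s j)).indicator (fun _ => (1 : ℝ)) y = 0 := by
      intro j _ hja hq
      refine Set.indicator_of_notMem (fun hmem => ?_) _
      have := hmem a (Set.mem_univ a)
      simp only [hs, if_neg h.ne_a, if_neg hja.symm, Set.mem_Iic] at this
      exact absurd (this.trans (min_le_left _ _)) (not_le.mpr hq)
    unfold PaysBid WinsAsSecond
    rw [h.topRival_eq, h.secondRival_eq]
    rcases lt_or_gt_of_ne (hne a) with hq | hq
    · rw [if_pos (Or.inl hq), Set.indicator_of_mem, Finset.sum_eq_zero, add_zero]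
      · intro j hj
        refine Set.indicator_of_notMem (fun hmem => ?_) _
        have hji := Finset.ne_of_mem_erase hj
        have := hmem j (Set.mem_univ j)
        simp only [hs, if_neg hji, if_true, Set.mem_Ioi] at this
        linarith [h.le_a hji]
      · intro l _
        simp only [hs₀]
        split_ifs with hl
        · trivial
        · exact (h.le_a hl).trans_lt hq
    · rw [Set.indicator_of_notMem, zero_add,
        Finset.sum_eq_single_of_mem a (by simp [h.ne_a]) fun j hj hja => hzero j hj hja hq]
      · have hiff : (y a < q ∨ q < y a ∧ y b < q ∧ y b ≤ q + D.psi q) ↔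
            y ∈ Set.univ.pi (s a) := by
          constructor
          · rintro (h' | ⟨-, h1, h2⟩)
            · linarith
            · intro l _
              simp only [hs]
              split_ifs with hl hla
              · trivial
              · exact hla ▸ hq
              · exact (h.le_b hl hla).trans (le_min h1.le h2)
          · intro hmem
            have := hmem b (Set.mem_univ b)
            simp only [hs, if_neg h.ne_b, if_neg h.ne.symm, Set.mem_Iic, payThreshold,
              le_min_iff] at this
            exact Or.inr ⟨hq, lt_of_le_of_ne this.1 (hne b), this.2⟩
        by_cases hmem : y ∈ Set.univ.pi (s a)
        · rw [if_pos (hiff.mpr hmem), Set.indicator_of_mem hmem]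
        · rw [if_neg (mt hiff.mp hmem), Set.indicator_of_notMem hmem]
      · intro hmem
        have := hmem a (Set.mem_univ a)
        simp only [hs₀, if_neg h.ne_a, Set.mem_Iio] at this
        linarith
  rw [integral_congr_ae hae, integral_add ((integrable_const _).indicator hms₀)
    (integrable_finsetSum _ fun j _ => (integrable_const _).indicator (hms j)),
    integral_finsetSum _ fun j _ => (integrable_const _).indicator (hms j)]
  simp only [integral_indicator_const _ hms₀, integral_indicator_const _ (hms _), smul_eq_mul,
    mul_one, real_pi_univ]
  have e₀ : ∏ l, D.law.real (s₀ l) = D.F q ^ (N - 1) := by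
    rw [← Finset.mul_prod_erase _ _ (Finset.mem_univ i)]
    have : ∀ l ∈ Finset.univ.erase i, D.law.real (s₀ l) = D.F q := fun l hl => by
      simp only [hs₀, if_neg (Finset.ne_of_mem_erase hl), law_Iio]
    rw [Finset.prod_congr rfl this, Finset.prod_const, DirectMechanism.card_univ_erase]
    simp [hs₀]
  have e : ∀ j ∈ Finset.univ.erase i, ∏ l, D.law.real (s j l) =
      D.F (D.payThreshold q) ^ (N - 2) * (1 - D.F q) := by
    intro j hj
    have hji := Finset.ne_of_mem_erase hj
    rw [← Finset.mul_prod_erase _ _ (Finset.mem_univ i), ← Finset.mul_prod_erase _ _ hj]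
    have : ∀ l ∈ (Finset.univ.erase i).erase j, D.law.real (s j l) = D.F (D.payThreshold q) :=
      fun l hl => by
        simp only [Finset.mem_erase] at hl
        simp only [hs, if_neg hl.2.1, if_neg hl.1]
        rfl
    rw [Finset.prod_congr rfl this, Finset.prod_const, Finset.card_erase_of_mem hj,
      DirectMechanism.card_univ_erase]
    simp only [hs, if_true, if_neg hji, law_Ioi, probReal_univ, one_mul]
    rw [mul_comm, Nat.sub_sub]
  rw [e₀, Finset.sum_congr rfl e, Finset.sum_const, DirectMechanism.card_univ_erase, nsmul_eq_mul,
    payProb, Nat.cast_sub (by omega), Nat.cast_one]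
  ring

end PayProb

end ValueDistribution

/-! ### The optimal mechanism: payoffs, incentives, revenue. -/

namespace ValueDistribution

variable {D : ValueDistribution} {N : ℕ}

section OptimalMechanism

variable (hN : 3 ≤ N) (hψ : MonotoneOn D.psi (Set.Ioo D.lo D.hi))
  (hdiff : DifferentiableOn ℝ D.psi (Set.Ioo (D.a 0) D.psiInvZero))

variable (D) in
/-- The bid function, extended by constants beyond the range of types. -/
noncomputable def clampedBid (N : ℕ) (x : ℝ) : ℝ := D.bid N (max D.lo (min D.hi x))

theorem clamp_mem (x : ℝ) : max D.lo (min D.hi x) ∈ Set.Icc D.lo D.hi :=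
  ⟨le_max_left _ _, max_le D.lo_lt_hi.le (min_le_left _ _)⟩

theorem clampedBid_eq {x : ℝ} (hx : x ∈ Set.Icc D.lo D.hi) : D.clampedBid N x = D.bid N x := by
  rw [clampedBid, min_eq_right hx.2, max_eq_right hx.1]

variable (D) in
open scoped Classical in
/-- What buyer `i` pays in the optimal mechanism: what he pays in the modified pay-your-bid auction if
nobody's reports deviate from the bid function. -/
noncomputable def optimalPayment (x : Fin N → ℝ) (i : Fin N) : ℝ :=
  if topRival i x < x i then D.clampedBid N (x i) - D.rivalPrice i x
  else if D.WinsAsSecond i (x i) x then D.clampedBid N (x i) else 0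

include hN hψ hdiff

/-- Clamping makes the bid function monotone on the whole line, hence measurable without any look at
its formula. -/
theorem measurable_clampedBid : Measurable (D.clampedBid N) := by
  have : Monotone (D.clampedBid N) := fun x y hxy =>
    (D.bid_strictMonoOn hN hψ hdiff).monotoneOn (clamp_mem x) (clamp_mem y)
      (max_le_max le_rfl (min_le_min le_rfl hxy))
  exact this.measurable

theorem measurable_optimalPayment (i : Fin N) :
    Measurable fun x : Fin N → ℝ => D.optimalPayment x i := by
  have hB := (measurable_clampedBid hN hψ hdiff).comp (measurable_pi_apply i (X := fun _ => ℝ))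
  exact Measurable.ite (measurableSet_lt (measurable_topRival hN i) (measurable_pi_apply i))
    (hB.sub (measurable_rivalPrice hN i))
    (Measurable.ite (measurableSet_winsAsSecond hN i (measurable_pi_apply i)) hB measurable_const)

theorem optimalPayment_mem {x : Fin N → ℝ} (hx : ∀ j, x j ∈ Set.Icc D.lo D.hi) (i : Fin N) :
    D.optimalPayment x i ∈ Set.Icc (-D.hi) D.hi := by
  have h1 := D.bid_nonneg hN hψ hdiff (hx i)
  have h2 := (D.bid_le_self hN hψ hdiff (hx i)).trans (hx i).2
  have h3 := rivalPrice_mem (D := D) hN (i := i) (A := Set.Icc D.lo D.hi) fun j _ => hx j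
  have h4 := D.lo_nonneg
  have h5 := D.lo_lt_hi
  unfold optimalPayment
  rw [clampedBid_eq (hx i)]
  split_ifs <;> constructor <;> linarith [h3.1, h3.2]

open scoped Classical in
/-- The direct mechanism corresponding to the modified pay-your-bid auction. -/
noncomputable def optimalMechanism : D.DirectMechanism N where
  P x i := if D.WinsAsSecond i (x i) x then 1 else 0
  t x i := D.optimalPayment x i
  measurable_P i := Measurable.ite (measurableSet_winsAsSecond hN i (measurable_pi_apply i))
    measurable_const measurable_const
  P_nonneg _ _ _ := by split_ifs <;> norm_num
  sum_P_le_one x _ := by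
    rw [Finset.sum_boole]
    have : (Finset.univ.filter fun i => D.WinsAsSecond i (x i) x).card ≤ 1 :=
      Finset.card_le_one.mpr fun j hj l hl =>
        winsAsSecond_unique hN (Finset.mem_filter.mp hj).2 (Finset.mem_filter.mp hl).2
    exact_mod_cast this
  measurable_t i := measurable_optimalPayment hN hψ hdiff i
  integrable_t i := by
    refine Integrable.of_mem_Icc (-D.hi) D.hi
      (measurable_optimalPayment hN hψ hdiff i).aemeasurable ?_
    filter_upwards [D.ae_mem_Icc_joint] with x hx using optimalPayment_mem hN hψ hdiff hx i
  integrable_t_update i q hq := by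
    refine Integrable.of_mem_Icc (-D.hi) D.hi ((measurable_optimalPayment hN hψ hdiff i).comp
      ((measurable_update' (a := i)).comp
        (measurable_id.prodMk measurable_const))).aemeasurable ?_
    filter_upwards [DirectMechanism.ae_update_mem i hq] with y hy
      using optimalPayment_mem hN hψ hdiff hy i

open scoped Classical in
/-- The mixture over the possible recipients of the first good, when `i` reports `q`. -/
theorem optimalMechanism_mix {i a b : Fin N} {y : Fin N → ℝ} (h : TopRivals i y a b) {q : ℝ}
    (hq : ∀ j, y j ≠ q) (A C : ℝ) (B : Fin N → ℝ) (hB : ∀ k, k ≠ i → k ≠ a → B k = C) :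
    let P := (optimalMechanism hN hψ hdiff).P (Function.update y i q)
    P i * A + ∑ k ∈ Finset.univ.erase i, P k * B k + (1 - ∑ k, P k) * C =
      if topRival i y < q then
        (if secondRival i y ≤ topRival i y + D.psi (topRival i y) then B a else C)
      else if D.WinsAsSecond i q y then A else C := by
  intro P
  set x := Function.update y i q with hx
  have hxi : x i = q := by simp [hx]
  have hxj : ∀ j, j ≠ i → x j = y j := fun j hj => by simp [hx, hj]
  have hPdef : ∀ k, P k = if D.WinsAsSecond k (x k) x then 1 else 0 := fun k => rfl
  have hPi : P i = if D.WinsAsSecond i q y then 1 else 0 := by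
    rw [hPdef, hxi, hx]; simp only [winsAsSecond_update]
  -- Only `i` and the top rival `a` matter as recipients: when anybody else gets the unit, the value
  -- for `i` is the same as under withholding.
  have key : P i * A + ∑ k ∈ Finset.univ.erase i, P k * B k + (1 - ∑ k, P k) * C =
      C + P i * (A - C) + P a * (B a - C) := by
    rw [← Finset.add_sum_erase _ _ (Finset.mem_univ i)]
    have hmem : a ∈ Finset.univ.erase i := by simp [h.ne_a]
    rw [← Finset.add_sum_erase _ _ hmem, ← Finset.add_sum_erase _ P hmem]
    have : ∑ k ∈ (Finset.univ.erase i).erase a, P k * B k =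
        (∑ k ∈ (Finset.univ.erase i).erase a, P k) * C := by
      rw [Finset.sum_mul]
      refine Finset.sum_congr rfl fun k hk => ?_
      simp only [Finset.mem_erase] at hk
      rw [hB k hk.2.1 hk.1]
    rw [this]
    ring
  rw [key]
  have hPa_of_lt : q < y a → P a = 0 := fun hlt => by
    rw [hPdef, if_neg]
    refine not_winsAsSecond_of_top hN fun j _ => ?_
    rw [hxj a h.ne_a]
    rcases eq_or_ne j i with rfl | hj
    · rw [hxi]; exact hlt.le
    · rw [hxj j hj]; exact h.le_a hj
  have hPa : y a < q → P a = if y b ≤ y a + D.psi (y a) then 1 else 0 := fun hlt => by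
    have h1 : topRival a x = q := by
      rw [← hxi]
      refine kthHighest_one_eq (by simp [h.ne_a.symm]) fun j _ => ?_
      rcases eq_or_ne j i with rfl | hji
      · rfl
      · rw [hxi, hxj j hji]; exact (h.le_a hji).trans hlt.le
    have h2 : secondRival a x = y b := by
      rw [← hxj b h.ne_b]
      refine kthHighest_two_eq (a := i) (by simp [h.ne_a.symm]) (by simp [h.ne.symm]) h.ne_b.symm
        (by rw [hxi, hxj b h.ne_b]; exact (h.lt.trans hlt).le) fun j hj hji => ?_
      rw [hxj j hji, hxj b h.ne_b]
      exact h.le_b hji (Finset.ne_of_mem_erase hj)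
    rw [hPdef, WinsAsSecond, h1, h2, hxj a h.ne_a]
    simp [hlt, h.lt]
  rw [hPi, WinsAsSecond, h.topRival_eq, h.secondRival_eq]
  rcases lt_or_gt_of_ne (hq a) with hlt | hlt
  · rw [hPa hlt, if_pos hlt, if_neg fun h' => absurd h'.1 hlt.not_gt]
    split_ifs <;> ring
  · rw [hPa_of_lt hlt, if_neg hlt.not_gt]
    split_ifs <;> ring

open scoped Classical in
theorem optimalMechanism_gross {i a b : Fin N} {y : Fin N → ℝ} (h : TopRivals i y a b) {q : ℝ}
    (hq : ∀ j, y j ≠ q) (z : ℝ) :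
    (optimalMechanism hN hψ hdiff).gross (Function.update y i q) (Function.update y i z) i =
      if topRival i y < q then max (z - D.rivalPrice i y) 0
      else if D.WinsAsSecond i q y then z else max (z - topRival i y) 0 := by
  have key := optimalMechanism_mix hN hψ hdiff h hq z (max (z - y a) 0)
    (fun k => max (z - kthHighest ((Finset.univ.erase k).erase i) y 1) 0)
    (fun k _ hka => by rw [h.kthHighest_erase_of_ne hka])
  rw [← h.topRival_eq, h.kthHighest_erase_a, ← h.secondRival_eq] at key
  simp only [DirectMechanism.gross, secondAuctionSurplus_update, Function.update_self]
  refine key.trans ?_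
  unfold rivalPrice
  split_ifs <;> rfl

open scoped Classical in
theorem optimalMechanism_winProb {i a b : Fin N} {y : Fin N → ℝ} (h : TopRivals i y a b) {q : ℝ}
    (hq : ∀ j, y j ≠ q) (z : ℝ) :
    (optimalMechanism hN hψ hdiff).winProb (Function.update y i q) (Function.update y i z) i =
      if topRival i y < q then (if D.rivalPrice i y < z then 1 else 0)
      else if D.WinsAsSecond i q y then 1 else (if topRival i y < z then 1 else 0) := by
  have key := optimalMechanism_mix hN hψ hdiff h hq 1 (if y a < z then 1 else 0)
    (fun k => if kthHighest ((Finset.univ.erase k).erase i) y 1 < z then 1 else 0)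
    (fun k _ hka => by rw [h.kthHighest_erase_of_ne hka])
  rw [← h.topRival_eq, h.kthHighest_erase_a, ← h.secondRival_eq] at key
  dsimp only at key
  rw [mul_one] at key
  simp only [DirectMechanism.winProb, kthHighest_erase_update, Function.update_self]
  refine key.trans ?_
  unfold rivalPrice
  split_ifs <;> rfl

omit hN hψ hdiff in
open scoped Classical in
theorem optimalPayment_update {i : Fin N} {y : Fin N → ℝ} {q : ℝ} (hq : q ∈ Set.Icc D.lo D.hi) :
    D.optimalPayment (Function.update y i q) i =
      if topRival i y < q then D.bid N q - D.rivalPrice i y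
      else if D.WinsAsSecond i q y then D.bid N q else 0 := by
  simp only [optimalPayment, topRival_update, Function.update_self, winsAsSecond_update,
    rivalPrice_update, clampedBid_eq hq]

-- The rebate depends on reports only and is granted even if the true type `z` loses the second
-- auction, hence the maximum with the rival's price. Deviations are therefore at least as
-- attractive here as in the auction.
open scoped Classical in
theorem optimalMechanism_payoff {i a b : Fin N} {y : Fin N → ℝ} (h : TopRivals i y a b) {q : ℝ}
    (hqm : q ∈ Set.Icc D.lo D.hi) (hq : ∀ j, y j ≠ q) (z : ℝ) :
    (optimalMechanism hN hψ hdiff).payoff (Function.update y i q) (Function.update y i z) i =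
      if topRival i y < q then max z (D.rivalPrice i y) - D.bid N q
      else if D.WinsAsSecond i q y then z - D.bid N q else max (z - topRival i y) 0 := by
  rw [DirectMechanism.payoff_eq, optimalMechanism_gross hN hψ hdiff h hq]
  change _ - D.optimalPayment _ i = _
  rw [optimalPayment_update hqm]
  split_ifs
  · rcases le_total z (D.rivalPrice i y) with hz | hz
    · rw [max_eq_right (by linarith), max_eq_right hz]; ring
    · rw [max_eq_left (by linarith), max_eq_left hz]; ring
  · rfl
  · simp

/-- A truthful highest type beats the remaining rivals in the second auction, and the rebate cancels
the price. So x - β(x) is earned exactly when the bid is paid, and 0 otherwise, which gives the left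
side of `payProb_mul_sub_bid`. -/
theorem optimalMechanism_interimPayoff_self (i : Fin N) {x : ℝ} (hx : x ∈ Set.Icc D.lo D.hi) :
    (optimalMechanism hN hψ hdiff).interimPayoff i x x = ∫ s in D.lo..x, D.payProb N s := by
  classical
  rw [← D.payProb_mul_sub_bid hN hψ hdiff hx, ← integral_paysBid hN i x, ← integral_mul_const]
  refine integral_congr_ae ?_
  filter_upwards [ae_generic N x] with y hy
  obtain ⟨hinj, -, hne⟩ := hy
  obtain ⟨a, b, h⟩ := exists_topRivals hN hinj i
  rw [optimalMechanism_payoff hN hψ hdiff h hx hne, PaysBid]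
  have hR := rivalPrice_le (D := D) h
  by_cases h1 : topRival i y < x
  · rw [if_pos h1, if_pos (Or.inl h1), max_eq_left (by linarith), one_mul]
  by_cases h2 : D.WinsAsSecond i x y
  · rw [if_neg h1, if_pos h2, if_pos (Or.inr h2), one_mul]
  · rw [if_neg h1, if_neg h2, if_neg (not_or.mpr ⟨h1, h2⟩), zero_mul]
    exact max_eq_right (by linarith)

/-- After this report the first unit never goes to `i` or to the top rival, so `i` meets the same
highest competitor as under withholding. This reduces individual rationality to incentive
compatibility. -/
theorem optimalMechanism_interimPayoff_lo (i : Fin N) {x : ℝ} :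
    (optimalMechanism hN hψ hdiff).interimPayoff i D.lo x = D.outsideOption i x := by
  classical
  refine integral_congr_ae ?_
  filter_upwards [ae_generic N D.lo] with y hy
  obtain ⟨hinj, hmem, hne⟩ := hy
  obtain ⟨a, b, h⟩ := exists_topRivals hN hinj i
  rw [optimalMechanism_payoff hN hψ hdiff h lo_le_hi_mem hne, if_neg, if_neg,
    secondAuctionSurplus_update]
  · rfl
  · intro h'
    have := h'.2.1
    rw [h.secondRival_eq] at this
    linarith [(hmem b).1]
  · rw [h.topRival_eq]
    linarith [(hmem a).1]

omit hN hdiff in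
theorem WinsAsSecond.le_payThreshold {i : Fin N} {q z : ℝ} {y : Fin N → ℝ}
    (h : D.WinsAsSecond i q y) (hlo : D.lo < q) (hqz : q ≤ z) (hz : z ≤ D.hi) :
    secondRival i y ≤ D.payThreshold z :=
  (le_min h.2.1.le h.2.2).trans (D.payThreshold_monotoneOn hψ ⟨hlo, hqz.trans hz⟩
    ⟨hlo.trans_le hqz, hz⟩ hqz)

/-- Suppose type `z` would not pay if truthful. Then the top rival is at least `z`, so the second
auction is lost after the lower report `q`; and if `q` won as second, so would `z`, since
`payThreshold` is monotone. -/
theorem optimalMechanism_interimWin_le (i : Fin N) {q z : ℝ} (hq : q ∈ Set.Icc D.lo D.hi)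
    (hz : z ∈ Set.Icc D.lo D.hi) (hqz : q ≤ z) :
    (optimalMechanism hN hψ hdiff).interimWin i q z ≤ D.payProb N z := by
  classical
  rw [← integral_paysBid hN i z]
  refine integral_mono_ae ((optimalMechanism hN hψ hdiff).integrable_winProb_update hN i hq z)
    (Integrable.of_mem_Icc 0 1 (Measurable.ite (measurableSet_paysBid hN i measurable_const)
      measurable_const measurable_const).aemeasurable
      (ae_of_all _ fun y => by split_ifs <;> simp)) ?_
  filter_upwards [ae_generic N q, ae_generic N z] with y hy hy'
  obtain ⟨hinj, hmem, hne⟩ := hy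
  obtain ⟨a, b, h⟩ := exists_topRivals hN hinj i
  simp only [optimalMechanism_winProb hN hψ hdiff h hne]
  have hone : (if topRival i y < q then (if D.rivalPrice i y < z then (1 : ℝ) else 0)
      else if D.WinsAsSecond i q y then 1 else (if topRival i y < z then 1 else 0)) ≤ 1 := by
    split_ifs <;> norm_num
  by_cases hp : D.PaysBid i z y
  · rwa [if_pos hp]
  rw [if_neg hp]
  have h1 : ¬ topRival i y < z := fun h' => hp (Or.inl h')
  have h2 : ¬ D.WinsAsSecond i q y := by
    intro hw
    have hlo : D.lo < q := lt_trans (by rw [h.secondRival_eq]; exact (hmem b).1) hw.2.1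
    have hle := le_min_iff.mp (hw.le_payThreshold hψ hlo hqz hz.2)
    refine hp (Or.inr ⟨lt_of_le_of_ne (not_lt.mp h1) ?_, hw.2.1.trans_le hqz, hle.2⟩)
    rw [h.topRival_eq]
    exact (hy'.2.2 a).symm
  rw [if_neg fun h' => h1 (h'.trans_le hqz), if_neg h2, if_neg h1]

/-- Suppose type `z` would pay if truthful. If `z` is highest, so is the report `q`, and the second
auction is won. If `z` wins as second, then either `q` still does, or `q` overtakes the top rival.
-/
theorem optimalMechanism_le_interimWin (i : Fin N) {q z : ℝ} (hq : q ∈ Set.Icc D.lo D.hi)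
    (hzq : z ≤ q) :
    D.payProb N z ≤ (optimalMechanism hN hψ hdiff).interimWin i q z := by
  classical
  rw [← integral_paysBid hN i z]
  refine integral_mono_ae
    (Integrable.of_mem_Icc 0 1 (Measurable.ite (measurableSet_paysBid hN i measurable_const)
      measurable_const measurable_const).aemeasurable
      (ae_of_all _ fun y => by split_ifs <;> simp))
    ((optimalMechanism hN hψ hdiff).integrable_winProb_update hN i hq z) ?_
  filter_upwards [ae_generic N q] with y hy
  obtain ⟨hinj, hmem, hne⟩ := hy
  obtain ⟨a, b, h⟩ := exists_topRivals hN hinj i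
  simp only [optimalMechanism_winProb hN hψ hdiff h hne]
  by_cases hp : D.PaysBid i z y
  swap
  · rw [if_neg hp]
    split_ifs <;> norm_num
  rw [if_pos hp]
  rcases hp with hp | hp
  · rw [if_pos (hp.trans_le hzq), if_pos ((rivalPrice_le h).trans_lt hp)]
  have hlo : D.lo < z := lt_trans (by rw [h.secondRival_eq]; exact (hmem b).1) hp.2.1
  by_cases hY : topRival i y < q
  -- The overtaken top rival is a higher type than `z`, so by monotonicity of `payThreshold` he gets
  -- the first unit. This leaves the second rival, who is below `z`, as the competitor in the second
  -- auction.
  · have hle := le_min_iff.mp (hp.le_payThreshold hψ hlo hp.1.le (hY.le.trans hq.2))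
    rw [if_pos hY, rivalPrice, if_pos hle.2, if_pos hp.2.1]
  · have hle := le_min_iff.mp (hp.le_payThreshold hψ hlo hzq hq.2)
    rw [if_neg hY, if_pos]
    refine ⟨lt_of_le_of_ne (not_lt.mp hY) ?_, hp.2.1.trans_le hzq, hle.2⟩
    rw [h.topRival_eq]
    exact (hne a).symm

/-- As functions of the true type, the payoff from reporting `q` and the truthful payoff agree at
`q`. The first has slope `interimWin` and the second `payProb`, and the two comparisons above order
these slopes in favour of truth on either side of `q`. -/
theorem optimalMechanism_incentiveCompatible :
    (optimalMechanism hN hψ hdiff).IncentiveCompatible := by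
  intro i x hx q hq
  set M := optimalMechanism hN hψ hdiff with hM
  have hqq : M.interimPayoff i q q = ∫ s in D.lo..q, D.payProb N s :=
    optimalMechanism_interimPayoff_self hN hψ hdiff i hq
  have hxx : M.interimPayoff i x x = ∫ s in D.lo..x, D.payProb N s :=
    optimalMechanism_interimPayoff_self hN hψ hdiff i hx
  have hc := D.continuousOn_payProb hN
  have hint : ∀ u ∈ Set.Icc D.lo D.hi, ∀ v ∈ Set.Icc D.lo D.hi, u ≤ v →
      IntervalIntegrable (D.payProb N) volume u v := fun u hu v hv huv =>
    (hc.mono (Set.Icc_subset_Icc hu.1 hv.2)).intervalIntegrable_of_Icc huv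
  have hdq := M.interimPayoff_eq hN i hq hq
  have hdx := M.interimPayoff_eq hN i hq hx
  have hsub : ∀ u v, D.lo ≤ u → v ≤ D.hi → ∀ x ∈ Set.Icc u v, ∀ z ∈ Set.Icc u v,
      M.interimGross i q x + (z - x) * M.interimWin i q x ≤ M.interimGross i q z :=
    fun u v hu hv x hx z hz => M.interimGross_subgradient hN i hq
      ⟨hu.trans hx.1, hx.2.trans hv⟩ ⟨hu.trans hz.1, hz.2.trans hv⟩
  have hwint : ∀ u v, D.lo ≤ u → v ≤ D.hi → u ≤ v →
      IntervalIntegrable (fun z => M.interimWin i q z) volume u v := fun u v hu hv huv => by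
    have := monotoneOn_of_subgradient (hsub u v hu hv)
    rw [← Set.uIcc_of_le huv] at this
    exact this.intervalIntegrable
  rcases le_total q x with hqx | hqx
  · have h1 := integral_eq_sub_of_subgradient hqx (hsub q x hq.1 hx.2)
    have h2 := intervalIntegral.integral_mono_on hqx (hwint q x hq.1 hx.2 hqx)
      (hint q hq x hx hqx) fun z hz => optimalMechanism_interimWin_le hN hψ hdiff i hq
        ⟨hq.1.trans hz.1, hz.2.trans hx.2⟩ hz.1
    have h3 := intervalIntegral.integral_add_adjacent_intervals
      (hint _ lo_le_hi_mem q hq hq.1) (hint q hq x hx hqx)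
    linarith
  · have h1 := integral_eq_sub_of_subgradient hqx (hsub x q hx.1 hq.2)
    have h2 := intervalIntegral.integral_mono_on hqx (hint x hx q hq hqx)
      (hwint x q hx.1 hq.2 hqx) fun z hz =>
        optimalMechanism_le_interimWin hN hψ hdiff i hq hz.2
    have h3 := intervalIntegral.integral_add_adjacent_intervals
      (hint _ lo_le_hi_mem x hx hx.1) (hint x hx q hq hqx)
    linarith

theorem optimalMechanism_individuallyRational :
    (optimalMechanism hN hψ hdiff).IndividuallyRational := fun i x hx => by
  rw [← optimalMechanism_interimPayoff_lo hN hψ hdiff]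
  exact optimalMechanism_incentiveCompatible hN hψ hdiff i x hx D.lo lo_le_hi_mem

theorem optimalMechanism_revenue : (optimalMechanism hN hψ hdiff).revenue =
    ∫ x : Fin N → ℝ, max (D.virtualSurplus x) 0 ∂D.jointLaw N := by
  classical
  refine DirectMechanism.revenue_eq_of_optimal _ hN hψ
    (optimalMechanism_incentiveCompatible hN hψ hdiff) (fun i => ?_) ?_
  · rw [optimalMechanism_interimPayoff_self hN hψ hdiff i lo_le_hi_mem,
      intervalIntegral.integral_same]
  filter_upwards [D.ae_injective_joint] with x hinj k
  have hiff : D.WinsAsSecond k (x k) x ↔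
      x k = kthHighest Finset.univ x 2 ∧ 0 ≤ D.virtualSurplus x := by
    obtain ⟨a, -, b, -, hab, hlt, h⟩ := exists_top_two (s := Finset.univ) (v := x)
      (by rw [Finset.card_univ, Fintype.card_fin]; omega) hinj.injOn
    obtain ⟨c, hc, hcmax⟩ := Finset.exists_max_image _ x
      (Finset.card_pos.mp (DirectMechanism.one_le_card_erase_erase hN a b))
    have hcb := Finset.ne_of_mem_erase hc
    have hca := Finset.ne_of_mem_erase (Finset.mem_of_mem_erase hc)
    have hltc : x c < x b := h c (Finset.mem_univ _) hca hcb
    have hmaxc : ∀ j, j ≠ a → j ≠ b → x j ≤ x c := fun j h1 h2 => hcmax j (by simp [h1, h2])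
    have hmaxb : ∀ j, j ≠ a → x j ≤ x b := fun j h1 => by
      rcases eq_or_ne j b with rfl | h2
      · rfl
      · exact (hmaxc j h1 h2).trans hltc.le
    have k2 : kthHighest Finset.univ x 2 = x b :=
      kthHighest_two_eq (Finset.mem_univ a) (Finset.mem_univ b) hab hlt.le fun j _ => hmaxb j
    have k3 : kthHighest Finset.univ x 3 = x c :=
      kthHighest_three_eq (Finset.mem_univ a) (Finset.mem_univ b) (Finset.mem_univ c) hab hca.symm
        hcb.symm hlt.le hltc.le fun j _ => hmaxc j
    unfold virtualSurplus
    rw [k2, k3]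
    rcases eq_or_ne k b with rfl | hkb
    · have hr : TopRivals k x a c := ⟨hab, hcb, hca.symm, hltc.trans hlt,
        fun j hj hja hjc => lt_of_le_of_ne (hmaxc j hja hj) fun he => hjc (hinj he)⟩
      rw [WinsAsSecond, hr.topRival_eq, hr.secondRival_eq]
      constructor
      · rintro ⟨-, -, h⟩; exact ⟨rfl, by linarith⟩
      · rintro ⟨-, h⟩; exact ⟨hlt, hltc, by linarith⟩
    · refine iff_of_false ?_ fun h' => hkb (hinj h'.1)
      rcases eq_or_ne k a with rfl | hka
      · refine not_winsAsSecond_of_top hN fun j hj => (hmaxb j hj).trans hlt.le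
      · exact not_winsAsSecond_of_two hN hka.symm hkb.symm hab ((hmaxb k hka).trans hlt.le)
          (hmaxb k hka)
  change (if D.WinsAsSecond k (x k) x then (1 : ℝ) else 0) = _
  by_cases hw : D.WinsAsSecond k (x k) x
  · rw [if_pos hw, if_pos (hiff.mp hw)]
  · rw [if_neg hw, if_neg (mt hiff.mpr hw)]

end OptimalMechanism

end ValueDistribution

/-! ### Ranks with tie-breaking, and equally ordered families. -/

section IsKthHighest

variable {N : ℕ} {σ : Equiv.Perm (Fin N)} {s : Finset (Fin N)} {v : Fin N → ℝ}

/-- Strict inequalities leave the priority order nothing to decide; this is how it drops out of the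
analysis. -/
theorem isKthHighest_one_iff {a j : Fin N} (ha : a ∈ s) (h : ∀ l ∈ s, l ≠ a → v l < v a) :
    IsKthHighest σ s v 1 j ↔ j = a := by
  constructor
  · rintro ⟨hj, hc⟩
    by_contra hja
    have : a ∈ s.filter (fun l => v j < v l ∨ (v j = v l ∧ σ l < σ j)) :=
      Finset.mem_filter.mpr ⟨ha, Or.inl (h j hj hja)⟩
    have := Finset.card_pos.mpr ⟨a, this⟩
    omega
  · rintro rfl
    refine ⟨ha, ?_⟩
    rw [Finset.filter_false_of_mem, Finset.card_empty]
    intro l hl hor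
    rcases eq_or_ne l j with rfl | hlj
    · simp at hor
    · have := h l hl hlj
      rcases hor with h' | h'
      · linarith
      · linarith [h'.1]

theorem isKthHighest_two_iff {a b j : Fin N} (ha : a ∈ s) (hb : b ∈ s) (hlt : v b < v a)
    (h : ∀ l ∈ s, l ≠ a → l ≠ b → v l < v b) : IsKthHighest σ s v 2 j ↔ j = b := by
  have hab : a ≠ b := by rintro rfl; exact lt_irrefl _ hlt
  constructor
  · rintro ⟨hj, hc⟩
    have hc' : (s.filter (fun l => v j < v l ∨ (v j = v l ∧ σ l < σ j))).card = 1 := by omega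
    by_contra hjb
    rcases eq_or_ne j a with rfl | hja
    · rw [Finset.filter_false_of_mem, Finset.card_empty] at hc'
      · omega
      intro l hl hor
      rcases eq_or_ne l j with rfl | hlj
      · simp at hor
      have : v l < v j := by
        rcases eq_or_ne l b with rfl | hlb
        · exact hlt
        · exact (h l hl hlj hlb).trans hlt
      rcases hor with h' | h'
      · linarith
      · linarith [h'.1]
    · have hj' := h j hj hja hjb
      have hsub : {a, b} ⊆ s.filter (fun l => v j < v l ∨ (v j = v l ∧ σ l < σ j)) := by
        intro l hl
        simp only [Finset.mem_insert, Finset.mem_singleton] at hl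
        rcases hl with rfl | rfl
        · exact Finset.mem_filter.mpr ⟨ha, Or.inl (hj'.trans hlt)⟩
        · exact Finset.mem_filter.mpr ⟨hb, Or.inl hj'⟩
      have := Finset.card_le_card hsub
      rw [Finset.card_pair hab] at this
      omega
  · rintro rfl
    refine ⟨hb, ?_⟩
    have : s.filter (fun l => v j < v l ∨ (v j = v l ∧ σ l < σ j)) = {a} := by
      ext l
      simp only [Finset.mem_filter, Finset.mem_singleton]
      constructor
      · rintro ⟨hl, hor⟩
        by_contra hla
        rcases eq_or_ne l j with rfl | hlj
        · simp at hor
        have := h l hl hla hlj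
        rcases hor with h' | h'
        · linarith
        · linarith [h'.1]
      · rintro rfl
        exact ⟨ha, Or.inl hlt⟩
    rw [this, Finset.card_singleton]

/-- Order statistics of equally ordered families are attained at the same index. -/
theorem exists_kthHighest_of_le_iff_le {ι : Type*} {s : Finset ι} {v w : ι → ℝ} {k : ℕ}
    (hk : 1 ≤ k) (hks : k ≤ s.card) (h : ∀ j l, v j ≤ v l ↔ w j ≤ w l) :
    ∃ j ∈ s, kthHighest s v k = v j ∧ kthHighest s w k = w j := by
  obtain ⟨j, hj, hvj, -⟩ := exists_kthHighest (v := v) hk hks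
  obtain ⟨l, hl, hwl, -⟩ := exists_kthHighest (v := w) hk hks
  refine ⟨j, hj, hvj, le_antisymm ?_ ?_⟩
  · rw [hwl, ← h, ← hvj, le_kthHighest_iff hk hks]
    simp only [h]
    rw [← le_kthHighest_iff hk hks, hwl]
  · rw [le_kthHighest_iff hk hks]
    simp only [← h]
    rw [← le_kthHighest_iff hk hks, hvj]

end IsKthHighest

/-! ### The auction itself: inferred types, outcomes, equilibrium. -/

namespace ValueDistribution

variable {D : ValueDistribution} {N : ℕ} {β : ℝ → ℝ}

section InferredType

variable (hβ : StrictMonoOn β (Set.Icc D.lo D.hi)) {b : ℝ}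

theorem inferredType_mem (b : ℝ) : D.inferredType β b ∈ Set.Icc D.lo D.hi := by
  refine ⟨le_max_left _ _, max_le D.lo_lt_hi.le ?_⟩
  -- For bids below every β(x) the supremum of the empty set is 0, so the bound must be nonnegative.
  exact Real.sSup_le (fun x hx => hx.1.2) (D.lo_nonneg.trans D.lo_lt_hi.le)

/-- With `lt_of_lt_inferredType`, this says that a bid stands to the rivals' bids as its inferred
type stands to their types, even when the bid is outside the range of β. -/
theorem lt_of_inferredType_lt {y : ℝ} (hy : y ∈ Set.Icc D.lo D.hi)
    (h : D.inferredType β b < y) : b < β y := by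
  by_contra! hle
  have : y ≤ sSup {x : ℝ | x ∈ Set.Icc D.lo D.hi ∧ β x ≤ b} :=
    le_csSup ⟨D.hi, fun x hx => hx.1.2⟩ ⟨hy, hle⟩
  exact absurd (this.trans (le_max_right _ _)) (not_le.mpr h)

include hβ

theorem lt_of_lt_inferredType {y : ℝ} (hy : y ∈ Set.Icc D.lo D.hi)
    (h : y < D.inferredType β b) : β y < b := by
  have h1 : y < sSup {x : ℝ | x ∈ Set.Icc D.lo D.hi ∧ β x ≤ b} :=
    (lt_max_iff.mp h).resolve_left (not_lt.mpr hy.1)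
  have hne : {x : ℝ | x ∈ Set.Icc D.lo D.hi ∧ β x ≤ b}.Nonempty := by
    by_contra hne
    rw [Set.not_nonempty_iff_eq_empty.mp hne, Real.sSup_empty] at h1
    linarith [hy.1, D.lo_nonneg]
  obtain ⟨z, hz, hyz⟩ := exists_lt_of_lt_csSup hne h1
  exact (hβ hy hz.1 hyz).trans_le hz.2

theorem inferredType_apply {y : ℝ} (hy : y ∈ Set.Icc D.lo D.hi) :
    D.inferredType β (β y) = y := by
  rcases lt_trichotomy (D.inferredType β (β y)) y with h | h | h
  · exact absurd (lt_of_inferredType_lt hy h) (lt_irrefl _)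
  · exact h
  · exact absurd (lt_of_lt_inferredType hβ hy h) (lt_irrefl _)

end InferredType

section Auction

variable (hβ : StrictMonoOn β (Set.Icc D.lo D.hi))

/-- In the second auction, bidder `i` of type `x` faces the highest rival `r`. -/
theorem second_auction_rebate {σ : Equiv.Perm (Fin N)} {s : Finset (Fin N)} {y : Fin N → ℝ}
    {i r : Fin N} {x : ℝ} (hinj : Function.Injective y) (hi : i ∈ s) (hr : r ∈ s) (hri : r ≠ i)
    (hx : ∀ j ≠ i, y j ≠ x) (hmax : ∀ j ∈ s, j ≠ i → y j ≤ y r) :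
    (IsKthHighest σ s (Function.update y i x) 1 i ↔ y r < x) ∧
      (y r < x → kthHighest s (Function.update y i x) 2 = y r) := by
  set x' := Function.update y i x with hx'
  have hxi : x' i = x := by simp [hx']
  have hxj : ∀ j, j ≠ i → x' j = y j := fun j hj => by simp [hx', hj]
  refine ⟨?_, fun hlt => ?_⟩
  · rcases lt_or_gt_of_ne (hx r hri) with hlt | hlt
    · refine iff_of_true ((isKthHighest_one_iff hi fun l hl hli => ?_).mpr rfl) hlt
      rw [hxi, hxj l hli]
      exact (hmax l hl hli).trans_lt hlt
    · refine iff_of_false (fun h => hri ?_) hlt.not_gt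
      refine ((isKthHighest_one_iff hr fun l hl hlr => ?_).mp h).symm
      rw [hxj r hri]
      rcases eq_or_ne l i with rfl | hli
      · rwa [hxi]
      · rw [hxj l hli]
        exact lt_of_le_of_ne (hmax l hl hli) fun he => hlr (hinj he)
  · rw [← hxj r hri]
    refine kthHighest_two_eq hi hr hri.symm (by rw [hxi, hxj r hri]; exact hlt.le) fun j hj hji => ?_
    rw [hxj j hji, hxj r hri]
    exact hmax j hj hji

include hβ

-- Without ties among inferred types, bids and inferred types are ordered alike, so all that the
-- rule reads off the bids can be read off types. What remains is to place `q` relative to the two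
-- top rivals.
open scoped Classical in
theorem auction_outcome (hN : 3 ≤ N) (σ : Equiv.Perm (Fin N)) {i a c : Fin N} {y : Fin N → ℝ}
    (h : TopRivals i y a c) (hinj : Function.Injective y) (hmem : ∀ j, y j ∈ Set.Icc D.lo D.hi)
    {b q x : ℝ} (hqb : D.inferredType β b = q) (hq : ∀ j ≠ i, y j ≠ q) (hx : ∀ j ≠ i, y j ≠ x) :
    D.netPayment σ β (Function.update (fun j => β (y j)) i b) (Function.update y i x) i =
      (if topRival i y < q then b - (if D.rivalPrice i y < x then D.rivalPrice i y else 0)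
      else if D.WinsAsSecond i q y then b else 0) ∧
    D.auctionPayoff σ β (Function.update (fun j => β (y j)) i b) (Function.update y i x) i =
      (if topRival i y < q then (if D.rivalPrice i y < x then x else 0) - b
      else if D.WinsAsSecond i q y then x - b else max (x - topRival i y) 0) := by
  set v := Function.update (fun j => β (y j)) i b with hv
  set τ := Function.update y i q with hτ
  have hvi : v i = b := by simp [hv]
  have hvj : ∀ j, j ≠ i → v j = β (y j) := fun j hj => by simp [hv, hj]
  have hτi : τ i = q := by simp [hτ]
  have hτj : ∀ j, j ≠ i → τ j = y j := fun j hj => by simp [hτ, hj]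
  have hlt : ∀ j l, τ j < τ l → v j < v l := by
    intro j l hjl
    by_cases hj : j = i <;> by_cases hl : l = i
    · rw [hj, hl] at hjl; exact absurd hjl (lt_irrefl _)
    · rw [hj, hvi, hvj l hl]
      rw [hj, hτi, hτj l hl] at hjl
      exact lt_of_inferredType_lt (hmem l) (hqb ▸ hjl)
    · rw [hl, hvi, hvj j hj]
      rw [hl, hτi, hτj j hj] at hjl
      exact lt_of_lt_inferredType hβ (hmem j) (hqb ▸ hjl)
    · rw [hvj j hj, hvj l hl]
      rw [hτj j hj, hτj l hl] at hjl
      exact hβ (hmem j) (hmem l) hjl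
  have hτinj : Function.Injective τ := by
    intro j l hjl
    by_cases hj : j = i <;> by_cases hl : l = i
    · rw [hj, hl]
    · rw [hj, hτi, hτj l hl] at hjl; exact absurd hjl.symm (hq l hl)
    · rw [hl, hτi, hτj j hj] at hjl; exact absurd hjl (hq j hj)
    · rw [hτj j hj, hτj l hl] at hjl; exact hinj hjl
  have hle : ∀ j l, v j ≤ v l ↔ τ j ≤ τ l := by
    intro j l
    constructor
    · intro hjl
      by_contra! hlj
      exact absurd (hlt l j hlj) (not_lt.mpr hjl)
    · intro hjl
      rcases hjl.eq_or_lt with he | hl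
      · rw [hτinj he]
      · exact (hlt j l hl).le
  have hinf : ∀ j, D.inferredType β (v j) = τ j := by
    intro j
    rcases eq_or_ne j i with rfl | hj
    · rw [hvi, hτi, hqb]
    · rw [hvj j hj, hτj j hj, inferredType_apply hβ (hmem j)]
  have hkth : ∀ k, 1 ≤ k → k ≤ 3 →
      D.inferredType β (kthHighest Finset.univ v k) = kthHighest Finset.univ τ k := by
    intro k hk hk3
    obtain ⟨j, -, h1, h2⟩ := exists_kthHighest_of_le_iff_le (s := Finset.univ) hk
      (by rw [Finset.card_univ, Fintype.card_fin]; omega) hle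
    rw [h1, h2, hinf]
  have halloc : D.Allocated β v ↔ kthHighest Finset.univ τ 3 ≤
      kthHighest Finset.univ τ 2 + D.psi (kthHighest Finset.univ τ 2) := by
    unfold Allocated
    rw [hkth 2 (by norm_num) (by norm_num), hkth 3 (by norm_num) (by norm_num)]
    constructor <;> intro h <;> linarith
  have hrem : ∀ k, (∀ j, IsKthHighest σ Finset.univ v 2 j ↔ j = k) → D.remaining σ β v =
      if D.Allocated β v then Finset.univ.erase k else Finset.univ := by
    intro k hk
    ext j
    simp only [remaining, GetsFirst, hk, Finset.mem_filter, Finset.mem_univ, true_and]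
    split_ifs with hA <;> simp [hA]
  have hsas : ∀ s : Finset (Fin N), secondAuctionSurplus s (Function.update y i x) i =
      max (x - kthHighest (s.erase i) y 1) 0 := fun s => secondAuctionSurplus_update s y i x
  have mu : ∀ j : Fin N, j ∈ (Finset.univ : Finset (Fin N)) := Finset.mem_univ
  have hτa : τ a = y a := hτj a h.ne_a
  have hτc : τ c = y c := hτj c h.ne_b
  unfold auctionPayoff netPayment secondPrice GetsFirst
  unfold WinsAsSecond rivalPrice
  rw [h.topRival_eq, h.secondRival_eq]
  rcases lt_or_gt_of_ne (hq a h.ne_a) with hqa | hqa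
  · -- `i` is the highest bidder and `a` the second-highest
    have hai : ∀ l, l ≠ i → τ l < τ i := fun l hl => by
      rw [hτi, hτj l hl]; exact (h.le_a hl).trans_lt hqa
    have hla : ∀ l, l ≠ i → l ≠ a → τ l < τ a := fun l hl hla => by
      rw [hτa, hτj l hl]; exact (h.le_b hl hla).trans_lt h.lt
    have hlc : ∀ l, l ≠ i → l ≠ a → τ l ≤ τ c := fun l hl hla => by
      rw [hτc, hτj l hl]; exact h.le_b hl hla
    have h1 : ∀ j, IsKthHighest σ Finset.univ v 1 j ↔ j = i := fun j =>
      isKthHighest_one_iff (mu i) fun l _ hl => hlt l i (hai l hl)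
    have h2 : ∀ j, IsKthHighest σ Finset.univ v 2 j ↔ j = a := fun j =>
      isKthHighest_two_iff (mu i) (mu a) (hlt _ _ (hai a h.ne_a)) fun l _ hl hl' =>
        hlt l a (hla l hl hl')
    have k2 : kthHighest Finset.univ τ 2 = y a := hτa ▸ kthHighest_two_eq (mu i) (mu a) h.ne_a.symm
      (hai a h.ne_a).le fun l _ hl => by
        rcases eq_or_ne l a with rfl | hl'
        · rfl
        · exact (hla l hl hl').le
    have k3 : kthHighest Finset.univ τ 3 = y c := hτc ▸ kthHighest_three_eq (mu i) (mu a) (mu c)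
      h.ne_a.symm h.ne_b.symm h.ne (hai a h.ne_a).le (hla c h.ne_b h.ne.symm).le
      fun l _ hl hl' => hlc l hl hl'
    rw [k2, k3] at halloc
    have hGF : ¬ (D.Allocated β v ∧ IsKthHighest σ Finset.univ v 2 i) := fun h' =>
      h.ne_a ((h2 i).mp h'.2).symm
    have h1i := (h1 i).mpr rfl
    rw [if_pos hqa, if_pos hqa, if_pos (Or.inl h1i), if_neg hGF, hrem a h2, hsas, hvi]
    by_cases hA : D.Allocated β v
    · obtain ⟨hr1, hr2⟩ := second_auction_rebate (σ := σ) (s := Finset.univ.erase a) hinj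
        (by simp [h.ne_a.symm]) (by simp [h.ne.symm] : c ∈ Finset.univ.erase a) h.ne_b hx
        fun j hj hji => h.le_b hji (Finset.ne_of_mem_erase hj)
      simp only [if_pos hA, if_pos (halloc.mp hA), h1i, true_and, hr1, h.kthHighest_erase_a]
      by_cases hR : y c < x
      · simp only [if_pos hR, hr2 hR]
        refine ⟨trivial, ?_⟩
        rw [max_eq_left (by linarith)]; ring
      · simp only [if_neg hR]
        refine ⟨trivial, ?_⟩
        rw [max_eq_right (by linarith)]; ring
    · obtain ⟨hr1, hr2⟩ := second_auction_rebate (σ := σ) (s := Finset.univ) hinj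
        (mu i) (mu a) h.ne_a hx fun j hj hji => h.le_a hji
      have hYa : kthHighest (Finset.univ.erase i) y 1 = y a := h.topRival_eq
      simp only [if_neg hA, if_neg (mt halloc.mpr hA), h1i, true_and, hr1, hYa]
      by_cases hR : y a < x
      · simp only [if_pos hR, hr2 hR]
        refine ⟨trivial, ?_⟩
        rw [max_eq_left (by linarith)]; ring
      · simp only [if_neg hR]
        refine ⟨trivial, ?_⟩
        rw [max_eq_right (by linarith)]; ring
  -- `a` is the highest bidder
  have hia : ∀ l, l ≠ a → τ l < τ a := fun l hl => by
    rcases eq_or_ne l i with rfl | hl'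
    · rw [hτi, hτa]; exact hqa
    · rw [hτa, hτj l hl']
      exact (h.le_b hl' hl).trans_lt h.lt
  have h1 : ∀ j, IsKthHighest σ Finset.univ v 1 j ↔ j = a := fun j =>
    isKthHighest_one_iff (mu a) fun l _ hl => hlt l a (hia l hl)
  have h1i : ¬ IsKthHighest σ Finset.univ v 1 i := fun h' => h.ne_a ((h1 i).mp h').symm
  rw [if_neg hqa.not_gt, if_neg hqa.not_gt]
  simp only [h1i, false_or, false_and, if_false, sub_zero, hvi]
  have hYa : kthHighest (Finset.univ.erase i) y 1 = y a := h.topRival_eq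
  rcases lt_or_gt_of_ne (hq c h.ne_b) with hqc | hqc
  · -- `i` is the second-highest bidder
    have hli : ∀ l, l ≠ a → l ≠ i → τ l < τ i := fun l hl hl' => by
      rw [hτi, hτj l hl']; exact (h.le_b hl' hl).trans_lt hqc
    have h2 : ∀ j, IsKthHighest σ Finset.univ v 2 j ↔ j = i := fun j =>
      isKthHighest_two_iff (mu a) (mu i) (hlt _ _ (hia i h.ne_a.symm)) fun l _ hl hl' =>
        hlt l i (hli l hl hl')
    have k2 : kthHighest Finset.univ τ 2 = q := hτi ▸ kthHighest_two_eq (mu a) (mu i) h.ne_a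
      (hia i h.ne_a.symm).le fun l _ hl => by
        rcases eq_or_ne l i with rfl | hl'
        · rfl
        · exact (hli l hl hl').le
    have k3 : kthHighest Finset.univ τ 3 = y c := hτc ▸ kthHighest_three_eq (mu a) (mu i) (mu c)
      h.ne_a h.ne h.ne_b.symm (hia i h.ne_a.symm).le (hli c h.ne.symm h.ne_b).le
      fun l _ hl hl' => by rw [hτc, hτj l hl']; exact h.le_b hl' hl
    rw [k2, k3] at halloc
    have h2i := (h2 i).mpr rfl
    simp only [h2i, and_true, hqa, hqc, true_and]
    by_cases hA : D.Allocated β v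
    · simp only [hA, halloc.mp hA, if_true, true_and, Function.update_self]
    · simp only [hA, mt halloc.mpr hA, if_false, true_and, sub_zero, hrem i h2, hsas, hYa]
  · -- `c` is the second-highest bidder
    have hlc : ∀ l, l ≠ a → l ≠ c → τ l < τ c := fun l hl hl' => by
      rcases eq_or_ne l i with rfl | hli
      · rw [hτi, hτc]; exact hqc
      · rw [hτc, hτj l hli]; exact h.others_lt l hli hl hl'
    have h2 : ∀ j, IsKthHighest σ Finset.univ v 2 j ↔ j = c := fun j =>
      isKthHighest_two_iff (mu a) (mu c) (hlt _ _ (hia c h.ne.symm)) fun l _ hl hl' =>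
        hlt l c (hlc l hl hl')
    have h2i : ¬ IsKthHighest σ Finset.univ v 2 i := fun h' => h.ne_b ((h2 i).mp h').symm
    simp only [h2i, and_false, if_false, hqc.not_gt, false_and, true_and, sub_zero, hrem c h2, hsas]
    have : kthHighest ((if D.Allocated β v then Finset.univ.erase c else Finset.univ).erase i) y 1 =
        y a := by
      split_ifs
      · exact h.kthHighest_erase_of_ne h.ne.symm
      · exact hYa
    rw [this]

end Auction

section Equilibrium

variable (hN : 3 ≤ N) (hψ : MonotoneOn D.psi (Set.Ioo D.lo D.hi))
  (hdiff : DifferentiableOn ℝ D.psi (Set.Ioo (D.a 0) D.psiInvZero)) (σ : Equiv.Perm (Fin N))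
include hN hψ hdiff

theorem auctionRevenue_ae_eq : D.auctionRevenue σ (D.bid N) =ᵐ[D.jointLaw N]
    fun x => ∑ i, (optimalMechanism hN hψ hdiff).t x i := by
  filter_upwards [D.ae_injective_joint, D.ae_mem_Icc_joint] with x hinj hmem
  refine Finset.sum_congr rfl fun i _ => ?_
  obtain ⟨a, c, h⟩ := exists_topRivals hN hinj i
  have hβ := D.bid_strictMonoOn hN hψ hdiff
  have hne : ∀ j ≠ i, x j ≠ x i := fun j hj he => hj (hinj he)
  have key := (auction_outcome hβ hN σ h hinj hmem (b := D.bid N (x i)) (x := x i)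
    (inferredType_apply hβ (hmem i)) hne hne).1
  rw [Function.update_eq_self i x, Function.update_eq_self i fun j => D.bid N (x j)] at key
  rw [key]
  change _ = D.optimalPayment x i
  unfold optimalPayment
  rw [clampedBid_eq (hmem i)]
  have hR := rivalPrice_le (D := D) h
  split_ifs with h1 h2
  · rfl
  -- A truthful highest type cannot miss the rebate: the price he faces is at most his top rival's
  -- type.
  · linarith
  · rfl
  · rfl

/-- Bidding `b` acts like reporting the inferred type `q`, except that `b` replaces β(q) and the
rebate is lost when the second auction is lost. Both changes can only hurt, and neither matters on
the equilibrium path, so optimality follows from `optimalMechanism_incentiveCompatible`. -/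
theorem isSymmetricEquilibrium_bid : D.IsSymmetricEquilibrium σ (D.bid N) := by
  classical
  intro i x hx
  have hβ := D.bid_strictMonoOn hN hψ hdiff
  set M := optimalMechanism hN hψ hdiff with hM
  have hout : ∀ b, D.deviationPayoff σ (D.bid N) i x b =ᵐ[D.jointLaw N] fun y =>
      if topRival i y < D.inferredType (D.bid N) b then
        (if D.rivalPrice i y < x then x else 0) - b
      else if D.WinsAsSecond i (D.inferredType (D.bid N) b) y then x - b
      else max (x - topRival i y) 0 := by
    intro b
    filter_upwards [ae_generic N (D.inferredType (D.bid N) b), D.ae_ne_joint x] with y hy hyx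
    obtain ⟨hinj, hmem, hne⟩ := hy
    obtain ⟨a, c, h⟩ := exists_topRivals hN hinj i
    exact (auction_outcome hβ hN σ h hinj (fun j => Set.Ioo_subset_Icc_self (hmem j)) rfl
      (fun j _ => hne j) fun j _ => hyx j).2
  have hint : ∀ b, Integrable (D.deviationPayoff σ (D.bid N) i x b) (D.jointLaw N) := by
    intro b
    refine Integrable.congr ?_ (hout b).symm
    have hT := measurable_topRival hN i
    refine Integrable.of_mem_Icc (-|b|) (D.hi + |b|) (Measurable.ite (measurableSet_lt hT
      measurable_const) ((Measurable.ite (measurableSet_lt (measurable_rivalPrice hN i)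
      measurable_const) measurable_const measurable_const).sub measurable_const)
      (Measurable.ite (measurableSet_winsAsSecond hN i measurable_const) measurable_const
        ((measurable_const.sub hT).max measurable_const))).aemeasurable ?_
    filter_upwards [D.ae_mem_Icc_joint] with y hy
    have h1 := topRival_mem (i := i) (A := Set.Icc D.lo D.hi) hN fun j _ => hy j
    have h2 := D.lo_nonneg
    have h3 := D.lo_lt_hi
    have h4 := le_abs_self b
    have h5 := neg_abs_le b
    have h6 : max (x - topRival i y) 0 ≤ D.hi := max_le (by linarith [h1.1, hx.2]) (by linarith)
    have h7 := le_max_right (x - topRival i y) 0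
    have h8 := abs_nonneg b
    split_ifs <;> constructor <;> linarith [hx.1, hx.2]
  have hintM : ∀ q ∈ Set.Icc D.lo D.hi, Integrable
      (fun y => M.payoff (Function.update y i q) (Function.update y i x) i) (D.jointLaw N) :=
    fun q hq => (M.integrable_gross_update hN i hq hx).sub (M.integrable_t_update i q hq)
  have hself : ∫ y, D.deviationPayoff σ (D.bid N) i x (D.bid N x) y ∂D.jointLaw N =
      M.interimPayoff i x x := by
    refine integral_congr_ae ?_
    filter_upwards [hout (D.bid N x), ae_generic N x] with y hy hgen
    obtain ⟨hinj, hmem, hne⟩ := hgen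
    obtain ⟨a, c, h⟩ := exists_topRivals hN hinj i
    rw [hy, hM, optimalMechanism_payoff hN hψ hdiff h hx hne, inferredType_apply hβ hx]
    have hR := rivalPrice_le (D := D) h
    by_cases h1 : topRival i y < x
    · rw [if_pos h1, if_pos h1, if_pos (by linarith), max_eq_left (by linarith)]
    · rw [if_neg h1, if_neg h1]
  refine ⟨hint, fun b => ?_, ?_⟩
  · set q := D.inferredType (D.bid N) b with hqdef
    have hq : q ∈ Set.Icc D.lo D.hi := inferredType_mem b
    rw [hself]
    refine le_trans ?_ (optimalMechanism_incentiveCompatible hN hψ hdiff i x hx q hq)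
    refine integral_mono_ae (hint b) (hintM q hq) ?_
    filter_upwards [hout b, ae_generic N q] with y hy hgen
    obtain ⟨hinj, hmem, hne⟩ := hgen
    obtain ⟨a, c, h⟩ := exists_topRivals hN hinj i
    rw [hy, optimalMechanism_payoff hN hψ hdiff h hq hne]
    -- Negative bids are also read as the lowest type and lie below its bid 0. The restriction on
    -- `q` costs nothing: whenever the bid is paid, some rival is below `q`.
    have hbid : D.lo < q → D.bid N q ≤ b := fun hlo =>
      D.bid_le_of_forall_lt hN hψ hdiff ⟨hlo, hq.2⟩ fun z hz =>
        (lt_of_lt_inferredType hβ ⟨hz.1.le, hz.2.le.trans hq.2⟩ hz.2).le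
    by_cases h1 : topRival i y < q
    · rw [if_pos h1, if_pos h1]
      have hb := hbid (lt_trans (by rw [h.topRival_eq]; exact (hmem a).1) h1)
      have hR := le_max_left x (D.rivalPrice i y)
      have hx0 := D.lo_nonneg.trans hx.1
      split_ifs <;> linarith
    · rw [if_neg h1, if_neg h1]
      by_cases h2 : D.WinsAsSecond i q y
      · rw [if_pos h2, if_pos h2]
        have hb := hbid (lt_trans (by rw [h.secondRival_eq]; exact (hmem c).1) h2.2.1)
        linarith
      · rw [if_neg h2, if_neg h2]
  · rw [hself]
    exact optimalMechanism_individuallyRational hN hψ hdiff i x hx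

end Equilibrium

end ValueDistribution

theorem theorem6 (D : ValueDistribution) (N : ℕ) (hN : 3 ≤ N)
    (hψ : MonotoneOn D.psi (Set.Ioo D.lo D.hi))
    (hdiff : DifferentiableOn ℝ D.psi (Set.Ioo (D.a 0) D.psiInvZero))
    (σ : Equiv.Perm (Fin N)) :
    StrictMonoOn (D.bid N) (Set.Icc D.lo D.hi) ∧
    D.IsSymmetricEquilibrium σ (D.bid N) ∧
    Integrable (D.auctionRevenue σ (D.bid N)) (D.jointLaw N) ∧
    IsGreatest
      {R : ℝ | ∃ M : D.DirectMechanism N,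
        M.IncentiveCompatible ∧ M.IndividuallyRational ∧ M.revenue = R}
      (∫ x, D.auctionRevenue σ (D.bid N) x ∂(D.jointLaw N)) ∧
    ∫ x, D.auctionRevenue σ (D.bid N) x ∂(D.jointLaw N) =
      ∫ x, max (D.psi (kthHighest Finset.univ x 2) + kthHighest Finset.univ x 2
        - kthHighest Finset.univ x 3) 0 ∂(D.jointLaw N) := by
  have hae := ValueDistribution.auctionRevenue_ae_eq hN hψ hdiff σ
  set M := ValueDistribution.optimalMechanism hN hψ hdiff with hM
  have hIC : M.IncentiveCompatible :=
    ValueDistribution.optimalMechanism_incentiveCompatible hN hψ hdiff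
  have hrev : ∫ x, D.auctionRevenue σ (D.bid N) x ∂(D.jointLaw N) = M.revenue :=
    integral_congr_ae hae
  have hopt := ValueDistribution.optimalMechanism_revenue hN hψ hdiff
  refine ⟨D.bid_strictMonoOn hN hψ hdiff,
    ValueDistribution.isSymmetricEquilibrium_bid hN hψ hdiff σ,
    (integrable_finsetSum _ fun i _ => M.integrable_t i).congr hae.symm, ⟨?_, ?_⟩, hrev.trans hopt⟩
  · exact ⟨M, hIC, ValueDistribution.optimalMechanism_individuallyRational hN hψ hdiff, hrev.symm⟩
  · rintro R ⟨M', h1, h2, rfl⟩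
    rw [hrev, hopt]
    exact M'.revenue_le hN hψ h1 h2
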